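/- **Setting.** Let $X$ be a smooth simply connected $4$-manifold without boundary, and let $\Sigma\subset X$ be a smoothly embedded closed connected surface with $\pi_1(X-\Sigma)\cong\mathbb Z/d$. Let $\alpha\subset\Sigma$ be a closed curve with a smooth trivialization $\sigma\colon S^1\times B^3\to X$, where $B^3\subset\mathbb R\times\mathbb C$ is the unit ball, of a tubular neighbourhood of $\alpha=\sigma(S^1\times 0)$. Here $\sigma$ extends to a smooth open embedding of $S^1\times\mathbb R\times\mathbb C$ in which $\Sigma$ corresponds to $S^1\times\mathbb R\times 0$; in particular $\sigma^{-1}(\Sigma)=S^1\times I$ for the diameter $I=B^3\cap(\mathbb R\times 0)$. Assume that for some unit vector $p\in\partial D^2\subset\mathbb C$ the push-off $\alpha'=\sigma(S^1\times(0,p))$ is null-homologous in $X-\Sigma$. Let $K\subset S^3$ be a smooth knot with a trivialized tubular neighbourhood $K\times\mathbb C\subset S^3$. Let $D^2\subset\mathbb C$ be the unit disc and let $E(K)$ be the closure of $S^3-K\times D^2$. Let $K\times\partial D^2\times[0,1]$ be the collar of $\partial E(K)=K\times\partial D^2\times 0$ in $E(K)$ formed by the points $(x,(1+t)e^{i\theta})$.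 The *twist map* $\tau\colon(S^3,K)\to(S^3,K)$ is $$\tau(x,e^{i\theta},t)=(x,e^{i(\theta+2\pi t)},t)$$ on the collar and the identity elsewhere. Let $(B^3,K_+)$ be the knotted ball pair obtained from $(S^3,K)$ by removing the interior of a standard unknotted ball pair $(B_-,K_-)$ with $B_-\subset K\times D^2$ disjoint from the collar. Then $\tau$ restricts to $(B^3,K_+)$ and is the identity on $\partial B^3$. For $m\in\mathbb Z$ the $m$-twist rim surgery is $$(X,\Sigma_K(m))=\bigl((X,\Sigma)-S^1\times(B^3,I)\bigr)\cup_\partial S^1\times_{\tau^m}(B^3,K_+),$$ where $S^1\times_{\tau^m}(B^3,K_+)=(B^3,K_+)\times[0,1]/(x,0)\sim(\tau^m x,1)$, and where the boundary pairs $\partial(B^3,I)$ and $\partial(B^3,K_+)=\partial(B_-,K_-)$ are identified by the standard identification $(B^3,I)\cong(B_-,K_-)$. **Lemma.** Let the base point $*$ be in $\partial E(K)=K\times\partial D^2$, and let $\mu\in\pi_1(B^3-K_+,*)$ be the meridian of $K_+$ through $*$. Then $$\pi_1(X-\Sigma_K(m),*)=\bigl\langle\,\pi_1(B^3-K_+,*)\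 \big|\ \mu^d=1,\ \beta=\tau_*^m(\beta)\text{ for all }\beta\in\pi_1(B^3-K_+,*)\,\bigr\rangle .$$ That is, the inclusion of a fibre $B^3-K_+$ of $S^1\times_{\tau^m}(B^3-K_+)$ into $X-\Sigma_K(m)$ induces an isomorphism from the quotient of $\pi_1(B^3-K_+,*)$ by the normal closure of $\mu^d$ and all $\beta^{-1}\tau_*^m(\beta)$ onto $\pi_1(X-\Sigma_K(m),*)$. -/

import Mathlib

open scoped Manifold ContDiff

noncomputable section

/-! ### Singular chains and null-homologous loops -/

/-- The group of integral singular `n`-chains of `Y`. -/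
abbrev SingChain (n : ℕ) (Y : Type*) [TopologicalSpace Y] :=
  C(stdSimplex ℝ (Fin (n + 1)), Y) →₀ ℤ

/-- The `i`-th face of the standard simplex, as a continuous map. -/
def faceMap (n : ℕ) (i : Fin (n + 2)) :
    C(stdSimplex ℝ (Fin (n + 1)), stdSimplex ℝ (Fin (n + 2))) :=
  ⟨stdSimplex.map i.succAbove, stdSimplex.continuous_map _⟩

/-- The singular boundary operator, the alternating sum of the faces. -/
def singBoundary (n : ℕ) {Y : Type*} [TopologicalSpace Y] (c : SingChain (n + 1) Y) :
    SingChain n Y :=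
  c.sum fun s a => ∑ i : Fin (n + 2), Finsupp.single (s.comp (faceMap n i)) ((-1) ^ (i : ℕ) * a)

/-- The singular `1`-simplex that runs once around a loop `γ : S¹ → Y`. -/
def loopSimplex {Y : Type*} [TopologicalSpace Y] (γ : C(Circle, Y)) :
    C(stdSimplex ℝ (Fin 2), Y) :=
  ⟨fun w => γ (Circle.exp (2 * Real.pi * (w : Fin 2 → ℝ) 1)),
    γ.continuous.comp (Circle.exp.continuous.comp
      (continuous_const.mul ((continuous_apply 1).comp continuous_subtype_val)))⟩

/-- A loop is null-homologous if its class in the integral singular homology `H₁(Y)` vanishes,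
that is, if it is the boundary of an integral singular `2`-chain. -/
def NullHomologous {Y : Type*} [TopologicalSpace Y] (γ : C(Circle, Y)) : Prop :=
  ∃ c : SingChain 2 Y, singBoundary 1 c = Finsupp.single (loopSimplex γ) 1

/-! ### The round ball pair

We write `ℝ³` as `ℝ × ℂ`.  The unit ball `B³` consists of the `(s, u)` with `s² + |u|² ≤ 1`; its
unknotted arc `I` is the diameter `u = 0`. -/

/-- The square of the Euclidean norm on `ℝ³ = ℝ × ℂ`. -/
def eucSq (v : ℝ × ℂ) : ℝ := v.1 ^ 2 + ‖v.2‖ ^ 2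

/-- The `3`-sphere. -/
abbrev S3 := Metric.sphere (0 : EuclideanSpace ℝ (Fin 4)) 1

/-! ### Knots, knotted arcs and the twist map -/

/-- A smooth knot `K` in `S³`, with a trivialized open tubular neighbourhood: a smooth open
embedding `S¹ × ℂ → S³` whose core `S¹ × 0` is the knot.  Any framing is allowed. -/
structure TubedKnot where
  /-- the trivialization of the tubular neighbourhood -/
  toFun : Circle × ℂ → S3
  injective : Function.Injective toFun
  isLocalDiffeomorph :
    IsLocalDiffeomorph ((𝓡 1).prod 𝓘(ℝ, ℂ)) (𝓡 3) ∞ toFun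

namespace TubedKnot

variable (N : TubedKnot)

theorem isOpenEmbedding : Topology.IsOpenEmbedding N.toFun :=
  .of_continuous_injective_isOpenMap N.isLocalDiffeomorph.contMDiff.continuous N.injective
    N.isLocalDiffeomorph.isOpenMap

theorem continuous : Continuous N.toFun := N.isOpenEmbedding.continuous

/-- The knot `K`. -/
def knot : Set S3 := Set.range fun z => N.toFun (z, 0)

/-- `t` if `0 ≤ t ≤ 1`, extended by the constants `0` and `1`. -/
def clamp (t : ℝ) : ℝ := max 0 (min 1 t)

/-- In the coordinates `(x, u) ∈ S¹ × ℂ` of the tubular neighbourhood, the normal disc bundle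
`K × D²` is `|u| ≤ 1` and the collar `K × ∂D² × [0,1]` of the boundary of the exterior of `K` is
`1 ≤ |u| ≤ 2`, with collar parameter `t = |u| - 1`.  This map rotates `u` through the angle
`c · 2πt` on the collar, through `0` on the disc bundle, and through `c · 2π` beyond the collar. -/
def twistLocal (c : ℝ) (p : Circle × ℂ) : Circle × ℂ :=
  (p.1, Circle.exp (c * (2 * Real.pi * clamp (‖p.2‖ - 1))) * p.2)

open Classical in
/-- The map of `S³` that is `twistLocal c` on the tubular neighbourhood and the identity
elsewhere. -/
def twistFun (c : ℝ) (y : S3) : S3 :=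
  if h : ∃ p, N.toFun p = y then N.toFun (twistLocal c h.choose) else y

theorem twistFun_apply (c : ℝ) (p : Circle × ℂ) :
    N.twistFun c (N.toFun p) = N.toFun (twistLocal c p) := by
  have h : ∃ q, N.toFun q = N.toFun p := ⟨p, rfl⟩
  rw [twistFun, dif_pos h, N.injective h.choose_spec]

theorem twistFun_of_notMem (c : ℝ) {y : S3} (h : ¬ ∃ p, N.toFun p = y) :
    N.twistFun c y = y := by rw [twistFun, dif_neg h]

theorem twistLocal_of_norm_le (c : ℝ) {p : Circle × ℂ} (h : ‖p.2‖ ≤ 1) :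
    twistLocal c p = p := by
  have : clamp (‖p.2‖ - 1) = 0 := by
    rw [clamp, max_eq_left]; exact (min_le_right _ _).trans (by linarith)
  simp [twistLocal, this]

theorem twistLocal_of_le_norm {c : ℝ} (hc : c = 1 ∨ c = -1) {p : Circle × ℂ} (h : 2 ≤ ‖p.2‖) :
    twistLocal c p = p := by
  have : clamp (‖p.2‖ - 1) = 1 := by
    rw [clamp, min_eq_left (by linarith)]; norm_num
  rcases hc with rfl | rfl <;> simp [twistLocal, this, Circle.exp_neg]

theorem twistLocal_neg (c : ℝ) (p : Circle × ℂ) : twistLocal (-c) (twistLocal c p) = p := by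
  have h : ‖(twistLocal c p).2‖ = ‖p.2‖ := by
    simp only [twistLocal, norm_mul, Circle.norm_coe, one_mul]
  rw [twistLocal, h]
  refine Prod.ext rfl ?_
  simp [twistLocal, Circle.exp_neg]

theorem twistFun_neg (c : ℝ) (y : S3) : N.twistFun (-c) (N.twistFun c y) = y := by
  by_cases h : ∃ p, N.toFun p = y
  · obtain ⟨p, rfl⟩ := h
    rw [twistFun_apply, twistFun_apply, twistLocal_neg]
  · rw [N.twistFun_of_notMem c h, N.twistFun_of_notMem _ h]

theorem continuous_twistFun {c : ℝ} (hc : c = 1 ∨ c = -1) : Continuous (N.twistFun c) := by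
  have hloc : Continuous (twistLocal c) := by unfold twistLocal clamp; fun_prop
  rw [continuous_iff_continuousAt]
  intro y
  by_cases h : ∃ p, N.toFun p = y
  · obtain ⟨p, rfl⟩ := h
    rw [← N.isOpenEmbedding.continuousAt_iff]
    have : N.twistFun c ∘ N.toFun = N.toFun ∘ twistLocal c :=
      funext fun p => N.twistFun_apply c p
    rw [this]
    exact (N.continuous.comp hloc).continuousAt
  · have hK : IsCompact (N.toFun '' (Set.univ ×ˢ Metric.closedBall (0 : ℂ) 2)) :=
      (isCompact_univ.prod (isCompact_closedBall _ _)).image N.continuous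
    have hy : (N.toFun '' (Set.univ ×ˢ Metric.closedBall (0 : ℂ) 2))ᶜ ∈ nhds y := by
      refine hK.isClosed.isOpen_compl.mem_nhds ?_
      rintro ⟨p, -, hp⟩
      exact h ⟨p, hp⟩
    refine continuousAt_id.congr ?_
    filter_upwards [hy] with x hx
    by_cases hx' : ∃ p, N.toFun p = x
    · obtain ⟨p, rfl⟩ := hx'
      have hp : 2 ≤ ‖p.2‖ := by
        by_contra hlt
        exact hx ⟨p, ⟨trivial, by simpa using (not_le.mp hlt).le⟩, rfl⟩
      rw [twistFun_apply, twistLocal_of_le_norm hc hp]; rfl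
    · rw [N.twistFun_of_notMem c hx']; rfl

/-- The twist map `τ : (S³, K) → (S³, K)`: on the collar it is
`(x, e^{iθ}, t) ↦ (x, e^{i(θ + 2πt)}, t)`, and it is the identity off the collar. -/
def twist : S3 ≃ₜ S3 where
  toFun := N.twistFun 1
  invFun := N.twistFun (-1)
  left_inv := N.twistFun_neg 1
  right_inv y := by simpa using N.twistFun_neg (-1) y
  continuous_toFun := N.continuous_twistFun (.inl rfl)
  continuous_invFun := N.continuous_twistFun (.inr rfl)

/-- A chart of `ℝ³ = ℝ × ℂ` near the point `K(1)`, which takes the pair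
`(B³, I)` to an unknotted ball pair `(B₋, K₋)` inside the disc bundle `K × D²`. -/
def ballChart (v : ℝ × ℂ) : S3 := N.toFun (Circle.exp (v.1 / 2), v.2 / 2)

/-- The interior of the ball `B₋`. -/
def removedBall : Set S3 := N.ballChart '' {v | eucSq v < 1}

theorem continuous_ballChart : Continuous N.ballChart :=
  N.continuous.comp (by fun_prop)

theorem norm_half_le {v : ℝ × ℂ} (hv : eucSq v ≤ 1) : ‖v.2 / 2‖ ≤ 1 / 2 := by
  unfold eucSq at hv
  have : ‖v.2‖ ≤ 1 := by nlinarith [sq_nonneg v.1, norm_nonneg v.2]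
  simp only [norm_div, Complex.norm_ofNat]; linarith

theorem ballChart_injOn : Set.InjOn N.ballChart {v | eucSq v ≤ 1} := by
  intro v hv w hw h
  have h' := N.injective h
  simp only [Prod.mk.injEq] at h'
  have hb : ∀ x : ℝ × ℂ, eucSq x ≤ 1 → x.1 / 2 ∈ Set.Ioc (-Real.pi) Real.pi := by
    intro x hx
    unfold eucSq at hx
    have h1 : |x.1| ≤ 1 := by rw [← sq_le_one_iff_abs_le_one]; nlinarith [sq_nonneg ‖x.2‖]
    have := abs_le.mp h1
    constructor <;> linarith [Real.pi_gt_three]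
  refine Prod.ext ?_ ?_
  · have h1 := congrArg (fun z : Circle => Complex.arg z) h'.1
    simp only [Circle.arg_exp (hb v hv).1 (hb v hv).2, Circle.arg_exp (hb w hw).1 (hb w hw).2] at h1
    linarith
  · linear_combination 2 * h'.2

theorem ballChart_notMem {v : ℝ × ℂ} (hv : eucSq v = 1) : N.ballChart v ∉ N.removedBall := by
  rintro ⟨w, hw, h⟩
  have hw' : eucSq w < 1 := hw
  have := N.ballChart_injOn hw'.le hv.le h
  subst this
  exact absurd hv hw'.ne

theorem notMem_removedBall {z : Circle} {u : ℂ} (hu : 1 ≤ ‖u‖) :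
    N.toFun (z, u) ∉ N.removedBall := by
  rintro ⟨w, hw, h⟩
  have h2 := congrArg Prod.snd (N.injective h)
  have := norm_half_le (le_of_lt (show eucSq w < 1 from hw))
  simp only at h2
  rw [h2] at this
  linarith

theorem notMem_knot {z : Circle} {u : ℂ} (hu : u ≠ 0) : N.toFun (z, u) ∉ N.knot := by
  rintro ⟨w, h⟩
  exact hu (congrArg Prod.snd (N.injective h)).symm

theorem twist_of_norm_le {p : Circle × ℂ} (h : ‖p.2‖ ≤ 1) :
    N.twist (N.toFun p) = N.toFun p := by
  change N.twistFun 1 _ = _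
  rw [twistFun_apply, twistLocal_of_norm_le _ h]

theorem notMem_iff_twist {A : Set S3} (hA : ∀ x ∈ A, N.twist x = x) (y : S3) :
    y ∉ A ↔ N.twist y ∉ A := by
  refine not_congr ⟨fun h => by rwa [hA y h], fun h => ?_⟩
  have : N.twist y = y := N.twist.injective (hA _ h)
  rwa [this] at h

theorem twist_knot : ∀ x ∈ N.knot, N.twist x = x := by
  rintro _ ⟨z, rfl⟩
  exact N.twist_of_norm_le (by simp)

theorem twist_removedBall : ∀ x ∈ N.removedBall, N.twist x = x := by
  rintro _ ⟨v, hv, rfl⟩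
  exact N.twist_of_norm_le
    ((norm_half_le (le_of_lt (show eucSq v < 1 from hv))).trans (by norm_num))

/-- The ball `B³` of the ball pair `(B³, K₊)`, the complement in `S³` of the interior of `B₋`. -/
abbrev Ball := {y : S3 // y ∉ N.removedBall}

/-- The complement `B³ - K₊` of the knotted arc `K₊ = K ∩ B³`. -/
abbrev ArcCompl := {y : S3 // y ∉ N.removedBall ∧ y ∉ N.knot}

/-- The twist map of `B³`. -/
def twistBall : N.Ball ≃ₜ N.Ball :=
  N.twist.subtype (N.notMem_iff_twist N.twist_removedBall)

/-- The twist map of `B³ - K₊`. -/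
def twistArc : N.ArcCompl ≃ₜ N.ArcCompl :=
  N.twist.subtype fun y => and_congr (N.notMem_iff_twist N.twist_removedBall y)
    (N.notMem_iff_twist N.twist_knot y)

/-- The point `z × u` of the torus `∂E(K) = K × ∂D²`, as a point of `B³ - K₊`. -/
def torusPoint (z u : Circle) : N.ArcCompl :=
  ⟨N.toFun (z, u), N.notMem_removedBall u.norm_coe.ge, N.notMem_knot u.coe_ne_zero⟩

theorem continuous_torusPoint (z : Circle) : Continuous (N.torusPoint z) := by
  unfold torusPoint
  exact Continuous.subtype_mk (N.continuous.comp (by fun_prop)) _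

/-- The meridian `μ` of `K₊` based at `z × u`: the loop that runs once around `z × ∂D²`. -/
def meridian (z u : Circle) : FundamentalGroup N.ArcCompl (N.torusPoint z u) :=
  FundamentalGroup.fromPath <| Path.Homotopic.Quotient.mk
    { toFun := fun t => N.torusPoint z (Circle.exp (2 * Real.pi * t) * u)
      continuous_toFun := (N.continuous_torusPoint z).comp (by fun_prop)
      source' := by simp
      target' := by simp }

theorem twistArc_zpow_torusPoint (m : ℤ) (z u : Circle) :
    (N.twistArc ^ m) (N.torusPoint z u) = N.torusPoint z u := by
  have h1 : N.twistArc (N.torusPoint z u) = N.torusPoint z u :=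
    Subtype.ext (N.twist_of_norm_le (p := (z, (u : ℂ))) u.norm_coe.le)
  have h2 : N.twistArc⁻¹ (N.torusPoint z u) = N.torusPoint z u :=
    N.twistArc.symm_apply_eq.mpr h1.symm
  induction m with
  | zero => rfl
  | succ n ih => rw [zpow_add_one]; change (N.twistArc ^ (n : ℤ)) (N.twistArc _) = _; rw [h1, ih]
  | pred n ih =>
    rw [zpow_sub_one]; change (N.twistArc ^ (-(n : ℤ))) (N.twistArc⁻¹ _) = _; rw [h2, ih]

/-- The automorphism `τ_*^m = (τ^m)_*` of `π₁(B³ - K₊, z × u)`. -/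
def twistStar (m : ℤ) (z u : Circle) :
    FundamentalGroup N.ArcCompl (N.torusPoint z u) →*
      FundamentalGroup N.ArcCompl (N.torusPoint z u) :=
  FundamentalGroup.mapOfEq (⟨N.twistArc ^ m, (N.twistArc ^ m).continuous⟩ : C(_, _))
    (N.twistArc_zpow_torusPoint m z u)

/-- The relators `μ^d` and `β⁻¹ τ_*^m(β)`. -/
def relators (m : ℤ) (d : ℕ) (z u : Circle) :
    Set (FundamentalGroup N.ArcCompl (N.torusPoint z u)) :=
  {N.meridian z u ^ d} ∪ Set.range fun β => β⁻¹ * N.twistStar m z u β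

end TubedKnot

/-! ### Twist rim surgery -/

section Surgery

variable {X : Type*} [TopologicalSpace X] [ChartedSpace (EuclideanSpace ℝ (Fin 4)) X]

/-- A trivialization of the normal bundle of a closed curve `α` of a surface `F` in `X`: a smooth
open embedding `σ : S¹ × ℝ × ℂ → X` such that `F` corresponds to `S¹ × ℝ × 0`.  The curve `α` is
`σ(S¹ × 0 × 0)`, and `σ` takes `S¹ × (B³, I)` to a neighbourhood pair of `α` in `(X, F)`. -/
structure CurveTriv (F : Set X) where
  /-- the trivialization -/
  toFun : Circle × (ℝ × ℂ) → X
  injective : Function.Injective toFun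
  isLocalDiffeomorph :
    IsLocalDiffeomorph ((𝓡 1).prod 𝓘(ℝ, ℝ × ℂ)) (𝓡 4) ∞ toFun
  mem_iff : ∀ z s u, toFun (z, (s, u)) ∈ F ↔ u = 0

variable {F : Set X} (σ : CurveTriv F) (N : TubedKnot) (m : ℤ)

namespace CurveTriv

/-- The push-off `α'` of `α` in `X - F`, in the normal direction `p ∈ ∂D²`. -/
def pushOff (p : Circle) : C(Circle, {x : X // x ∉ F}) where
  toFun z := ⟨σ.toFun (z, (0, p)), fun h => p.coe_ne_zero ((σ.mem_iff _ _ _).mp h)⟩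
  continuous_toFun :=
    (σ.isLocalDiffeomorph.contMDiff.continuous.comp (by fun_prop)).subtype_mk _

/-- `X - S¹ × int B³`. -/
abbrev Outer := {x : X // x ∉ σ.toFun '' {q | eucSq q.2 < 1}}

/-- The point `σ(z, v)` of `S¹ × ∂B³`, as a point of `X - S¹ × int B³`. -/
def outerPoint (z : Circle) (v : ℝ × ℂ) (hv : eucSq v = 1) : σ.Outer :=
  ⟨σ.toFun (z, v), by
    rintro ⟨q, hq, h⟩
    have := σ.injective h
    subst this
    exact absurd hv (ne_of_lt hq)⟩

/-- The gluing relation that defines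
`X - S¹ × B³ ∪ S¹ ×_{τ^m} B³` as a quotient of the disjoint union of `X - S¹ × int B³` and
`B³ × [0,1]`. -/
inductive Glue : σ.Outer ⊕ (N.Ball × unitInterval) → σ.Outer ⊕ (N.Ball × unitInterval) → Prop
  /-- the mapping torus `S¹ ×_{τ^m} B³ = B³ × [0,1] / (x, 0) ∼ (τ^m x, 1)` -/
  | wrap (x : N.Ball) : Glue (Sum.inr (x, 0)) (Sum.inr ((N.twistBall ^ m) x, 1))
  /-- the two pieces are glued along `S¹ × ∂B³`; the spheres `∂B³` and `∂B₋` are identified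
  through the chart of `B₋`, which takes `∂I` to `∂K₊` -/
  | bdry (t : unitInterval) (v : ℝ × ℂ) (hv : eucSq v = 1) :
      Glue (Sum.inl (σ.outerPoint (Circle.exp (2 * Real.pi * t)) v hv))
        (Sum.inr (⟨N.ballChart v, N.ballChart_notMem hv⟩, t))

/-- The ambient space `X - S¹ × B³ ∪ S¹ ×_{τ^m} B³` of the surgered surface, with the quotient
topology. -/
abbrev Surgered := Quot (σ.Glue N m)

/-- The surface `F_K(m)` obtained by `m`-twist rim surgery: the union of the images of
`F - S¹ × int I` and of `S¹ ×_{τ^m} K₊`. -/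
def surface : Set (σ.Surgered N m) :=
  (fun x => Quot.mk (σ.Glue N m) (Sum.inl x)) '' {x : σ.Outer | (x : X) ∈ F} ∪
  (fun y => Quot.mk (σ.Glue N m) (Sum.inr y)) '' {y : N.Ball × unitInterval | (y.1 : S3) ∈ N.knot}

/-- The complement `X - F_K(m)`. -/
abbrev SurfaceCompl := {y : σ.Surgered N m // y ∉ σ.surface N m}

/-- Whether a point of the disjoint union lies over the surgered surface. -/
def overSurface : σ.Outer ⊕ (N.Ball × unitInterval) → Prop :=
  Sum.elim (fun x => (x : X) ∈ F) fun y => (y.1 : S3) ∈ N.knot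

theorem twistBall_zpow_mem_knot (x : N.Ball) :
    (((N.twistBall ^ m) x : N.Ball) : S3) ∈ N.knot ↔ (x : S3) ∈ N.knot := by
  have h1 : ∀ x : N.Ball, ((N.twistBall x : N.Ball) : S3) ∈ N.knot ↔ (x : S3) ∈ N.knot :=
    fun x => not_iff_not.mp (N.notMem_iff_twist N.twist_knot x).symm
  have h2 : ∀ x : N.Ball, ((N.twistBall⁻¹ x : N.Ball) : S3) ∈ N.knot ↔ (x : S3) ∈ N.knot := by
    intro x
    have : N.twistBall (N.twistBall⁻¹ x) = x := N.twistBall.apply_symm_apply x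
    rw [← h1 (N.twistBall⁻¹ x), this]
  induction m generalizing x with
  | zero => rfl
  | succ n ih =>
    rw [zpow_add_one]; change (((N.twistBall ^ (n : ℤ)) (N.twistBall x) : N.Ball) : S3) ∈ _ ↔ _
    exact (ih _).trans (h1 x)
  | pred n ih =>
    rw [zpow_sub_one]
    change (((N.twistBall ^ (-(n : ℤ))) (N.twistBall⁻¹ x) : N.Ball) : S3) ∈ _ ↔ _
    exact (ih _).trans (h2 x)

theorem overSurface_iff_of_glue {a b : σ.Outer ⊕ (N.Ball × unitInterval)} (h : σ.Glue N m a b) :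
    σ.overSurface N a ↔ σ.overSurface N b := by
  cases h with
  | wrap x => exact (twistBall_zpow_mem_knot N m x).symm
  | bdry t v hv =>
    have h1 : σ.overSurface N (Sum.inl (σ.outerPoint (Circle.exp (2 * Real.pi * t)) v hv)) ↔
        v.2 = 0 := σ.mem_iff _ v.1 v.2
    rw [h1]
    constructor
    · intro h
      exact ⟨Circle.exp (v.1 / 2), by simp [TubedKnot.ballChart, h]⟩
    · intro h
      by_contra hne
      exact N.notMem_knot (u := v.2 / 2) (by simpa using hne) h

theorem mk_mem_surface_iff (a : σ.Outer ⊕ (N.Ball × unitInterval)) :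
    Quot.mk (σ.Glue N m) a ∈ σ.surface N m ↔ σ.overSurface N a := by
  let P : σ.Surgered N m → Prop :=
    Quot.lift (σ.overSurface N) fun _ _ h => propext (σ.overSurface_iff_of_glue N m h)
  constructor
  · rintro (⟨x, hx, h⟩ | ⟨y, hy, h⟩)
    · exact (congrArg P h).mp hx
    · exact (congrArg P h).mp hy
  · intro h
    rcases a with x | y
    · exact .inl ⟨x, h, rfl⟩
    · exact .inr ⟨y, h, rfl⟩

/-- The inclusion of `B³ - K₊` in `X - F_K(m)`, as the fibre over `0` of
`S¹ ×_{τ^m} (B³ - K₊)`. -/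
def fibreIncl : C(N.ArcCompl, σ.SurfaceCompl N m) where
  toFun y := ⟨Quot.mk _ (Sum.inr (⟨y, y.2.1⟩, 0)), by
    rw [mk_mem_surface_iff]; exact y.2.2⟩
  continuous_toFun := by
    refine Continuous.subtype_mk (continuous_quot_mk.comp (continuous_inr.comp ?_)) _
    exact (continuous_subtype_val.subtype_mk _).prodMk continuous_const

end CurveTriv

end Surgery

end

noncomputable section

/-! ### Holonomies -/

open unitInterval

/-! The argument is van Kampen's theorem for the decomposition of the surgered complement into the
outer piece, where `X` is unchanged, and a neighbourhood of the mapping torus of `τ^m` on `B³ - K₊`.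
The two meet in a torus times a plane, whose fundamental group is generated by the meridian of the
surface and a push-off of `α`.

The outer piece contributes almost nothing. Since `X` is simply connected and the surface is
connected and of codimension two, the meridians normally generate the group of the complement of the
surface in `X`. That group is `ℤ/d`, so it is generated by one meridian, of order `d`. Since it is
commutative, the null-homologous push-off `α'` is trivial in it. The mapping torus has the group of
the fibre with one more generator `t` that conjugates `β` into `τ_*^m(β)`. The twist is the identity
on a region that joins the base point to `∂B³`, so `t` can be slid through this region onto `α'`;
hence `t = 1`. What remains is the group of the fibre with the relations `μ^d = 1` and `β =
τ_*^m(β)`.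

Homomorphisms out of fundamental groups are carried by holonomies, that is, functors from the
fundamental groupoid to a group, given by a single law for singular squares. Being functions of
paths, they can be pulled back, changed by a gauge and glued over open covers
(`Holonomy.exists_of_cover`) without tracking base points. The group of the outer piece itself is
never computed: its interior lies in the complement of the surface in `X`, and a radial retraction
maps that complement back to the outer piece (`CurveTriv.collapse`). This is enough to move
holonomies in both directions.

Three statements give the isomorphism. The relators die in the surgered complement
(`CurveTriv.normalClosure_relators_le_ker`). A homomorphism back to the quotient, left inverse to
the induced map, comes from gluing a holonomy on the mapping torus to one on the outer piece
(`CurveTriv.exists_hom`). Surjectivity comes from a global parallel section of the cosets of the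
image of the fibre group (`CurveTriv.surjective_map_fibreIncl`). -/

/-- The straight segment from `a` to `b`. -/
def segMap {E : Type*} [NormedAddCommGroup E] [NormedSpace ℝ E] (a b : E) : C(I, E) where
  toFun t := AffineMap.lineMap a b (t : ℝ)
  continuous_toFun := by
    simp only [AffineMap.lineMap_apply_module]
    fun_prop

theorem segMap_apply {E : Type*} [NormedAddCommGroup E] [NormedSpace ℝ E] (a b : E) (t : I) :
    segMap a b t = (1 - (t : ℝ)) • a + (t : ℝ) • b := AffineMap.lineMap_apply_module _ _ _

/-- The bottom edge of a square. -/
def edgeB : C(I, I × I) := ⟨fun s => (s, 0), by fun_prop⟩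
/-- The top edge of a square. -/
def edgeT : C(I, I × I) := ⟨fun s => (s, 1), by fun_prop⟩
/-- The left edge of a square. -/
def edgeL : C(I, I × I) := ⟨fun t => (0, t), by fun_prop⟩
/-- The right edge of a square. -/
def edgeR : C(I, I × I) := ⟨fun t => (1, t), by fun_prop⟩

section

variable {Y Z G : Type*} [TopologicalSpace Y] [TopologicalSpace Z] [Group G]

/-- A function `v` of paths is compatible with a singular square. -/
def SquareLaw (v : C(I, Y) → G) (H : C(I × I, Y)) : Prop :=
  v (H.comp edgeR) * v (H.comp edgeB) = v (H.comp edgeT) * v (H.comp edgeL)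

variable (Y G) in
/-- A `G`-valued holonomy on `Y`: a functor from the fundamental groupoid of `Y` to `G`, presented
as a function of paths that is trivial on constant paths and satisfies the law of squares. -/
structure Holonomy where
  /-- the value on a path -/
  toFun : C(I, Y) → G
  const' : ∀ y, toFun (.const I y) = 1
  square' : ∀ H : C(I × I, Y), SquareLaw toFun H

instance : CoeFun (Holonomy Y G) fun _ => C(I, Y) → G := ⟨Holonomy.toFun⟩

/-- The triangle law follows from the law of squares on a convex set. -/
theorem seg_mul_of_squareLaw {E : Type*} [NormedAddCommGroup E] [NormedSpace ℝ E]
    {v : C(I, Y) → G} (h1 : ∀ y, v (.const I y) = 1) {U : Set Y}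
    (h2 : ∀ H : C(I × I, Y), (∀ p, H p ∈ U) → SquareLaw v H) {K : Set E} (hK : Convex ℝ K)
    (f : C(E, Y)) (hf : ∀ x ∈ K, f x ∈ U) {a b c : E} (ha : a ∈ K) (hb : b ∈ K) (hc : c ∈ K) :
    v (f.comp (segMap b c)) * v (f.comp (segMap a b)) = v (f.comp (segMap a c)) := by
  -- A square with its left side collapsed to `a`: the bottom is `ab`, the right side is `bc` and
  -- the top is `ac`.
  let T : C(I × I, E) := ⟨fun p => (1 - (p.1 : ℝ)) • a + (p.1 : ℝ) • segMap b c p.2, by fun_prop⟩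
  have hT : ∀ p, (f.comp T) p ∈ U := by
    intro p
    refine hf _ (hK ha ?_ (by have := p.1.2.2; simp [this]) p.1.2.1 (by ring))
    rw [segMap_apply]
    exact hK hb hc (by have := p.2.2.2; simp [this]) p.2.2.1 (by ring)
  have h := h2 (f.comp T) hT
  unfold SquareLaw at h
  have e1 : (f.comp T).comp edgeR = f.comp (segMap b c) := by
    ext t; simp [T, edgeR]
  have e2 : (f.comp T).comp edgeB = f.comp (segMap a b) := by
    ext t; simp [T, edgeB, segMap_apply]
  have e3 : (f.comp T).comp edgeT = f.comp (segMap a c) := by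
    ext t; simp [T, edgeT, segMap_apply]
  have e4 : (f.comp T).comp edgeL = .const I (f a) := by
    ext t; simp [T, edgeL]
  rw [e1, e2, e3, e4, h1, mul_one] at h
  exact h

namespace Primitive

/-- `f` is a primitive along `K` of the local transport `g`. -/
def IsPrimitive {E : Type*} [PseudoMetricSpace E] (g : E → E → G) (K : Set E) (f : E → G) : Prop :=
  ∃ δ > 0, ∀ a ∈ K, ∀ b ∈ K, dist a b < δ → f b = g a b * f a

/-- Uniqueness of primitives up to a constant on the right: a small step multiplies `f` and `f'` on
the left by the same element, so `f⁻¹ f'` is locally constant. -/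
theorem IsPrimitive.inv_mul_eq {E : Type*} [PseudoMetricSpace E] {g : E → E → G} {K : Set E} (hK : IsPreconnected K) {f f' : E → G}
    (hf : IsPrimitive g K f) (hf' : IsPrimitive g K f') {a b : E} (ha : a ∈ K) (hb : b ∈ K) :
    (f a)⁻¹ * f' a = (f b)⁻¹ * f' b := by
  have : PreconnectedSpace K := Subtype.preconnectedSpace hK
  obtain ⟨δ, hδ, h⟩ := hf
  obtain ⟨δ', hδ', h'⟩ := hf'
  have : IsLocallyConstant fun x : K => (f x)⁻¹ * f' x := by
    rw [IsLocallyConstant.iff_eventually_eq]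
    intro x
    filter_upwards [Metric.ball_mem_nhds x (lt_min hδ hδ')] with y hy
    rw [Metric.mem_ball, dist_comm, lt_min_iff] at hy
    rw [h x x.2 y y.2 hy.1, h' x x.2 y y.2 hy.2]
    group
  exact this.apply_eq_of_preconnectedSpace ⟨a, ha⟩ ⟨b, hb⟩

variable {E : Type*} [NormedAddCommGroup E] [NormedSpace ℝ E]

/-- The transport along the first `k` of `n` equal pieces of the segment from `a` to `b`. -/
def polygon (g : E → E → G) (a : E) (n : ℕ) (b : E) : ℕ → G
  | 0 => 1
  | k + 1 => g (AffineMap.lineMap a b ((k : ℝ) / n)) (AffineMap.lineMap a b (((k + 1 : ℕ) : ℝ) / n))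
      * polygon g a n b k

/-- The primitive at `b` is the transport from a fixed point `a` along the segment to `b`, cut into
short pieces. When `b` moves slightly, the old and the new segment bound a ladder of thin
quadrilaterals, and each of them is two triangles to which `hg` applies. -/
theorem exists_isPrimitive {g : E → E → G} {K : Set E} (hK : Convex ℝ K)
    (hb : Bornology.IsBounded K) {δ : ℝ} (hδ : 0 < δ)
    (hg : ∀ a ∈ K, ∀ b ∈ K, ∀ c ∈ K, dist a b < δ → dist b c < δ → dist a c < δ →
      g b c * g a b = g a c) : ∃ f, IsPrimitive g K f := by
  rcases K.eq_empty_or_nonempty with rfl | ⟨a, ha⟩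
  · exact ⟨1, 1, one_pos, by simp⟩
  obtain ⟨D, hD⟩ := hb.exists_norm_le
  -- The points of `K` are at most `2 * D` apart, so each of the `n` pieces is shorter than `δ / 2`.
  -- The other half of `δ` is left for the rungs of the ladder, so that the diagonals stay below
  -- `δ`.
  obtain ⟨n, hn⟩ := exists_nat_gt (max 1 (2 * D / (δ / 2)))
  have hn0 : (0 : ℝ) < n := (lt_of_lt_of_le one_pos (le_max_left _ _)).trans hn
  have hnD : 2 * D / n < δ / 2 := by
    rw [div_lt_iff₀ hn0]
    have := (le_max_right _ _).trans_lt hn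
    rw [div_lt_iff₀ (by positivity)] at this
    linarith
  have hmem : ∀ b ∈ K, ∀ k ≤ n, AffineMap.lineMap a b ((k : ℝ) / n) ∈ K := by
    intro b hb k hk
    refine hK.lineMap_mem ha hb ⟨by positivity, ?_⟩
    rw [div_le_one hn0]; exact_mod_cast hk
  have hone : ∀ x ∈ K, g x x = 1 := fun x hx => by
    have := hg x hx x hx x hx (by simpa) (by simpa) (by simpa)
    exact mul_eq_left.mp this
  refine ⟨fun b => polygon g a n b n, δ / 2, by positivity, fun b hbK b' hb'K hbb' => ?_⟩
  have key : ∀ k ≤ n, polygon g a n b' k =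
      g (AffineMap.lineMap a b ((k : ℝ) / n)) (AffineMap.lineMap a b' ((k : ℝ) / n)) *
        polygon g a n b k := by
    intro k
    induction k with
    | zero => intro _; simp [polygon, hone a ha]
    | succ k ih =>
      intro hk
      have ih := ih (by omega)
      rw [polygon, ih, polygon, ← mul_assoc, ← mul_assoc]
      congr 1
      have hd1 : ∀ j ≤ n, dist (AffineMap.lineMap a b ((j : ℝ) / n) : E)
          (AffineMap.lineMap a b' ((j : ℝ) / n)) < δ / 2 := by
        intro j hj
        have : (AffineMap.lineMap a b ((j : ℝ) / n) : E) - AffineMap.lineMap a b' ((j : ℝ) / n) =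
            ((j : ℝ) / n) • (b - b') := by
          simp only [AffineMap.lineMap_apply_module]; module
        rw [dist_eq_norm, this, norm_smul, Real.norm_of_nonneg (by positivity), ← dist_eq_norm]
        refine lt_of_le_of_lt (mul_le_of_le_one_left dist_nonneg ?_) hbb'
        rw [div_le_one hn0]; exact_mod_cast hj
      have hd2 : ∀ x ∈ K, dist (AffineMap.lineMap a x ((k : ℝ) / n) : E)
          (AffineMap.lineMap a x (((k + 1 : ℕ) : ℝ) / n)) < δ / 2 := by
        intro x hx
        have : (AffineMap.lineMap a x ((k : ℝ) / n) : E) -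
            AffineMap.lineMap a x (((k + 1 : ℕ) : ℝ) / n) = (1 / n : ℝ) • (a - x) := by
          simp only [AffineMap.lineMap_apply_module]
          push_cast
          have : ((k : ℝ) + 1) / n = k / n + 1 / n := by ring
          rw [this]; module
        rw [dist_eq_norm, this, norm_smul, Real.norm_of_nonneg (by positivity)]
        refine lt_of_le_of_lt ?_ hnD
        have h1 : ‖a - x‖ ≤ 2 * D := (norm_sub_le _ _).trans (by linarith [hD a ha, hD x hx])
        calc 1 / (n : ℝ) * ‖a - x‖ ≤ 1 / n * (2 * D) := by gcongr
          _ = _ := by ring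
      have m1 := hmem b hbK k (by omega)
      have m2 := hmem b hbK (k + 1) hk
      have m3 := hmem b' hb'K k (by omega)
      have m4 := hmem b' hb'K (k + 1) hk
      have hd : dist (AffineMap.lineMap a b ((k : ℝ) / n) : E)
          (AffineMap.lineMap a b' (((k + 1 : ℕ) : ℝ) / n)) < δ := by
        refine (dist_triangle _ (AffineMap.lineMap a b (((k + 1 : ℕ) : ℝ) / n) : E) _).trans_lt ?_
        linarith [hd2 b hbK, hd1 (k + 1) hk]
      rw [hg _ m1 _ m3 _ m4 ((hd1 k (by omega)).trans (by linarith))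
        ((hd2 b' hb'K).trans (by linarith)) hd,
        hg _ m1 _ m2 _ m4 ((hd2 b hbK).trans (by linarith))
        ((hd1 (k + 1) hk).trans (by linarith)) hd]
  have := key n le_rfl
  simpa only [div_self hn0.ne', AffineMap.lineMap_apply_one] using this

end Primitive

namespace Holonomy

variable {ι : Type*} {U : ι → Set Y} {v : C(I, Y) → G}

/-- Below a Lebesgue number of the pulled-back cover, a small triangle lies over a single member `U
i`, where the triangle law is available. -/
theorem exists_isPrimitive {E : Type*} [NormedAddCommGroup E] [NormedSpace ℝ E]
    (hU : ∀ i, IsOpen (U i)) (hcov : ∀ y, ∃ i, y ∈ U i)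
    (h1 : ∀ y, v (.const I y) = 1)
    (h2 : ∀ i, ∀ H : C(I × I, Y), (∀ p, H p ∈ U i) → SquareLaw v H) {K : Set E}
    (hK : Convex ℝ K) (hc : IsCompact K) (f : C(E, Y)) :
    ∃ F, Primitive.IsPrimitive (fun a b => v (f.comp (segMap a b))) K F := by
  obtain ⟨δ, hδ, h⟩ := lebesgue_number_lemma_of_metric (c := fun i => f ⁻¹' U i) hc
    (fun i => (hU i).preimage f.continuous) (fun x _ => Set.mem_iUnion.mpr (hcov (f x)))
  refine Primitive.exists_isPrimitive hK hc.isBounded hδ fun a ha b hb c hc hab hbc hac => ?_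
  obtain ⟨i, hi⟩ := h a ha
  exact seg_mul_of_squareLaw h1 (h2 i) (convex_ball a δ) f (fun x hx => hi hx)
    (Metric.mem_ball_self hδ) (by rwa [Metric.mem_ball, dist_comm])
    (by rwa [Metric.mem_ball, dist_comm])

/-- A path, extended to the real line by constants. -/
def extendLine (γ : C(I, Y)) : C(ℝ, Y) :=
  γ.comp ⟨Set.projIcc 0 1 zero_le_one, continuous_projIcc⟩

/-- A square, extended to the plane by a retraction. -/
def extendPlane (H : C(I × I, Y)) : C(ℝ × ℝ, Y) :=
  H.comp ⟨fun p => (Set.projIcc 0 1 zero_le_one p.1, Set.projIcc 0 1 zero_le_one p.2), by fun_prop⟩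

/-- **Local-to-global principle**: a function of paths that is trivial on constant paths and
satisfies the law of squares on each member of an open cover extends from the paths inside the
members to a holonomy. -/
theorem exists_of_cover (hU : ∀ i, IsOpen (U i)) (hcov : ∀ y, ∃ i, y ∈ U i)
    (h1 : ∀ y, v (.const I y) = 1)
    (h2 : ∀ i, ∀ H : C(I × I, Y), (∀ p, H p ∈ U i) → SquareLaw v H) :
    ∃ W : Holonomy Y G, ∀ i γ, (∀ t, γ t ∈ U i) → W γ = v γ := by
  have hI : IsPreconnected (Set.Icc (0 : ℝ) 1) := isPreconnected_Icc
  have m0 : (0 : ℝ) ∈ Set.Icc (0 : ℝ) 1 := ⟨le_rfl, zero_le_one⟩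
  have m1 : (1 : ℝ) ∈ Set.Icc (0 : ℝ) 1 := ⟨zero_le_one, le_rfl⟩
  choose F hF using fun γ : C(I, Y) =>
    exists_isPrimitive hU hcov h1 h2 (convex_Icc (0 : ℝ) 1) isCompact_Icc (extendLine γ)
  -- By uniqueness of primitives up to a constant on the right, this quotient does not depend on the
  -- chosen primitive.
  let W : C(I, Y) → G := fun γ => F γ 1 * (F γ 0)⁻¹
  have hW : ∀ γ f, Primitive.IsPrimitive (fun a b => v ((extendLine γ).comp (segMap a b)))
      (Set.Icc (0 : ℝ) 1) f → W γ = f 1 * (f 0)⁻¹ := by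
    intro γ f hf
    have := Primitive.IsPrimitive.inv_mul_eq hI (hF γ) hf m0 m1
    have h : f 1 = F γ 1 * ((F γ 0)⁻¹ * f 0) := by rw [this]; group
    simp only [W]; rw [h]; group
  refine ⟨⟨W, fun y => ?_, fun H => ?_⟩, fun i γ hγ => ?_⟩
  · have hf : Primitive.IsPrimitive (fun a b => v ((extendLine (.const I y)).comp (segMap a b)))
        (Set.Icc (0 : ℝ) 1) 1 := by
      refine ⟨1, one_pos, fun a _ b _ _ => ?_⟩
      have : (extendLine (.const I y)).comp (segMap a b) = .const I y := rfl
      simp only [this, h1]; simp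
    rw [hW _ _ hf]; simp
  · obtain ⟨f, δ, hδ, hf⟩ := exists_isPrimitive hU hcov h1 h2
      ((convex_Icc (0 : ℝ) 1).prod (convex_Icc (0 : ℝ) 1)) (isCompact_Icc.prod isCompact_Icc)
      (extendPlane H)
    -- A primitive over the whole square restricts to primitives along its sides, so the four
    -- transports are quotients of its values at the corners and the law of squares becomes an
    -- identity between them.
    have edge : ∀ (e : C(I, I × I)) (e' : ℝ → ℝ × ℝ), (∀ x y, dist (e' x) (e' y) = dist x y) →
        (∀ x ∈ Set.Icc (0 : ℝ) 1, e' x ∈ Set.Icc (0 : ℝ) 1 ×ˢ Set.Icc (0 : ℝ) 1) →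
        (∀ a b : ℝ, (extendLine (H.comp e)).comp (segMap a b) =
          (extendPlane H).comp (segMap (e' a) (e' b))) →
        W (H.comp e) = f (e' 1) * (f (e' 0))⁻¹ := by
      intro e e' hd hm hs
      refine hW _ (fun x => f (e' x)) ⟨δ, hδ, fun a ha b hb hab => ?_⟩
      beta_reduce
      rw [hs]
      exact hf _ (hm a ha) _ (hm b hb) (by rwa [hd])
    have p0 : Set.projIcc (0 : ℝ) 1 zero_le_one 0 = 0 := Set.projIcc_left _
    have p1 : Set.projIcc (0 : ℝ) 1 zero_le_one 1 = 1 := Set.projIcc_right _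
    have eB := edge edgeB (fun x => (x, 0)) (by simp [Prod.dist_eq]) (fun x hx => ⟨hx, m0⟩)
      (fun a b => by ext t; simp [extendLine, extendPlane, edgeB, segMap_apply])
    have eT := edge edgeT (fun x => (x, 1)) (by simp [Prod.dist_eq]) (fun x hx => ⟨hx, m1⟩)
      (fun a b => by ext t; simp [extendLine, extendPlane, edgeT, segMap_apply])
    have eL := edge edgeL (fun x => (0, x)) (by simp [Prod.dist_eq]) (fun x hx => ⟨m0, hx⟩)
      (fun a b => by ext t; simp [extendLine, extendPlane, edgeL, segMap_apply])
    have eR := edge edgeR (fun x => (1, x)) (by simp [Prod.dist_eq]) (fun x hx => ⟨m1, hx⟩)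
      (fun a b => by ext t; simp [extendLine, extendPlane, edgeR, segMap_apply])
    unfold SquareLaw
    rw [eB, eT, eL, eR]; group
  · have hm : ∀ x, extendLine γ x ∈ U i := fun x => hγ _
    have hf : Primitive.IsPrimitive (fun a b => v ((extendLine γ).comp (segMap a b)))
        (Set.Icc (0 : ℝ) 1) (fun b => v ((extendLine γ).comp (segMap 0 b))) := by
      refine ⟨1, one_pos, fun a _ b _ _ => ?_⟩
      exact (seg_mul_of_squareLaw h1 (h2 i) convex_univ (extendLine γ) (fun x _ => hm x)
        (Set.mem_univ _) (Set.mem_univ _) (Set.mem_univ _)).symm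
    change W γ = _
    rw [hW _ _ hf]
    have e1 : (extendLine γ).comp (segMap 0 1) = γ := by
      ext t; simp [extendLine, segMap_apply]
    have e0 : (extendLine γ).comp (segMap 0 0) = .const I (γ 0) := by
      ext t; simp [extendLine, segMap_apply]
    simp only [e1, e0, h1]; simp

end Holonomy

end

end

/-! ### Holonomies and homomorphisms of fundamental groups. -/

noncomputable section
open unitInterval

/-- A path with its endpoints as a term of type `Path`. -/
def ContinuousMap.asPath {Y : Type*} [TopologicalSpace Y] (γ : C(I, Y)) : Path (γ 0) (γ 1) :=
  ⟨γ, rfl, rfl⟩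

namespace Holonomy

section

variable {Y Z G G' : Type*} [TopologicalSpace Y] [TopologicalSpace Z] [Group G] [Group G']
  (W : Holonomy Y G)

theorem const (y : Y) : W (.const I y) = 1 := W.const' y

/-- The law of squares, with the four edges given pointwise. -/
theorem square {b r t l : C(I, Y)} (H : C(I × I, Y)) (hb : ∀ s, H (s, 0) = b s)
    (hr : ∀ s, H (1, s) = r s) (ht : ∀ s, H (s, 1) = t s) (hl : ∀ s, H (0, s) = l s) :
    W r * W b = W t * W l := by
  have h := W.square' H
  unfold SquareLaw at h
  rwa [show H.comp edgeR = r from ContinuousMap.ext hr,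
    show H.comp edgeB = b from ContinuousMap.ext hb,
    show H.comp edgeT = t from ContinuousMap.ext ht,
    show H.comp edgeL = l from ContinuousMap.ext hl] at h

/-- Pull-back along a continuous map. -/
def comap (f : C(Z, Y)) : Holonomy Z G where
  toFun γ := W (f.comp γ)
  const' y := W.const' (f y)
  square' H := W.square' (f.comp H)

@[simp] theorem comap_apply (f : C(Z, Y)) (γ : C(I, Z)) : W.comap f γ = W (f.comp γ) := rfl

/-- Push-forward along a group homomorphism. -/
def push (φ : G →* G') : Holonomy Y G' where
  toFun γ := φ (W γ)
  const' y := by rw [W.const, map_one]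
  square' H := by
    have := W.square' H
    unfold SquareLaw at this ⊢
    rw [← map_mul, this, map_mul]

@[simp] theorem push_apply (φ : G →* G') (γ : C(I, Y)) : W.push φ γ = φ (W γ) := rfl

/-- Change of gauge. -/
def gauge (g : Y → G) : Holonomy Y G where
  toFun γ := g (γ 1) * W γ * (g (γ 0))⁻¹
  const' y := by rw [W.const]; simp
  square' H := by
    have := W.square' H
    unfold SquareLaw at this ⊢
    simp only [ContinuousMap.comp_apply, edgeB, edgeT, edgeL, edgeR, ContinuousMap.coe_mk] at this ⊢
    calc _ = g (H (1, 1)) * (W (H.comp edgeR) * W (H.comp edgeB)) * (g (H (0, 0)))⁻¹ := by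
          simp only [edgeR, edgeB]; group
      _ = g (H (1, 1)) * (W (H.comp edgeT) * W (H.comp edgeL)) * (g (H (0, 0)))⁻¹ := by
          congr 2
      _ = _ := by simp only [edgeT, edgeL]; group

@[simp] theorem gauge_apply (g : Y → G) (γ : C(I, Y)) :
    W.gauge g γ = g (γ 1) * W γ * (g (γ 0))⁻¹ := rfl

theorem trans {a b c : Y} (p : Path a b) (q : Path b c) :
    W (p.trans q : C(I, Y)) = W (q : C(I, Y)) * W (p : C(I, Y)) := by
  -- In the square `(s, t) ↦ s (1 + t) / 2` the bottom runs through the first half of the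
  -- concatenation, the right side through the second half and the top through all of it; the left
  -- side is constant.
  let f : I × I → ℝ := fun x => (x.1 : ℝ) * (1 + x.2) / 2
  have h := W.square (b := (p : C(I, Y))) (r := (q : C(I, Y))) (t := (p.trans q : C(I, Y)))
    (l := .const I a) ⟨fun x => (p.trans q).extend (f x), by fun_prop⟩ ?_ ?_ ?_ ?_
  · rw [h, W.const, mul_one]
  · intro s
    have e : f (s, 0) = s / 2 := by simp [f]
    have h1 : (s : ℝ) / 2 ∈ I := ⟨by linarith [s.2.1], by linarith [s.2.2]⟩
    simp only [ContinuousMap.coe_mk, e]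
    rw [Path.extend_apply _ h1, Path.trans_apply,
      dif_pos (show (s : ℝ) / 2 ≤ 1 / 2 by linarith [s.2.2])]
    change p _ = p _
    congr 1; ext; simp; ring
  · intro s
    have e : f (1, s) = (1 + s) / 2 := by simp [f]
    have h1 : (1 + (s : ℝ)) / 2 ∈ I := ⟨by linarith [s.2.1], by linarith [s.2.2]⟩
    simp only [ContinuousMap.coe_mk, e]
    rw [Path.extend_apply _ h1, Path.trans_apply]
    split_ifs with h
    · have h : (1 + (s : ℝ)) / 2 ≤ 1 / 2 := h
      have : s = 0 := Subtype.ext (le_antisymm (by simp; linarith) s.2.1)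
      subst this
      refine ((congrArg p (Subtype.ext ?_)).trans p.target).trans q.source.symm
      simp
    · change q _ = q _
      congr 1; ext; simp; ring
  · intro s
    have h1 : f (s, 1) = s := by simp only [f]; simp; ring
    simp only [ContinuousMap.coe_mk, h1]
    simp
  · intro s
    simp [f]

/-- A homotopy of paths is a square with two constant opposite sides. -/
theorem eq_of_homotopic {a b : Y} {p q : Path a b} (h : p.Homotopic q) :
    W (p : C(I, Y)) = W (q : C(I, Y)) := by
  obtain ⟨F⟩ := h
  have h := W.square (b := .const I a) (t := .const I b) (l := (p : C(I, Y))) (r := (q : C(I, Y)))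
    F.toContinuousMap (fun s => F.source s) (fun s => F.apply_one s) (fun s => F.target s)
    (fun s => F.apply_zero s)
  simpa [W.const] using h.symm

theorem symm {a b : Y} (p : Path a b) : W (p.symm : C(I, Y)) = (W (p : C(I, Y)))⁻¹ := by
  have h := W.eq_of_homotopic (p := Path.refl a) (q := p.trans p.symm) ⟨.reflTransSymm p⟩
  rw [W.trans] at h
  have h' : W (Path.refl a : C(I, Y)) = 1 := W.const a
  rw [h'] at h
  exact eq_inv_of_mul_eq_one_left h.symm

/-- Paths with the same endpoints in a simply connected space have the same holonomy. -/
theorem eq_of_simplyConnected [SimplyConnectedSpace Y] {γ γ' : C(I, Y)} (h0 : γ 0 = γ' 0)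
    (h1 : γ 1 = γ' 1) : W γ = W γ' :=
  W.eq_of_homotopic (p := γ.asPath) (q := γ'.asPath.cast h0 h1)
    (SimplyConnectedSpace.paths_homotopic _ _)

theorem eq_one_of_simplyConnected [SimplyConnectedSpace Y] {γ : C(I, Y)} (h : γ 0 = γ 1) :
    W γ = 1 := by
  rw [← W.const (γ 0)]; exact W.eq_of_simplyConnected rfl h.symm

/-- The holonomy of loops as a homomorphism on the fundamental group. -/
def toHom (y : Y) : FundamentalGroup Y y →* G where
  toFun := Quotient.lift (fun p : Path y y => W (p : C(I, Y))) fun _ _ h => W.eq_of_homotopic h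
  map_one' := W.const y
  map_mul' a b := by
    induction a using Path.Homotopic.Quotient.ind with | mk a => ?_
    induction b using Path.Homotopic.Quotient.ind with | mk b => ?_
    exact W.trans b a

theorem toHom_map (f : C(Z, Y)) (z : Z) (β : FundamentalGroup Z z) :
    W.toHom (f z) (FundamentalGroup.map f z β) = (W.comap f).toHom z β := by
  induction β using Path.Homotopic.Quotient.ind with | mk b => ?_
  rfl

open Classical in
/-- A path from the base point, constant at the base point. -/
def spoke [PathConnectedSpace Y] (y₀ y : Y) : Path y₀ y :=
  if h : y₀ = y then (Path.refl y₀).cast rfl h.symm else PathConnectedSpace.somePath y₀ y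

theorem spoke_self [PathConnectedSpace Y] (y₀ : Y) : spoke y₀ y₀ = Path.refl y₀ := by
  rw [spoke, dif_pos rfl]; rfl

theorem spoke_mul_spoke {y₀ a b c : Y} (pa : Path y₀ a) (pb : Path y₀ b) (pc : Path y₀ c)
    (p : Path a b) (q : Path b c) :
    (((Path.Homotopic.Quotient.mk pa).trans (.mk p)).trans (.mk pb.symm)).trans
        (((Path.Homotopic.Quotient.mk pb).trans (.mk q)).trans (.mk pc.symm)) =
      ((Path.Homotopic.Quotient.mk pa).trans (.mk (p.trans q))).trans (.mk pc.symm) := by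
  simp only [Path.Homotopic.Quotient.mk_symm, Path.Homotopic.Quotient.mk_trans, Path.Homotopic.Quotient.trans_assoc]
  rw [← Path.Homotopic.Quotient.trans_assoc (Path.Homotopic.Quotient.mk pb).symm, Path.Homotopic.Quotient.symm_trans, Path.Homotopic.Quotient.refl_trans]

instance : SimplyConnectedSpace I :=
  have : ContractibleSpace I := (convex_Icc (0 : ℝ) 1).contractibleSpace ⟨0, by simp⟩
  inferInstance

instance : SimplyConnectedSpace (I × I) :=
  have : ContractibleSpace (Set.Icc (0 : ℝ) 1 ×ˢ Set.Icc (0 : ℝ) 1) :=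
    ((convex_Icc (0 : ℝ) 1).prod (convex_Icc (0 : ℝ) 1)).contractibleSpace ⟨(0, 0), by simp⟩
  have : ContractibleSpace (I × I) := (Homeomorph.Set.prod _ _).symm.contractibleSpace
  inferInstance

/-- The holonomy defined by a homomorphism on the fundamental group, and a choice of paths from the
base point. -/
def ofHom [PathConnectedSpace Y] {y₀ : Y} (φ : FundamentalGroup Y y₀ →* G) : Holonomy Y G where
  toFun γ := φ (FundamentalGroup.fromPath
    (((Path.Homotopic.Quotient.mk (spoke y₀ (γ 0))).trans (.mk γ.asPath)).trans (.mk (spoke y₀ (γ 1)).symm)))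
  const' y := by
    rw [← map_one φ]
    congr 1
    change ((Path.Homotopic.Quotient.mk (spoke y₀ y)).trans (Path.Homotopic.Quotient.refl y)).trans (Path.Homotopic.Quotient.mk (spoke y₀ y)).symm
      = Path.Homotopic.Quotient.refl y₀
    rw [Path.Homotopic.Quotient.trans_refl, Path.Homotopic.Quotient.trans_symm]
  square' H := by
    have key : ((H.comp edgeB).asPath.trans (H.comp edgeR).asPath).Homotopic
        ((H.comp edgeL).asPath.trans (H.comp edgeT).asPath) := by
      let pB : Path ((0, 0) : I × I) (1, 0) := edgeB.asPath
      let pR : Path ((1, 0) : I × I) (1, 1) := edgeR.asPath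
      let pL : Path ((0, 0) : I × I) (0, 1) := edgeL.asPath
      let pT : Path ((0, 1) : I × I) (1, 1) := edgeT.asPath
      have h' := (SimplyConnectedSpace.paths_homotopic (pB.trans pR) (pL.trans pT)).map H
      rw [Path.map_trans, Path.map_trans] at h'
      exact h'
    unfold SquareLaw
    rw [← map_mul, ← map_mul, FundamentalGroup.mul_def, FundamentalGroup.mul_def]
    congr 1
    refine (spoke_mul_spoke (spoke y₀ _) (spoke y₀ _) (spoke y₀ _) (H.comp edgeB).asPath
      (H.comp edgeR).asPath).trans (Eq.trans ?_ (spoke_mul_spoke (spoke y₀ _) (spoke y₀ _)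
        (spoke y₀ _) (H.comp edgeL).asPath (H.comp edgeT).asPath).symm)
    congr 2
    exact Path.Homotopic.Quotient.eq.mpr key

theorem ofHom_path [PathConnectedSpace Y] {y₀ : Y} (φ : FundamentalGroup Y y₀ →* G) {a b : Y}
    (p : Path a b) : ofHom φ (p : C(I, Y)) = φ (FundamentalGroup.fromPath
      (((Path.Homotopic.Quotient.mk (spoke y₀ a)).trans (.mk p)).trans (.mk (spoke y₀ b).symm))) := by
  obtain ⟨p, rfl, rfl⟩ := p
  rfl

/-- The equality is exact, not just up to conjugation, because the spoke to the base point is the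
constant path. -/
theorem toHom_ofHom [PathConnectedSpace Y] {y₀ : Y} (φ : FundamentalGroup Y y₀ →* G) :
    (ofHom φ).toHom y₀ = φ := by
  ext β
  induction β using Path.Homotopic.Quotient.ind with | mk b => ?_
  refine (ofHom_path φ b).trans ?_
  congr 1
  rw [spoke_self]
  change ((Path.Homotopic.Quotient.refl y₀).trans (Path.Homotopic.Quotient.mk b)).trans (Path.Homotopic.Quotient.refl y₀).symm = Path.Homotopic.Quotient.mk b
  rw [Path.Homotopic.Quotient.refl_trans]
  exact Path.Homotopic.Quotient.trans_refl _

/-- Two holonomies on a path-connected space that agree on the loops at one point differ by a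
change of gauge. -/
theorem exists_gauge [PathConnectedSpace Y] (W W' : Holonomy Y G) (y₀ : Y)
    (h : ∀ γ : Path y₀ y₀, W (γ : C(I, Y)) = W' (γ : C(I, Y))) :
    ∃ g : Y → G, (∀ γ, W' γ = g (γ 1) * W γ * (g (γ 0))⁻¹) ∧ g y₀ = 1 := by
  -- The gauge compares the two transports along the same spoke; agreement on the loop spoke, `γ`,
  -- reversed spoke is the required identity.
  refine ⟨fun y => W' (spoke y₀ y : C(I, Y)) * (W (spoke y₀ y : C(I, Y)))⁻¹, fun γ => ?_, ?_⟩
  · have := h (((spoke y₀ (γ 0)).trans γ.asPath).trans (spoke y₀ (γ 1)).symm)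
    simp only [Holonomy.trans, Holonomy.symm] at this
    have e : ∀ V : Holonomy Y G, V (γ.asPath : C(I, Y)) = V γ := fun V => rfl
    rw [e, e] at this
    have h2 : W' γ = W' (spoke y₀ (γ 1) : C(I, Y)) * ((W' (spoke y₀ (γ 1) : C(I, Y)))⁻¹ *
      (W' γ * W' (spoke y₀ (γ 0) : C(I, Y)))) * (W' (spoke y₀ (γ 0) : C(I, Y)))⁻¹ := by group
    rw [h2, ← this]
    group
  · simp only [spoke_self]
    have e : ∀ V : Holonomy Y G, V (Path.refl y₀ : C(I, Y)) = 1 := fun V => V.const y₀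
    simp [e]

/-- The tautological holonomy, with values in the fundamental group. -/
def taut [PathConnectedSpace Y] (y₀ : Y) : Holonomy Y (FundamentalGroup Y y₀) :=
  ofHom (MonoidHom.id _)

end
end Holonomy
end

/-! ### Gluing of holonomies, van Kampen's theorem, and loops in tori. -/

noncomputable section
open unitInterval

/-- Restriction of the codomain of a continuous map to a set. -/
def ContinuousMap.intoSet {A Y : Type*} [TopologicalSpace A] [TopologicalSpace Y] (f : C(A, Y))
    (U : Set Y) (h : ∀ a, f a ∈ U) : C(A, U) := ⟨fun a => ⟨f a, h a⟩, by fun_prop⟩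

/-- The inclusion of a set as a continuous map. -/
def inclSet {Y : Type*} [TopologicalSpace Y] (U : Set Y) : C(U, Y) :=
  ⟨Subtype.val, continuous_subtype_val⟩

/-- The loop that runs once around the circle, based at `z`. -/
def circleLoop (z : Circle) : C(I, Circle) := ⟨fun t => Circle.exp (2 * Real.pi * t) * z, by fun_prop⟩

theorem circleLoop_zero (z : Circle) : circleLoop z 0 = z := by simp [circleLoop]

theorem circleLoop_one (z : Circle) : circleLoop z 1 = z := by simp [circleLoop]

namespace Holonomy

section
variable {Y Z A B D G G' : Type*} [TopologicalSpace Y] [TopologicalSpace Z] [TopologicalSpace A]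
  [TopologicalSpace B] [TopologicalSpace D] [Group G] [Group G']

theorem exists_glue {ι : Type*} {U : ι → Set Y} (hU : ∀ i, IsOpen (U i))
    (hcov : ∀ y, ∃ i, y ∈ U i) (w : ∀ i, Holonomy (U i) G)
    (hw : ∀ i j (γ : C(I, Y)) (hi : ∀ t, γ t ∈ U i) (hj : ∀ t, γ t ∈ U j),
      w i (γ.intoSet _ hi) = w j (γ.intoSet _ hj)) :
    ∃ W : Holonomy Y G, ∀ i (γ : C(I, U i)), W ((inclSet _).comp γ) = w i γ := by
  classical
  let v : C(I, Y) → G := fun γ =>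
    if h : ∃ i, ∀ t, γ t ∈ U i then w h.choose (γ.intoSet _ h.choose_spec) else 1
  have hv : ∀ i (γ : C(I, Y)) (hi : ∀ t, γ t ∈ U i), v γ = w i (γ.intoSet _ hi) := by
    intro i γ hi
    have h : ∃ i, ∀ t, γ t ∈ U i := ⟨i, hi⟩
    simp only [v]
    rw [dif_pos h]
    exact hw _ _ _ _ _
  have h1 : ∀ y, v (.const I y) = 1 := by
    intro y
    obtain ⟨i, hi⟩ := hcov y
    rw [hv i (.const I y) fun _ => hi]
    exact (w i).const ⟨y, hi⟩
  have h2 : ∀ i, ∀ H : C(I × I, Y), (∀ p, H p ∈ U i) → SquareLaw v H := by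
    intro i H hH
    have := (w i).square' (H.intoSet _ hH)
    unfold SquareLaw at this ⊢
    rw [hv i (H.comp edgeR) fun _ => hH _, hv i (H.comp edgeB) fun _ => hH _,
      hv i (H.comp edgeT) fun _ => hH _, hv i (H.comp edgeL) fun _ => hH _]
    exact this
  obtain ⟨W, hW⟩ := exists_of_cover hU hcov h1 h2
  refine ⟨W, fun i γ => ?_⟩
  have hm : ∀ t, (inclSet (U i)).comp γ t ∈ U i := fun t => (γ t).2
  exact (hW i _ hm).trans (hv i _ hm)

/-- Two holonomies on two open sets that cover glue if they differ by a change of gauge on the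
intersection. -/
theorem exists_glue_two {U V : Set Y} (hU : IsOpen U) (hV : IsOpen V) (hcov : ∀ y, y ∈ U ∨ y ∈ V)
    (wU : Holonomy U G) (wV : Holonomy V G) (g : Y → G)
    (hw : ∀ (γ : C(I, Y)) (h : ∀ t, γ t ∈ U) (h' : ∀ t, γ t ∈ V),
      wV (γ.intoSet _ h') = g (γ 1) * wU (γ.intoSet _ h) * (g (γ 0))⁻¹) :
    ∃ W : Holonomy Y G, (∀ γ : C(I, V), W ((inclSet _).comp γ) = wV γ) ∧
      ∀ γ : C(I, U), W ((inclSet _).comp γ) = g (γ 1) * wU γ * (g (γ 0))⁻¹ := by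
  obtain ⟨W, hW⟩ := exists_glue (U := fun b : Bool => if b then U else V)
    (by rintro (_ | _) <;> simpa) (fun y => (hcov y).elim (fun h => ⟨true, h⟩) fun h => ⟨false, h⟩)
    (fun b => match b with
      | true => wU.gauge fun y => g y
      | false => wV)
    (by
      rintro (_ | _) (_ | _) γ hi hj
      · rfl
      · exact hw γ hj hi
      · exact (hw γ hi hj).symm
      · rfl)
  exact ⟨W, fun γ => hW false γ, fun γ => hW true γ⟩

/-- The theorem of van Kampen, in the form of an extension of holonomies. -/
theorem exists_extension {U V : Set Y} (hU : IsOpen U) (hV : IsOpen V)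
    (hcov : ∀ y, y ∈ U ∨ y ∈ V) (wU : Holonomy U G) (wV : Holonomy V G)
    [PathConnectedSpace ↥(U ∩ V)] (y₀ : ↥(U ∩ V))
    (hw : ∀ γ : C(I, ↥(U ∩ V)), γ 0 = y₀ → γ 1 = y₀ →
      wU (((inclSet _).comp γ).intoSet U fun t => (γ t).2.1) =
        wV (((inclSet _).comp γ).intoSet V fun t => (γ t).2.2)) :
    ∃ W : Holonomy Y G, ∀ γ : C(I, V), W ((inclSet _).comp γ) = wV γ := by
  classical
  obtain ⟨g, hg, -⟩ := exists_gauge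
    (wU.comap ⟨fun y : ↥(U ∩ V) => ⟨y, y.2.1⟩, by fun_prop⟩)
    (wV.comap ⟨fun y : ↥(U ∩ V) => ⟨y, y.2.2⟩, by fun_prop⟩) y₀
    (fun γ => hw γ γ.source γ.target)
  obtain ⟨W, hW, -⟩ := exists_glue_two hU hV hcov wU wV
    -- The gauge found on the overlap is extended to all points by `1`. It need not be continuous,
    -- so any extension serves. Only the holonomy on `U` is changed; the one on `V` is kept exactly.
    (fun y => if h : y ∈ U ∩ V then g ⟨y, h⟩ else 1) (fun γ h h' => by
      have := hg (γ.intoSet (U ∩ V) fun t => ⟨h t, h' t⟩)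
      rw [dif_pos ⟨h 1, h' 1⟩, dif_pos ⟨h 0, h' 0⟩]
      exact this)
  exact ⟨W, hW⟩

/-- A section that is locally parallel is parallel. -/
theorem smul_eq_of_cover (W : Holonomy Y G) {S : Type*} [MulAction G S] {ι : Type*} {U : ι → Set Y}
    (hU : ∀ i, IsOpen (U i)) (hcov : ∀ y, ∃ i, y ∈ U i) (κ : Y → S)
    (h : ∀ i (γ : C(I, Y)), (∀ t, γ t ∈ U i) → κ (γ 1) = W γ • κ (γ 0)) (γ : C(I, Y)) :
    κ (γ 1) = W γ • κ (γ 0) := by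
  -- The section along the path, carried back to time `0`. It is locally constant, hence constant.
  let c : ℝ → S := fun s => (W ((extendLine γ).comp (segMap 0 s)))⁻¹ • κ (extendLine γ s)
  have hc : IsLocallyConstant c := by
    rw [IsLocallyConstant.iff_eventually_eq]
    intro x
    obtain ⟨i, hi⟩ := hcov (extendLine γ x)
    obtain ⟨ε, hε, hb⟩ := Metric.isOpen_iff.mp ((hU i).preimage (extendLine γ).continuous) x hi
    filter_upwards [Metric.ball_mem_nhds x hε] with y hy
    have e := h i ((extendLine γ).comp (segMap x y)) fun t => hb (by
      rw [segMap_apply]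
      exact convex_ball x ε (Metric.mem_ball_self hε) hy (by linarith [t.2.2]) t.2.1 (by ring))
    have e1 : ((extendLine γ).comp (segMap x y)) 1 = extendLine γ y := by simp [segMap_apply]
    have e0 : ((extendLine γ).comp (segMap x y)) 0 = extendLine γ x := by simp [segMap_apply]
    rw [e1, e0] at e
    have m := seg_mul_of_squareLaw (v := W) W.const (U := Set.univ) (fun H _ => W.square' H)
      convex_univ (extendLine γ) (fun _ _ => trivial) (Set.mem_univ (0 : ℝ)) (Set.mem_univ x)
      (Set.mem_univ y)
    simp only [c]
    rw [e, ← m, mul_inv_rev, mul_smul, inv_smul_smul]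
  have h01 := hc.apply_eq_of_preconnectedSpace 0 1
  have e1 : (extendLine γ).comp (segMap 0 1) = γ := by
    ext t; simp [extendLine, segMap_apply]
  have e0 : (extendLine γ).comp (segMap 0 0) = .const I (γ 0) := by
    ext t; simp [extendLine, segMap_apply]
  have f1 : extendLine γ 1 = γ 1 := by simp [extendLine]
  have f0 : extendLine γ 0 = γ 0 := by simp [extendLine]
  simp only [c, e1, e0, f0, f1, W.const, inv_one, one_smul] at h01
  rw [h01, smul_inv_smul]

theorem mul_of_simplyConnected [SimplyConnectedSpace Y] (W : Holonomy Y G) {p q r : C(I, Y)}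
    (hpq : p 1 = q 0) (hp : p 0 = r 0) (hq : q 1 = r 1) : W q * W p = W r := by
  have := W.trans (p.asPath.cast rfl hpq.symm) q.asPath
  refine this.symm.trans (W.eq_of_simplyConnected ?_ ?_)
  · exact (Path.source _).trans hp
  · exact (Path.target _).trans hq

/-- The diagonal of a square is homotopic to two of its sides. -/
theorem prod_eq (W : Holonomy (A × B) G) (a : C(I, A)) (b : C(I, B)) :
    W (a.prodMk b) = W ((ContinuousMap.const I (a 1)).prodMk b) *
      W (a.prodMk (.const I (b 0))) :=
  ((W.comap (a.prodMap b)).mul_of_simplyConnected (p := edgeB) (q := edgeR)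
    (r := (ContinuousMap.id I).prodMk (.id I)) rfl rfl rfl).symm

/-- The exponent is the degree, read off from a lift to `ℝ`. It depends on the loop alone and is
chosen before the holonomy, which makes it possible to compare two holonomies on one loop. -/
theorem circle_eq_zpow {γ : C(I, Circle)} (h : γ 0 = γ 1) :
    ∃ n : ℤ, ∀ W : Holonomy Circle G, W γ = W (circleLoop (γ 0)) ^ n := by
  obtain ⟨a, ha⟩ : ∃ a : ℝ, Circle.exp a = γ 0 := Circle.exp_surjective _
  let c := Circle.isCoveringMap_exp.liftPath γ a ha.symm
  have hc : ∀ t, Circle.exp (c t) = γ t := fun t =>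
    congrFun (Circle.isCoveringMap_exp.liftPath_lifts γ a ha.symm) t
  have hc0 : c 0 = a := Circle.isCoveringMap_exp.liftPath_zero γ a ha.symm
  obtain ⟨n, hn⟩ : ∃ n : ℤ, c 1 = a + n * (2 * Real.pi) := by
    rw [← Circle.exp_eq_exp, hc, ha, h]
  refine ⟨n, fun W => ?_⟩
  let V : Holonomy ℝ G := W.comap ⟨Circle.exp, Circle.exp.continuous⟩
  have hV : W γ = V (segMap a (a + n * (2 * Real.pi))) := by
    have : W γ = V c := by
      rw [comap_apply]; congr 1; ext1 t; exact (hc t).symm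
    rw [this]
    refine V.eq_of_simplyConnected ?_ ?_ <;> simp [segMap_apply, hc0, hn]
  have hone : V (segMap a (a + 2 * Real.pi)) = W (circleLoop (γ 0)) := by
    rw [comap_apply]; congr 1; ext1 t
    simp only [ContinuousMap.comp_apply, ContinuousMap.coe_mk, circleLoop, segMap_apply, ← ha,
      ← Circle.exp_add]
    congr 1; simp; ring
  have hstep : ∀ k : ℤ, V (segMap a (a + (k + 1 : ℤ) * (2 * Real.pi))) =
      W (circleLoop (γ 0)) * V (segMap a (a + k * (2 * Real.pi))) := by
    intro k
    rw [← hone]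
    have e : V (segMap a (a + 2 * Real.pi)) =
        V (segMap (a + k * (2 * Real.pi)) (a + (k + 1 : ℤ) * (2 * Real.pi))) := by
      simp only [V, comap_apply]; congr 1; ext1 t
      simp only [ContinuousMap.comp_apply, ContinuousMap.coe_mk, segMap_apply]
      rw [Circle.exp_eq_exp]
      exact ⟨-k, by push_cast; simp; ring⟩
    rw [e]
    refine (V.mul_of_simplyConnected ?_ ?_ ?_).symm <;> simp [segMap_apply]
  rw [hV]
  clear hV hn
  induction n with
  | zero =>
    rw [zpow_zero]
    exact V.eq_one_of_simplyConnected (by simp [segMap_apply])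
  | succ n ih => rw [hstep, ih, ← zpow_one_add, add_comm]
  | pred n ih =>
    have := hstep (-n - 1)
    rw [sub_add_cancel, ih] at this
    rw [show (-(n : ℤ) - 1) = -1 + -n by ring, zpow_add, zpow_neg_one, this,
      show (-1 + -(n : ℤ)) = -n - 1 by ring, inv_mul_cancel_left]

theorem circle_prod_eq_zpow [SimplyConnectedSpace D] {γ : C(I, Circle × D)} (h : γ 0 = γ 1) :
    ∃ n : ℤ, ∀ W : Holonomy (Circle × D) G,
      W γ = W ((circleLoop (γ 0).1).prodMk (.const I (γ 0).2)) ^ n := by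
  let a : C(I, Circle) := ⟨fun t => (γ t).1, by fun_prop⟩
  let b : C(I, D) := ⟨fun t => (γ t).2, by fun_prop⟩
  obtain ⟨n, hn⟩ := circle_eq_zpow (G := G) (γ := a) (congrArg Prod.fst h)
  refine ⟨n, fun W => ?_⟩
  have e1 : W ((ContinuousMap.const I (a 1)).prodMk b) = 1 :=
    (W.comap ((ContinuousMap.const D (a 1)).prodMk (.id D))).eq_one_of_simplyConnected (γ := b)
      (congrArg Prod.snd h)
  have e2 := hn (W.comap ((ContinuousMap.id Circle).prodMk (.const Circle (b 0))))
  have e3 := W.prod_eq a b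
  rw [e1, one_mul] at e3
  exact e3.trans e2

/-- The fundamental group of a torus times a simply connected space is `ℤ²`. One pair of exponents
serves all holonomies with values in `G`, so they are determined on loops by two of them. -/
theorem circle_circle_prod_eq [SimplyConnectedSpace D] {γ : C(I, Circle × (Circle × D))}
    (h : γ 0 = γ 1) : ∃ n k : ℤ, ∀ W : Holonomy (Circle × (Circle × D)) G,
      W γ = W ((ContinuousMap.const I (γ 0).1).prodMk
          ((circleLoop (γ 0).2.1).prodMk (.const I (γ 0).2.2))) ^ k *
        W ((circleLoop (γ 0).1).prodMk (.const I (γ 0).2)) ^ n := by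
  let a : C(I, Circle) := ⟨fun t => (γ t).1, by fun_prop⟩
  let b : C(I, Circle × D) := ⟨fun t => (γ t).2, by fun_prop⟩
  obtain ⟨n, hn⟩ := circle_eq_zpow (G := G) (γ := a) (congrArg Prod.fst h)
  obtain ⟨k, hk⟩ := circle_prod_eq_zpow (G := G) (γ := b) (congrArg Prod.snd h)
  refine ⟨n, k, fun W => ?_⟩
  have e1 := hk (W.comap ((ContinuousMap.const _ (a 1)).prodMk (.id _)))
  have e2 := hn (W.comap ((ContinuousMap.id Circle).prodMk (.const Circle (b 0))))
  have e3 := W.prod_eq a b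
  have ha : a 1 = (γ 0).1 := (congrArg Prod.fst h).symm
  rw [ha] at e1 e3
  exact e3.trans (congrArg₂ (· * ·) e1 e2)

end

/-! ### Null-homologous loops -/

section

variable {Y G : Type*} [TopologicalSpace Y] [CommGroup G]

instance (n : ℕ) : SimplyConnectedSpace (stdSimplex ℝ (Fin (n + 1))) :=
  have : ContractibleSpace (stdSimplex ℝ (Fin (n + 1))) :=
    (convex_stdSimplex ℝ (Fin (n + 1))).contractibleSpace ⟨_, single_mem_stdSimplex ℝ 0⟩
  inferInstance

/-- The parametrization of the standard `1`-simplex by the unit interval. -/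
def simplexPath : C(I, stdSimplex ℝ (Fin 2)) where
  toFun t := ⟨![1 - t, t], by
    constructor
    · intro i; fin_cases i
      · simpa using t.2.2
      · simpa using t.2.1
    · simp⟩
  continuous_toFun := by
    refine Continuous.subtype_mk (continuous_pi fun i => ?_) _
    fin_cases i <;> simp <;> fun_prop

theorem loopSimplex_comp_simplexPath (γ : C(Circle, Y)) :
    (loopSimplex γ).comp simplexPath = γ.comp (circleLoop 1) := by
  ext1 t
  simp only [ContinuousMap.comp_apply, loopSimplex, circleLoop, ContinuousMap.coe_mk, mul_one]
  rfl

theorem simplexPath_zero : simplexPath 0 = stdSimplex.vertex 0 := by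
  ext i; change (![1 - ((0 : I) : ℝ), (0 : I)] : Fin 2 → ℝ) i = _
  fin_cases i <;> simp

theorem simplexPath_one : simplexPath 1 = stdSimplex.vertex 1 := by
  ext i; change (![1 - ((1 : I) : ℝ), (1 : I)] : Fin 2 → ℝ) i = _
  fin_cases i <;> simp

/-- The sum of the holonomies of the simplices of a singular `1`-chain. -/
def chainSum (W : Holonomy Y G) : SingChain 1 Y →+ Additive G :=
  Finsupp.liftAddHom fun s => zmultiplesHom (Additive G) (Additive.ofMul (W (s.comp simplexPath)))

theorem chainSum_single (W : Holonomy Y G) (s : C(stdSimplex ℝ (Fin 2), Y)) (a : ℤ) :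
    W.chainSum (Finsupp.single s a) = a • Additive.ofMul (W (s.comp simplexPath)) := by
  simp [chainSum]

/-- The standard triangle is simply connected, so transport along two consecutive edges equals
transport along the third. In a commutative group this makes the alternating sum over the faces
vanish. -/
theorem chainSum_singBoundary (W : Holonomy Y G) (c : SingChain 2 Y) :
    W.chainSum (singBoundary 1 c) = 0 := by
  unfold singBoundary
  rw [Finsupp.sum, map_sum]
  refine Finset.sum_eq_zero fun s _ => ?_
  have key := (W.comap s).mul_of_simplyConnected (p := (faceMap 1 2).comp simplexPath)
    (q := (faceMap 1 0).comp simplexPath) (r := (faceMap 1 1).comp simplexPath) ?_ ?_ ?_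
  · simp only [comap_apply, ← ContinuousMap.comp_assoc] at key
    rw [map_sum, Fin.sum_univ_three]
    simp only [chainSum_single, ← key, ofMul_mul]
    simp
  · change stdSimplex.map _ (simplexPath 1) = stdSimplex.map _ (simplexPath 0)
    rw [simplexPath_zero, simplexPath_one, stdSimplex.map_vertex, stdSimplex.map_vertex]
    rfl
  · change stdSimplex.map _ (simplexPath 0) = stdSimplex.map _ (simplexPath 0)
    rw [simplexPath_zero, stdSimplex.map_vertex, stdSimplex.map_vertex]
    rfl
  · change stdSimplex.map _ (simplexPath 1) = stdSimplex.map _ (simplexPath 1)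
    rw [simplexPath_one, stdSimplex.map_vertex, stdSimplex.map_vertex]
    rfl

theorem eq_one_of_nullHomologous (W : Holonomy Y G) {γ : C(Circle, Y)} (h : NullHomologous γ) :
    W (γ.comp (circleLoop 1)) = 1 := by
  obtain ⟨c, hc⟩ := h
  have := W.chainSum_singBoundary c
  rw [hc, chainSum_single, loopSimplex_comp_simplexPath, one_smul] at this
  exact this

end

end Holonomy
end

noncomputable section
open unitInterval Topology

/-! ### Locally flat subsets of codimension at least two -/

section

variable {X : Type*} [TopologicalSpace X]

/-- A subset `F` is tame if each point has arbitrarily small open neighbourhoods `B` such that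
`B - F` is path connected and can be shrunk, inside itself, towards any point of `B ∩ F`. -/
def IsTame (F : Set X) : Prop :=
  ∀ x, ∀ O ∈ 𝓝 x, ∃ B ⊆ O, IsOpen B ∧ x ∈ B ∧ IsPathConnected (B \ F) ∧
    ∀ x' ∈ B ∩ F, ∀ O' ∈ 𝓝 x', ∃ H : C(I × ↥(B \ F), ↥(B \ F)),
      (∀ y, H (0, y) = y) ∧ ∀ y, (H (1, y) : X) ∈ O'

/-- The set `T` of points near which the whole complement of `F` can be reached from `p` is open and
closed: near any point the complement is path connected, and it is not empty in any smaller
neighbourhood. -/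
theorem IsTame.isPathConnected_compl {F : Set X} (hF : IsTame F) [ConnectedSpace X] :
    IsPathConnected Fᶜ := by
  obtain ⟨p, hp⟩ : ∃ p, p ∉ F := by
    obtain ⟨B, -, -, -, ⟨p, hp, -⟩, -⟩ := hF (Classical.arbitrary X) _ Filter.univ_mem
    exact ⟨p, hp.2⟩
  let T : Set X := {x | ∃ B, IsOpen B ∧ x ∈ B ∧ ∀ y ∈ B \ F, JoinedIn Fᶜ p y}
  have hT : IsOpen T := by
    rw [isOpen_iff_forall_mem_open]
    rintro x ⟨B, hB, hx, h⟩
    exact ⟨B, fun x' hx' => ⟨B, hB, hx', h⟩, hB, hx⟩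
  have hT' : IsOpen Tᶜ := by
    rw [isOpen_iff_forall_mem_open]
    intro x hx
    obtain ⟨B, -, hB, hxB, hpc, -⟩ := hF x _ Filter.univ_mem
    refine ⟨B, fun x' hx' hT => hx ?_, hB, hxB⟩
    obtain ⟨B', hB', hx'B', h⟩ := hT
    obtain ⟨C, hC, -, -, ⟨q, hq, -⟩, -⟩ := hF x' _ ((hB.inter hB').mem_nhds ⟨hx', hx'B'⟩)
    refine ⟨B, hB, hxB, fun y hy => (h q ⟨(hC hq.1).2, hq.2⟩).trans ?_⟩
    exact (hpc.joinedIn q ⟨(hC hq.1).1, hq.2⟩ y hy).mono fun w hw => hw.2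
  have hpT : p ∈ T := by
    obtain ⟨B, -, hB, hxB, hpc, -⟩ := hF p _ Filter.univ_mem
    exact ⟨B, hB, hxB, fun y hy => (hpc.joinedIn p ⟨hxB, hp⟩ y hy).mono fun w hw => hw.2⟩
  have huniv : T = Set.univ := IsClopen.eq_univ ⟨⟨hT'⟩, hT⟩ ⟨p, hpT⟩
  refine ⟨p, hp, fun {q} hq => ?_⟩
  obtain ⟨B, -, hqB, h⟩ : q ∈ T := huniv ▸ trivial
  exact h q ⟨hqB, hq⟩

variable {Q : Type*} [Group Q]

/-- Triviality of a holonomy on the loops of a set. -/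
def Holonomy.TrivialOn {Y : Type*} [TopologicalSpace Y] (W : Holonomy Y Q) (A : Set Y) : Prop :=
  ∀ γ : C(I, Y), (∀ t, γ t ∈ A) → γ 0 = γ 1 → W γ = 1

theorem Holonomy.TrivialOn.mono {Y : Type*} [TopologicalSpace Y] {W : Holonomy Y Q} {A B : Set Y}
    (h : W.TrivialOn B) (hAB : A ⊆ B) : W.TrivialOn A := fun γ hγ => h γ fun t => hAB (hγ t)

/-- A holonomy that is trivial on loops is a change of gauge of the trivial one. The gauge is found
on `B \ F`, and its inverse is the potential. -/
theorem Holonomy.TrivialOn.exists_potential {F : Set X} {θ : Holonomy ↥Fᶜ Q} {B : Set X}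
    (h : θ.TrivialOn {y | (y : X) ∈ B}) (hB : IsPathConnected (B \ F)) :
    ∃ f : X → Q, ∀ γ : C(I, ↥Fᶜ), (∀ t, (γ t : X) ∈ B) → θ γ = f (γ 1) * (f (γ 0))⁻¹ := by
  classical
  have : PathConnectedSpace ↥(B \ F) := isPathConnected_iff_pathConnectedSpace.mp hB
  obtain ⟨b⟩ : Nonempty ↥(B \ F) := inferInstance
  obtain ⟨g, hg, -⟩ := Holonomy.exists_gauge
    (θ.comap ⟨fun y : ↥(B \ F) => (⟨y, y.2.2⟩ : ↥Fᶜ), by fun_prop⟩)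
    ((θ.comap ⟨fun y : ↥(B \ F) => (⟨y, y.2.2⟩ : ↥Fᶜ), by fun_prop⟩).push (1 : Q →* Q)) b
    (fun γ => h _ (fun t => (γ t).2.1) (by simp))
  refine ⟨fun y => if hy : y ∈ B \ F then (g ⟨y, hy⟩)⁻¹ else 1, fun γ hγ => ?_⟩
  have := hg ⟨fun t => ⟨γ t, hγ t, (γ t).2⟩, by fun_prop⟩
  simp only [Holonomy.push_apply, MonoidHom.one_apply, Holonomy.comap_apply] at this
  beta_reduce
  rw [dif_pos ⟨hγ 1, (γ 1).2⟩, dif_pos ⟨hγ 0, (γ 0).2⟩, inv_inv]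
  have e : θ γ = (g ⟨γ 1, hγ 1, (γ 1).2⟩)⁻¹ * 1 * g ⟨γ 0, hγ 0, (γ 0).2⟩ := by
    rw [this]; simp only [ContinuousMap.coe_mk]; group; rfl
  rw [e, mul_one]

/-- A holonomy on the complement of a tame closed subset `F` of a simply connected space is trivial
if it is trivial near each point of `F`. -/
theorem IsTame.trivialOn_univ [SimplyConnectedSpace X] {F : Set X} (hF : IsTame F)
    (hcl : IsClosed F) (θ : Holonomy ↥Fᶜ Q)
    (h : ∀ x ∈ F, ∃ O ∈ 𝓝 x, θ.TrivialOn {y | (y : X) ∈ O}) : θ.TrivialOn Set.univ := by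
  classical
  have h1 : ∀ x : F, ∃ B, IsOpen B ∧ (x : X) ∈ B ∧ ∃ f : X → Q,
      ∀ γ : C(I, ↥Fᶜ), (∀ t, (γ t : X) ∈ B) → θ γ = f (γ 1) * (f (γ 0))⁻¹ := by
    intro x
    obtain ⟨O, hO, hθ⟩ := h x x.2
    obtain ⟨B, hBO, hB, hxB, hpc, -⟩ := hF x O hO
    exact ⟨B, hB, hxB, (hθ.mono fun y hy => hBO hy).exists_potential hpc⟩
  choose B hB hxB f hf using h1
  -- Two potentials of the same holonomy differ by a constant on a connected set. The constant `k x
  -- x' y` is attached to `y` even if `y` lies on `F`, because `C \ F` is still connected.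
  have h2 : ∀ (x x' : F) (y : X), y ∈ B x → y ∈ B x' → ∃ k, ∃ C, IsOpen C ∧ y ∈ C ∧
      C ⊆ B x ∩ B x' ∧ ∀ w ∈ C \ F, (f x w)⁻¹ * f x' w = k := by
    intro x x' y hy hy'
    obtain ⟨C, hCB, hC, hyC, hpc, -⟩ := hF y _ (((hB x).inter (hB x')).mem_nhds ⟨hy, hy'⟩)
    obtain ⟨b, hb⟩ := hpc.nonempty
    refine ⟨(f x b)⁻¹ * f x' b, C, hC, hyC, hCB, fun w hw => ?_⟩
    obtain ⟨γ, hγ⟩ := hpc.joinedIn b hb w hw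
    let γ' : C(I, ↥Fᶜ) := ⟨fun t => ⟨γ t, (hγ t).2⟩, by fun_prop⟩
    have e := (hf x γ' fun t => (hCB (hγ t).1).1).symm.trans (hf x' γ' fun t => (hCB (hγ t).1).2)
    have e0 : (γ' 0 : X) = b := γ.source
    have e1 : (γ' 1 : X) = w := γ.target
    rw [e0, e1] at e
    have : (f x w)⁻¹ * f x' w = (f x w)⁻¹ * (f x' w * (f x' b)⁻¹) * f x' b := by group
    rw [this, ← e]
    group
  choose! k C hC using h2
  -- The potentials are extended over `F`. At `w ∈ F` the potential attached to `w` serves as the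
  -- reference, and `f' x w` is the constant by which the potential of `x` differs from it near `w`.
  -- The quotients of two extended potentials are then locally constant across `F` too.
  let f' : F → X → Q := fun x w => if hw : w ∈ F then (k x ⟨w, hw⟩ w)⁻¹ else f x w
  have h3 : ∀ (x x' : F) (y : X), y ∈ B x → y ∈ B x' → ∀ w ∈ C x x' y,
      (f' x w)⁻¹ * f' x' w = k x x' y := by
    intro x x' y hy hy' w hw
    obtain ⟨c1, c2, c3, c4⟩ := hC x x' y hy hy'
    by_cases hwF : w ∈ F
    · simp only [f', dif_pos hwF, inv_inv]
      obtain ⟨d1, d2, d3, d4⟩ := hC x ⟨w, hwF⟩ w (c3 hw).1 (hxB ⟨w, hwF⟩)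
      obtain ⟨e1, e2, e3, e4⟩ := hC x' ⟨w, hwF⟩ w (c3 hw).2 (hxB ⟨w, hwF⟩)
      obtain ⟨D, hD, -, -, ⟨q, hq, -⟩, -⟩ := hF w _
        ((c1.inter (d1.inter e1)).mem_nhds ⟨hw, d2, e2⟩)
      rw [← c4 q ⟨(hD hq.1).1, hq.2⟩, ← d4 q ⟨(hD hq.1).2.1, hq.2⟩, ← e4 q ⟨(hD hq.1).2.2, hq.2⟩]
      group
    · simp only [f', dif_neg hwF]
      exact c4 w ⟨hw, hwF⟩
  let U : Option F → Set X := fun o => o.elim Fᶜ B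
  -- Off `F` the given holonomy; around a point of `F` the holonomy with potential `f' x`. Glued
  -- together they extend `θ` over all of `X`, which is simply connected.
  let w : ∀ o : Option F, Holonomy (U o) Q
    | none => θ
    | some x => (⟨fun _ => 1, fun _ => rfl, fun _ => rfl⟩ : Holonomy (B x) Q).gauge
        fun y => f' x y
  have hmix : ∀ x (γ : C(I, X)) (hi : ∀ t, γ t ∈ Fᶜ) (hj : ∀ t, γ t ∈ B x),
      θ (γ.intoSet _ hi) = f' x (γ 1) * 1 * (f' x (γ 0))⁻¹ := by
    intro x γ hi hj
    rw [hf x (γ.intoSet _ hi) hj]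
    simp only [f']
    rw [dif_neg (hi 1), dif_neg (hi 0), mul_one]
    rfl
  obtain ⟨W, hW⟩ := Holonomy.exists_glue (U := U) (by
      rintro (_ | x)
      · exact hcl.isOpen_compl
      · exact hB x) (fun y => by
      by_cases hy : y ∈ F
      · exact ⟨some ⟨y, hy⟩, hxB ⟨y, hy⟩⟩
      · exact ⟨none, hy⟩) w (by
      rintro (_ | x) (_ | x') γ hi hj
      · rfl
      · exact hmix x' γ hi hj
      · exact (hmix x γ hj hi).symm
      · change f' x (γ 1) * 1 * (f' x (γ 0))⁻¹ = f' x' (γ 1) * 1 * (f' x' (γ 0))⁻¹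
        have hlc : IsLocallyConstant fun t => (f' x (γ t))⁻¹ * f' x' (γ t) := by
          rw [IsLocallyConstant.iff_eventually_eq]
          intro t
          obtain ⟨c1, c2, c3, c4⟩ := hC x x' (γ t) (hi t) (hj t)
          filter_upwards [(c1.preimage γ.continuous).mem_nhds c2] with s hs
          rw [h3 x x' (γ t) (hi t) (hj t) _ hs, h3 x x' (γ t) (hi t) (hj t) _ c2]
        have := hlc.apply_eq_of_preconnectedSpace 0 1
        have e : f' x (γ 1) * 1 * (f' x (γ 0))⁻¹ =
          f' x (γ 1) * ((f' x (γ 0))⁻¹ * f' x' (γ 0)) * (f' x' (γ 0))⁻¹ := by group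
        rw [e, this]; group)
  intro γ _ hγ
  rw [← hW none γ]
  exact W.eq_one_of_simplyConnected (congrArg Subtype.val hγ)

/-- A holonomy on the complement of a tame closed connected subset `F` of a simply connected space
is trivial if it is trivial near one point of `F`. -/
theorem IsTame.trivialOn_univ_of_connected [SimplyConnectedSpace X] {F : Set X} (hF : IsTame F)
    (hcl : IsClosed F) (hconn : IsPreconnected F) (θ : Holonomy ↥Fᶜ Q)
    {x₀ : X} (hx₀ : x₀ ∈ F) (h : ∃ O ∈ 𝓝 x₀, θ.TrivialOn {y | (y : X) ∈ O}) :
    θ.TrivialOn Set.univ := by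
  refine hF.trivialOn_univ hcl θ fun x hx => ?_
  have : PreconnectedSpace F := Subtype.preconnectedSpace hconn
  let T : Set F := {x | ∃ O ∈ 𝓝 (x : X), θ.TrivialOn {y | (y : X) ∈ O}}
  have hT : IsOpen T := by
    rw [isOpen_iff_forall_mem_open]
    rintro x ⟨O, hO, h⟩
    obtain ⟨O', hO', ho, hx⟩ := mem_nhds_iff.mp hO
    exact ⟨{x | (x : X) ∈ O'}, fun x' hx' => ⟨O, Filter.mem_of_superset (ho.mem_nhds hx') hO', h⟩,
      ho.preimage continuous_subtype_val, hx⟩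
  have hT' : IsOpen Tᶜ := by
    rw [isOpen_iff_forall_mem_open]
    intro x hx
    obtain ⟨B, -, hB, hxB, hpc, hsh⟩ := hF x _ Filter.univ_mem
    refine ⟨{x | (x : X) ∈ B}, fun x' hx' hT => hx ?_, hB.preimage continuous_subtype_val, hxB⟩
    obtain ⟨O', hO', h'⟩ := hT
    obtain ⟨H, H0, H1⟩ := hsh x' ⟨hx', x'.2⟩ O' hO'
    refine ⟨B, hB.mem_nhds hxB, fun γ hγ hloop => ?_⟩
    let J : C(↥(B \ F), ↥Fᶜ) := ⟨fun y => ⟨y, y.2.2⟩, by fun_prop⟩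
    let γ' : C(I, ↥(B \ F)) := ⟨fun t => ⟨γ t, hγ t, (γ t).2⟩, by fun_prop⟩
    -- A loop of `B \ F` is shrunk into the neighbourhood `O'` of `x'`, where `θ` is trivial. The
    -- two ends of the loop have the same track, so the transport along the loop is the identity as
    -- well. Hence triviality near `x'` spreads to all of `B`.
    have sq := (θ.comap J).square (b := γ') (t := ⟨fun s => H (1, γ' s), by fun_prop⟩)
      (l := ⟨fun t => H (t, γ' 0), by fun_prop⟩) (r := ⟨fun t => H (t, γ' 1), by fun_prop⟩)
      ⟨fun p => H (p.2, γ' p.1), by fun_prop⟩ (fun s => H0 _) (fun _ => rfl) (fun _ => rfl)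
      (fun _ => rfl)
    have e1 : θ.comap J ⟨fun s => H (1, γ' s), by fun_prop⟩ = 1 :=
      h' _ (fun t => H1 _) (by
        have : γ' 0 = γ' 1 := Subtype.ext (congrArg (fun y : ↥Fᶜ => (y : X)) hloop)
        simp [this])
    have e2 : γ' 0 = γ' 1 := Subtype.ext (congrArg (fun y : ↥Fᶜ => (y : X)) hloop)
    have e3 : θ.comap J γ' = θ γ := rfl
    rw [e1, e2, one_mul, e3] at sq
    exact mul_eq_left.mp sq
  have huniv : T = Set.univ := IsClopen.eq_univ ⟨⟨hT'⟩, hT⟩ ⟨⟨x₀, hx₀⟩, h⟩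
  have : (⟨x, hx⟩ : F) ∈ T := huniv ▸ trivial
  exact this

end

/-! ### Slice charts -/

section

variable {X E E' : Type*} [TopologicalSpace X] [NormedAddCommGroup E] [NormedSpace ℝ E]
  [NormedAddCommGroup E'] [NormedSpace ℝ E']

/-- The map `v ↦ r v / (1 + ‖v‖)` carries the space minus the origin onto the ball minus the origin.
-/
theorem isPathConnected_ball_diff_zero (h : 1 < Module.rank ℝ E') {r : ℝ} (hr : 0 < r) :
    IsPathConnected (Metric.ball (0 : E') r \ {0}) := by
  have hpos : ∀ v : E', 0 < 1 + ‖v‖ := fun v => by positivity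
  have := (isPathConnected_compl_singleton_of_one_lt_rank h (0 : E')).image
    (f := fun v : E' => (r / (1 + ‖v‖)) • v)
    (by
      refine Continuous.smul (continuous_const.div (by fun_prop) fun v => (hpos v).ne')
        continuous_id)
  convert this using 1
  ext w
  simp only [Set.mem_sdiff, Metric.mem_ball, dist_zero_right, Set.mem_singleton_iff, Set.mem_image,
    Set.mem_compl_iff]
  constructor
  · rintro ⟨h1, h2⟩
    have h3 : 0 < r - ‖w‖ := by linarith
    refine ⟨(1 / (r - ‖w‖)) • w, by simp [h2, h3.ne'], ?_⟩
    rw [norm_smul, smul_smul, Real.norm_of_nonneg (by positivity)]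
    convert one_smul ℝ w using 2
    field_simp
    ring
  · rintro ⟨v, hv, rfl⟩
    refine ⟨?_, smul_ne_zero (div_ne_zero hr.ne' (hpos v).ne') hv⟩
    rw [norm_smul, Real.norm_of_nonneg (div_nonneg hr.le (hpos v).le), div_mul_eq_mul_div,
      div_lt_iff₀ (hpos v)]
    nlinarith [norm_nonneg v]

/-- In the chart, `B` is a product of balls and `B \ F` is a ball times a punctured ball.
Contracting by positive factors towards a point of the slice only rescales the normal coordinate, so
the contraction never meets `F`. -/
theorem exists_tame_nhd_of_slice (h : 1 < Module.rank ℝ E') {F : Set X}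
    (e : OpenPartialHomeomorph X (E × E')) {x : X} (hx : x ∈ e.source) (hxF : x ∈ F)
    (he : ∀ y ∈ e.source, y ∈ F ↔ (e y).2 = 0) {O : Set X} (hO : O ∈ 𝓝 x) :
    ∃ B ⊆ O, IsOpen B ∧ x ∈ B ∧ IsPathConnected (B \ F) ∧
      ∀ x' ∈ B ∩ F, ∀ O' ∈ 𝓝 x', ∃ H : C(I × ↥(B \ F), ↥(B \ F)),
        (∀ y, H (0, y) = y) ∧ ∀ y, (H (1, y) : X) ∈ O' := by
  have hsymm : ∀ y ∈ e.source, ∀ O ∈ 𝓝 y, ∃ r > 0, Metric.ball (e y) r ⊆ e.target ∩ e.symm ⁻¹' O := by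
    intro y hy O hO
    refine Metric.mem_nhds_iff.mp (Filter.inter_mem (e.open_target.mem_nhds (e.map_source hy)) ?_)
    exact (e.continuousAt_symm (e.map_source hy)).preimage_mem_nhds (by rwa [e.left_inv hy])
  obtain ⟨r, hr, hball⟩ := hsymm x hx O hO
  have hex : e x = ((e x).1, 0) := Prod.ext rfl ((he x hx).mp hxF)
  let P : Set (E × E') := Metric.ball (e x) r
  have hP : P = Metric.ball (e x).1 r ×ˢ Metric.ball (0 : E') r := by
    simp only [P]; rw [hex, ball_prod_same]
  have hPconv : Convex ℝ P := convex_ball _ _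
  let B : Set X := e.source ∩ e ⁻¹' P
  have hBs : ∀ p ∈ P, e.symm p ∈ B := fun p hp =>
    ⟨e.map_target (hball hp).1, by rw [Set.mem_preimage, e.right_inv (hball hp).1]; exact hp⟩
  have hBF : B \ F = e.symm '' (P \ {p | p.2 = 0}) := by
    ext y
    constructor
    · rintro ⟨⟨hy, hyP⟩, hyF⟩
      exact ⟨e y, ⟨hyP, fun h0 => hyF ((he y hy).mpr h0)⟩, e.left_inv hy⟩
    · rintro ⟨p, ⟨hp, hp0⟩, rfl⟩
      refine ⟨hBs p hp, fun hF => hp0 ?_⟩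
      have := (he _ (hBs p hp).1).mp hF
      rwa [e.right_inv (hball hp).1] at this
  refine ⟨B, fun y hy => ?_, e.isOpen_inter_preimage Metric.isOpen_ball,
    ⟨hx, Metric.mem_ball_self hr⟩, ?_, ?_⟩
  · have := (hball hy.2).2
    rwa [Set.mem_preimage, e.left_inv hy.1] at this
  · rw [hBF]
    have h1 : P \ {p | p.2 = 0} = Metric.ball (e x).1 r ×ˢ (Metric.ball (0 : E') r \ {0}) := by
      rw [hP]; ext p; simp [and_assoc]
    have h2 : IsPathConnected (P \ {p | p.2 = 0}) := by
      rw [h1]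
      exact ((convex_ball _ _).isPathConnected ⟨_, Metric.mem_ball_self hr⟩).prod
        (isPathConnected_ball_diff_zero h hr)
    exact h2.image' (e.continuousOn_symm.mono fun p hp => (hball hp.1).1)
  · rintro x' ⟨⟨hx's, hx'P⟩, hx'F⟩ O' hO'
    obtain ⟨δ, hδ, hball'⟩ := hsymm x' hx's O' hO'
    -- Points of the ball of radius `r` are less than `2 * r` apart, so the contraction by `ε` ends
    -- within `δ` of `e x'`.
    let ε : ℝ := min 1 (δ / (2 * (2 * r)))
    have hε : 0 < ε := lt_min one_pos (by positivity)
    have hε1 : ε ≤ 1 := min_le_left _ _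
    have hε2 : ε * (2 * r) < δ := by
      have : ε ≤ δ / (2 * (2 * r)) := min_le_right _ _
      rw [le_div_iff₀ (by positivity)] at this
      nlinarith
    have hx'0 : (e x').2 = 0 := (he x' hx's).mp hx'F
    let c : I → ℝ := fun t => 1 - t * (1 - ε)
    have hc0 : ∀ t, 0 < c t := fun t => by
      have := t.2.1; have := t.2.2; simp only [c]; nlinarith
    have hc1 : ∀ t, c t ≤ 1 := fun t => by
      have := t.2.1; simp only [c]; nlinarith
    let K : I × ↥(B \ F) → E × E' := fun q => c q.1 • e q.2 + (1 - c q.1) • e x'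
    have hKP : ∀ q, K q ∈ P := fun q =>
      hPconv q.2.2.1.2 hx'P (hc0 _).le (by linarith [hc1 q.1]) (by ring)
    have hK0 : ∀ q, (K q).2 ≠ 0 := by
      intro q h0
      simp only [K, Prod.snd_add, Prod.smul_snd, hx'0, smul_zero, add_zero] at h0
      exact q.2.2.2 ((he _ q.2.2.1.1).mpr ((smul_eq_zero.mp h0).resolve_left (hc0 _).ne'))
    have hcont : Continuous K := by
      have : Continuous fun q : I × ↥(B \ F) => e q.2 :=
        e.continuousOn.comp_continuous (by fun_prop) fun q => q.2.2.1.1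
      have hc : Continuous fun q : I × ↥(B \ F) => c q.1 := by simp only [c]; fun_prop
      exact (hc.smul this).add ((continuous_const.sub hc).smul continuous_const)
    refine ⟨⟨fun q => ⟨e.symm (K q), by rw [hBF]; exact ⟨K q, ⟨hKP q, hK0 q⟩, rfl⟩⟩, ?_⟩, ?_, ?_⟩
    · exact (e.continuousOn_symm.comp_continuous hcont fun q => (hball (hKP q)).1).subtype_mk _
    · intro y
      ext
      simp only [ContinuousMap.coe_mk, K, c]
      simp [e.left_inv y.2.1.1]
    · intro y
      refine (hball' ?_).2
      have e1 : K (1, y) - e x' = ε • (e y - e x') := by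
        simp only [K, c]; simp; module
      rw [Metric.mem_ball, dist_eq_norm, e1, norm_smul, Real.norm_of_nonneg hε.le]
      refine lt_of_le_of_lt (mul_le_mul_of_nonneg_left ?_ hε.le) hε2
      have d1 : dist (e y) (e x) < r := y.2.1.2
      have d2 : dist (e x') (e x) < r := hx'P
      rw [← dist_eq_norm]
      linarith [dist_triangle_right (e y) (e x') (e x)]

theorem exists_tame_nhd_of_notMem [LocallyPathConnectedSpace X] {F : Set X} (hF : IsClosed F) {x : X}
    (hx : x ∉ F) {O : Set X} (hO : O ∈ 𝓝 x) :
    ∃ B ⊆ O, IsOpen B ∧ x ∈ B ∧ IsPathConnected (B \ F) ∧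
      ∀ x' ∈ B ∩ F, ∀ O' ∈ 𝓝 x', ∃ H : C(I × ↥(B \ F), ↥(B \ F)),
        (∀ y, H (0, y) = y) ∧ ∀ y, (H (1, y) : X) ∈ O' := by
  obtain ⟨B, ⟨hB, hxB, hpc⟩, hBO⟩ := (isOpen_isPathConnected_basis x).mem_iff.mp
    (Filter.inter_mem hO (hF.isOpen_compl.mem_nhds hx))
  have hd : Disjoint B F := Set.disjoint_left.mpr fun y hy hyF => (hBO hy).2 hyF
  refine ⟨B, fun y hy => (hBO hy).1, hB, hxB, by simpa [hd.sdiff_eq_left] using hpc, ?_⟩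
  rintro x' ⟨h1, h2⟩
  exact absurd h2 (hBO h1).2

end
end

/-! ### Tameness of smooth surfaces and of knots. -/

noncomputable section
open unitInterval Topology

/-- An immersion is `s ↦ (s, 0)` in suitable charts, with a complement of dimension `4 - 2 = 2`. To
make this a slice chart for the image, other sheets of the surface must be kept away, which is
possible because `ι` is a topological embedding. -/
theorem IsTame.of_isSmoothEmbedding
    {X : Type*} [TopologicalSpace X] [T2Space X]
    [ChartedSpace (EuclideanSpace ℝ (Fin 4)) X]
    {S : Type*} [TopologicalSpace S] [CompactSpace S]
    [ChartedSpace (EuclideanSpace ℝ (Fin 2)) S]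
    {ι : S → X} (hι : Manifold.IsSmoothEmbedding (𝓡 2) (𝓡 4) ∞ ι) : IsTame (Set.range ι) := by
  have : LocallyPathConnectedSpace X :=
    ChartedSpace.locallyPathConnectedSpace (EuclideanSpace ℝ (Fin 4)) X
  have hcl : IsClosed (Set.range ι) := (isCompact_range hι.isEmbedding.continuous).isClosed
  intro x O hO
  by_cases hx : x ∈ Set.range ι
  swap
  · exact exists_tame_nhd_of_notMem hcl hx hO
  obtain ⟨s, rfl⟩ := hx
  have h := hι.isImmersion.isImmersionAt s
  have hfin : Module.Finite ℝ h.complement :=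
    Module.Finite.of_injective (h.equiv.toLinearMap ∘ₗ LinearMap.inr ℝ _ _)
      (h.equiv.injective.comp LinearMap.inr_injective)
  have hrank : 1 < Module.rank ℝ h.complement := by
    have e := h.equiv.toLinearEquiv.finrank_eq
    rw [Module.finrank_prod, finrank_euclideanSpace_fin, finrank_euclideanSpace_fin] at e
    rw [← Module.finrank_eq_rank]
    have : Module.finrank ℝ h.complement = 2 := by omega
    rw [this]; norm_num
  obtain ⟨W, hW, hWs⟩ := (hι.isEmbedding.isInducing.isOpen_iff).mp h.domChart.open_source
  let e₀ : OpenPartialHomeomorph X (EuclideanSpace ℝ (Fin 2) × h.complement) :=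
    h.codChart.trans h.equiv.symm.toHomeomorph.toOpenPartialHomeomorph
  have he₀ : ∀ s' ∈ h.domChart.source, e₀ (ι s') = (h.domChart s', 0) := by
    intro s' hs'
    have := h.writtenInCharts (show h.domChart s' ∈ (h.domChart.extend (𝓡 2)).target by
      simpa using h.domChart.map_source hs')
    simp only [Function.comp_apply, OpenPartialHomeomorph.extend_coe,
      OpenPartialHomeomorph.extend_coe_symm] at this
    change h.codChart (ι (h.domChart.symm (h.domChart s'))) = h.equiv (h.domChart s', 0) at this
    rw [h.domChart.left_inv hs'] at this
    change h.equiv.symm (h.codChart (ι s')) = _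
    rw [this, ContinuousLinearEquiv.symm_apply_apply]
  have hs : s ∈ h.domChart.source := h.mem_domChart_source
  have hsrc : e₀.source = h.codChart.source := by simp [e₀]
  have hmaps : ∀ s' ∈ h.domChart.source, ι s' ∈ e₀.source := fun s' hs' => by
    rw [hsrc]; exact h.source_subset_preimage_source hs'
  -- `W` excludes points of the image that come from outside the domain chart. The condition on the
  -- first coordinate excludes points of the plane `E × 0` that do not come from the surface.
  let W' : Set X := W ∩ (e₀.source ∩ e₀ ⁻¹' (h.domChart.target ×ˢ Set.univ))
  have hW' : IsOpen W' :=
    hW.inter (e₀.isOpen_inter_preimage (h.domChart.open_target.prod isOpen_univ))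
  have hmem : ∀ s' ∈ h.domChart.source, ι s' ∈ W' := by
    intro s' hs'
    refine ⟨?_, hmaps s' hs', ?_⟩
    · rw [← hWs] at hs'; exact hs'
    · rw [Set.mem_preimage, he₀ s' hs']
      exact ⟨h.domChart.map_source hs', trivial⟩
  refine exists_tame_nhd_of_slice hrank (e₀.restrOpen W' hW') (x := ι s) ?_ (Set.mem_range_self s) ?_ hO
  · rw [OpenPartialHomeomorph.restrOpen_source]
    exact ⟨hmaps s hs, hmem s hs⟩
  · intro y hy
    rw [OpenPartialHomeomorph.restrOpen_source] at hy
    rw [OpenPartialHomeomorph.coe_restrOpen]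
    constructor
    · rintro ⟨s', rfl⟩
      have hs' : s' ∈ h.domChart.source := by
        rw [← hWs]; exact hy.2.1
      rw [he₀ s' hs']
    · intro h0
      have hp : (e₀ y).1 ∈ h.domChart.target := hy.2.2.2.1
      refine ⟨h.domChart.symm (e₀ y).1, ?_⟩
      have hs' := h.domChart.map_target hp
      refine e₀.injOn (hmaps _ hs') hy.1 ?_
      rw [he₀ _ hs', h.domChart.right_inv hp]
      exact Prod.ext rfl h0.symm

instance : ConnectedSpace S3 :=
  isConnected_iff_connectedSpace.mp (isConnected_sphere (by
    rw [← Module.finrank_eq_rank, finrank_euclideanSpace_fin]; norm_num) _ zero_le_one)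

namespace TubedKnot

variable (N : TubedKnot)

theorem isClosed_knot : IsClosed N.knot :=
  (isCompact_range (N.continuous.comp (by fun_prop))).isClosed

theorem apply_mem_knot_iff (p : Circle × ℂ) : N.toFun p ∈ N.knot ↔ p.2 = 0 := by
  constructor
  · intro h
    by_contra hne
    exact N.notMem_knot (z := p.1) hne h
  · intro h
    exact ⟨p.1, by rw [← h]⟩

/-- The trivialized tube, with a chart of the circle in place of the core, is a slice chart. -/
theorem isTame_knot : IsTame N.knot := by
  have : LocallyPathConnectedSpace S3 :=
    ChartedSpace.locallyPathConnectedSpace (EuclideanSpace ℝ (Fin 3)) S3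
  intro x O hO
  by_cases hx : x ∈ N.knot
  swap
  · exact exists_tame_nhd_of_notMem N.isClosed_knot hx hO
  obtain ⟨z, rfl⟩ := hx
  let e₁ := N.isOpenEmbedding.toOpenPartialHomeomorph.symm
  have he₁ : ∀ p, e₁ (N.toFun p) = p := fun p =>
    N.isOpenEmbedding.toOpenPartialHomeomorph_left_inv
  have hsrc : e₁.source = Set.range N.toFun := by simp [e₁]
  let e := e₁.trans ((chartAt (EuclideanSpace ℝ (Fin 1)) z).prod (OpenPartialHomeomorph.refl ℂ))
  refine exists_tame_nhd_of_slice (by rw [Complex.rank_real_complex]; norm_num) e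
    (x := N.toFun (z, 0)) ?_ ((N.apply_mem_knot_iff _).mpr rfl) ?_ hO
  · simp only [e, OpenPartialHomeomorph.trans_source, hsrc]
    refine ⟨⟨(z, 0), rfl⟩, ?_⟩
    rw [Set.mem_preimage, he₁]
    simp
  · intro y hy
    have hy1 : y ∈ Set.range N.toFun := by rw [← hsrc]; exact hy.1
    obtain ⟨p, rfl⟩ := hy1
    rw [N.apply_mem_knot_iff]
    have : (e (N.toFun p)).2 = p.2 := by
      change (e₁ (N.toFun p)).2 = _
      rw [he₁]
    rw [this]

instance : PathConnectedSpace ↥(N.knot)ᶜ :=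
  isPathConnected_iff_pathConnectedSpace.mp N.isTame_knot.isPathConnected_compl

end TubedKnot
end

/-! ### Freely homotopic circles, and the group of the surface complement in `X`. -/

noncomputable section
open Topology
local notation "I" => unitInterval

namespace Holonomy

variable {D G : Type*} [TopologicalSpace D] [Group G]

/-- Circle fibres over a path-connected base have conjugate holonomies. -/
theorem exists_conj_circleLoop [PathConnectedSpace D] (W : Holonomy (Circle × D) G)
    (a b : Circle × D) : ∃ g : G, W ((circleLoop a.1).prodMk (.const I a.2)) =
      g * W ((circleLoop b.1).prodMk (.const I b.2)) * g⁻¹ := by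
  let δ : Path b a := PathConnectedSpace.somePath b a
  have := W.square (b := (circleLoop b.1).prodMk (.const I b.2))
    (t := (circleLoop a.1).prodMk (.const I a.2)) (l := δ) (r := δ)
    ⟨fun p => (Circle.exp (2 * Real.pi * p.1) * (δ p.2).1, (δ p.2).2), by fun_prop⟩
    (fun s => by simp [circleLoop]) (fun s => by simp) (fun s => by simp [circleLoop])
    (fun s => by simp)
  exact ⟨W δ, by rw [this]; group⟩

/-- A null-homologous loop has trivial holonomy if the fundamental group is commutative. -/
theorem eq_one_of_nullHomologous_of_mulEquiv {Y A : Type*} [TopologicalSpace Y]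
    [PathConnectedSpace Y] [CommGroup A] {γ : C(Circle, Y)}
    (e : FundamentalGroup Y (γ 1) ≃* A) (h : NullHomologous γ) (W : Holonomy Y G) :
    W (γ.comp (circleLoop 1)) = 1 := by
  let P : Path (γ 1) (γ 1) := ⟨γ.comp (circleLoop 1), congrArg γ (circleLoop_zero 1),
    congrArg γ (circleLoop_one 1)⟩
  have h2 : (FundamentalGroup.fromPath (Path.Homotopic.Quotient.mk P) :
      FundamentalGroup Y (γ 1)) = 1 := by
    apply e.injective
    refine Eq.trans ?_ e.map_one.symm
    rw [← (ofHom e.toMonoidHom).eq_one_of_nullHomologous h]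
    exact (DFunLike.congr_fun (toHom_ofHom e.toMonoidHom) _).symm
  exact (congrArg (W.toHom _) h2).trans (W.toHom _).map_one

end Holonomy

/-! ### Polar coordinates -/

/-- The complement of the axis in `ℝ × ℂ`. -/
abbrev OffAxis := {v : ℝ × ℂ // v.2 ≠ 0}

instance : PathConnectedSpace OffAxis := by
  have h : IsPathConnected ((Set.univ : Set ℝ) ×ˢ ({0}ᶜ : Set ℂ)) :=
    isPathConnected_univ.prod (isPathConnected_compl_singleton_of_one_lt_rank (by
      rw [Complex.rank_real_complex]; norm_num) 0)
  have e : ((Set.univ : Set ℝ) ×ˢ ({0}ᶜ : Set ℂ)) = {v : ℝ × ℂ | v.2 ≠ 0} := by ext; simp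
  rw [e] at h
  exact isPathConnected_iff_pathConnectedSpace.mp h

theorem continuous_eucSq : Continuous eucSq := by unfold eucSq; fun_prop

theorem eucSq_pos (v : OffAxis) : 0 < eucSq v := by
  have := norm_pos_iff.mpr v.2
  unfold eucSq; positivity

/-- Spherical coordinates: longitude, radius, and sine of the latitude. -/
def spherical (q : Circle × (ℝ × ℝ)) : ℝ × ℂ :=
  (q.2.1 * q.2.2, (q.2.1 * √(1 - q.2.2 ^ 2) : ℝ) * q.1)

theorem continuous_spherical : Continuous spherical := by unfold spherical; fun_prop

theorem spherical_snd_ne_zero {q : Circle × (ℝ × ℝ)} (h1 : 0 < q.2.1) (h2 : q.2.2 ∈ Set.Ioo (-1) 1) :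
    (spherical q).2 ≠ 0 := by
  have : 0 < 1 - q.2.2 ^ 2 := by nlinarith [h2.1, h2.2]
  exact mul_ne_zero (Complex.ofReal_ne_zero.mpr (by positivity)) (Circle.coe_ne_zero _)

theorem eucSq_spherical {q : Circle × (ℝ × ℝ)} (h2 : q.2.2 ∈ Set.Ioo (-1) 1) :
    eucSq (spherical q) = q.2.1 ^ 2 := by
  have : 0 < 1 - q.2.2 ^ 2 := by nlinarith [h2.1, h2.2]
  simp only [eucSq, spherical, norm_mul, Circle.norm_coe, Complex.norm_real, mul_one,
    Real.norm_eq_abs, mul_pow, sq_abs, Real.sq_sqrt this.le]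
  ring

/-- The longitude of a point off the axis. -/
def longitude : C(OffAxis, Circle) where
  toFun v := ⟨(v : ℝ × ℂ).2 / ‖(v : ℝ × ℂ).2‖, by
    change _ ∈ Metric.sphere (0 : ℂ) 1
    rw [mem_sphere_zero_iff_norm]
    have := norm_ne_zero_iff.mpr v.2
    simp [this]⟩
  continuous_toFun := by
    refine Continuous.subtype_mk (Continuous.div (by fun_prop) (by fun_prop) fun v => ?_) _
    exact Complex.ofReal_ne_zero.mpr (norm_ne_zero_iff.mpr v.2)

/-- The inverse of spherical coordinates. -/
def sphericalInv : C(OffAxis, Circle × (ℝ × ℝ)) where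
  toFun v := (longitude v, √(eucSq v), (v : ℝ × ℂ).1 / √(eucSq v))
  continuous_toFun := by
    have : Continuous fun v : OffAxis => √(eucSq v) :=
      (continuous_eucSq.comp continuous_subtype_val).sqrt
    refine longitude.continuous.prodMk (this.prodMk (Continuous.div (by fun_prop) this fun v => ?_))
    exact (Real.sqrt_pos.mpr (eucSq_pos v)).ne'

theorem sphericalInv_mem (v : OffAxis) : (sphericalInv v).2.2 ∈ Set.Ioo (-1 : ℝ) 1 := by
  have h := Real.sqrt_pos.mpr (eucSq_pos v)
  have hu := norm_pos_iff.mpr v.2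
  have hlt : |(v : ℝ × ℂ).1| < √(eucSq v) := by
    apply Real.lt_sqrt_of_sq_lt
    rw [sq_abs]; unfold eucSq; nlinarith
  change (v : ℝ × ℂ).1 / √(eucSq v) ∈ _
  rw [Set.mem_Ioo, lt_div_iff₀ h, div_lt_iff₀ h, neg_one_mul, one_mul]
  exact abs_lt.mp hlt

theorem spherical_sphericalInv (v : OffAxis) : spherical (sphericalInv v) = v := by
  have h := Real.sqrt_pos.mpr (eucSq_pos v)
  have hu := norm_pos_iff.mpr v.2
  refine Prod.ext ?_ ?_
  · change √(eucSq v) * ((v : ℝ × ℂ).1 / √(eucSq v)) = _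
    field_simp
  · change ((√(eucSq v) * √(1 - ((v : ℝ × ℂ).1 / √(eucSq v)) ^ 2) : ℝ) : ℂ) *
      ((v : ℝ × ℂ).2 / ‖(v : ℝ × ℂ).2‖) = _
    have : √(eucSq v) * √(1 - ((v : ℝ × ℂ).1 / √(eucSq v)) ^ 2) = ‖(v : ℝ × ℂ).2‖ := by
      rw [← Real.sqrt_mul (eucSq_pos v).le, div_pow, Real.sq_sqrt (eucSq_pos v).le, mul_sub, mul_one,
        mul_div_cancel₀ _ (eucSq_pos v).ne']
      rw [show eucSq v - (v : ℝ × ℂ).1 ^ 2 = ‖(v : ℝ × ℂ).2‖ ^ 2 by unfold eucSq; ring]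
      exact Real.sqrt_sq hu.le
    rw [this]
    have : (‖(v : ℝ × ℂ).2‖ : ℂ) ≠ 0 := Complex.ofReal_ne_zero.mpr hu.ne'
    field_simp

/-! ### The complement of the surface -/

theorem IsTame.nonempty_mulEquiv {X : Type*} [TopologicalSpace X] [SimplyConnectedSpace X]
    {F : Set X} (hF : IsTame F) {d : ℕ} {x₀ : ↥Fᶜ}
    (hd : Nonempty (FundamentalGroup ↥Fᶜ x₀ ≃* Multiplicative (ZMod d))) (y : ↥Fᶜ) :
    Nonempty (FundamentalGroup ↥Fᶜ y ≃* Multiplicative (ZMod d)) := by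
  have : PathConnectedSpace ↥Fᶜ :=
    isPathConnected_iff_pathConnectedSpace.mp hF.isPathConnected_compl
  obtain ⟨e⟩ := hd
  exact ⟨(FundamentalGroup.fundamentalGroupMulEquivOfPathConnected y x₀).trans e⟩

namespace CurveTriv

variable {X : Type*} [TopologicalSpace X] [ChartedSpace (EuclideanSpace ℝ (Fin 4)) X] {F : Set X}
  (σ : CurveTriv F)

theorem isOpenEmbedding : IsOpenEmbedding σ.toFun :=
  .of_continuous_injective_isOpenMap σ.isLocalDiffeomorph.contMDiff.continuous σ.injective
    σ.isLocalDiffeomorph.isOpenMap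

theorem continuous : Continuous σ.toFun := σ.isOpenEmbedding.continuous

theorem apply_mem_iff (q : Circle × (ℝ × ℂ)) : σ.toFun q ∈ F ↔ q.2.2 = 0 := σ.mem_iff q.1 q.2.1 q.2.2

/-- The trivialization off the axis. -/
def offAxis : C(Circle × OffAxis, ↥Fᶜ) where
  toFun q := ⟨σ.toFun (q.1, q.2), fun h => q.2.2 ((σ.apply_mem_iff _).mp h)⟩
  continuous_toFun := (σ.continuous.comp (by fun_prop)).subtype_mk _

/-- The points of `ℝ × ℂ` off the axis on a circle about the axis. -/
def axisCircle (r : ℝ) (hr : 0 < r) : C(Circle, OffAxis) where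
  toFun w := ⟨(0, r * w), mul_ne_zero (Complex.ofReal_ne_zero.mpr hr.ne') w.coe_ne_zero⟩
  continuous_toFun := by fun_prop

/-- The meridian of the surface. -/
def meridian (p : Circle) : C(I, ↥Fᶜ) :=
  (σ.offAxis.comp ((ContinuousMap.const Circle 1).prodMk (axisCircle 2 two_pos))).comp (circleLoop p)

theorem meridian_zero (p : Circle) : σ.meridian p 0 = σ.offAxis (1, axisCircle 2 two_pos p) := by
  simp [meridian, circleLoop_zero]

theorem meridian_one (p : Circle) : σ.meridian p 1 = σ.offAxis (1, axisCircle 2 two_pos p) := by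
  simp [meridian, circleLoop_one]

variable {G : Type*} [Group G]

/-- A chart for the complement of the axis near one point of the curve. -/
def sector : C(Circle × (ℝ × ↥(Set.Ioi (0 : ℝ) ×ˢ Set.Ioo (-1 : ℝ) 1)), ↥Fᶜ) :=
  σ.offAxis.comp ⟨fun q => (Circle.exp q.2.1, ⟨spherical (q.1, q.2.2),
    spherical_snd_ne_zero q.2.2.2.1 q.2.2.2.2⟩), by
    refine Continuous.prodMk (by fun_prop) (Continuous.subtype_mk ?_ _)
    exact continuous_spherical.comp (by fun_prop)⟩

instance : ContractibleSpace ↥(Set.Ioi (0 : ℝ) ×ˢ Set.Ioo (-1 : ℝ) 1) :=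
  ((convex_Ioi (0 : ℝ)).prod (convex_Ioo (-1 : ℝ) 1)).contractibleSpace ⟨(1, 0), by simp⟩

/-- Over an arc of the curve, the complement of the surface is a circle of longitudes times a
contractible space, by spherical coordinates. Each loop there is a power of a circle of longitudes,
and this circle is conjugate to the meridian. -/
theorem exists_trivialOn_nhds (W : Holonomy ↥Fᶜ G) (p : Circle) (h : W (σ.meridian p) = 1) :
    ∃ O ∈ 𝓝 (σ.toFun (1, 0)), W.TrivialOn {y | (y : X) ∈ O} := by
  -- The curve is cut open at `-1`, so that its angle becomes a continuous real coordinate.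
  let A : Set (Circle × (ℝ × ℂ)) := {q | (q.1 : ℂ) ∈ Complex.slitPlane}
  have hA : IsOpen A := Complex.isOpen_slitPlane.preimage (by fun_prop)
  refine ⟨σ.toFun '' A, (σ.isOpenEmbedding.isOpenMap _ hA).mem_nhds ⟨_, by simp [A], rfl⟩, ?_⟩
  intro γ hγ hloop
  choose q hqA hq using hγ
  have hqc : Continuous q := by
    rw [σ.isOpenEmbedding.isInducing.continuous_iff]
    have : σ.toFun ∘ q = fun t => (γ t : X) := funext hq
    rw [this]; fun_prop
  have hq0 : ∀ t, (q t).2.2 ≠ 0 := fun t h => (γ t).2 (by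
    rw [← hq]; exact (σ.apply_mem_iff _).mpr h)
  let v : C(I, OffAxis) := ⟨fun t => ⟨(q t).2, hq0 t⟩, by fun_prop⟩
  let a : C(I, ℝ) := ⟨fun t => Complex.arg (q t).1, continuous_iff_continuousAt.mpr fun t =>
    ContinuousAt.comp (f := fun t => ((q t).1 : ℂ)) (Complex.continuousAt_arg (hqA t)) (by fun_prop)⟩
  let δ : C(I, Circle × (ℝ × ↥(Set.Ioi (0 : ℝ) ×ˢ Set.Ioo (-1 : ℝ) 1))) :=
    ⟨fun t => ((sphericalInv (v t)).1, a t, ⟨(sphericalInv (v t)).2,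
      Real.sqrt_pos.mpr (eucSq_pos _), sphericalInv_mem _⟩), by
      have hs : Continuous fun t => sphericalInv (v t) := sphericalInv.continuous.comp v.continuous
      exact hs.fst.prodMk (a.continuous.prodMk (hs.snd.subtype_mk _))⟩
  have hδ : σ.sector.comp δ = γ := by
    ext t
    rw [← hq t]
    change σ.toFun (Circle.exp (Complex.arg (q t).1), spherical (sphericalInv (v t))) = _
    rw [spherical_sphericalInv, Circle.exp_arg]
    rfl
  have hδl : δ 0 = δ 1 := by
    have e : q 0 = q 1 := σ.injective (by rw [hq, hq, hloop])
    have e' : v 0 = v 1 := Subtype.ext (congrArg Prod.snd e)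
    simp only [δ, ContinuousMap.coe_mk, e', a, e]
  obtain ⟨n, hn⟩ := Holonomy.circle_prod_eq_zpow (G := G) hδl
  have e1 := hn (W.comap σ.sector)
  rw [Holonomy.comap_apply, hδ] at e1
  obtain ⟨g, hg⟩ := (W.comap σ.sector).exists_conj_circleLoop ((δ 0).1, (δ 0).2)
    (p, 0, ⟨(2, 0), by simp⟩)
  have e2 : W.comap σ.sector ((circleLoop p).prodMk (.const I (0, ⟨(2, 0), by simp⟩))) =
      W (σ.meridian p) := by
    rw [Holonomy.comap_apply]
    congr 1
    ext t
    change σ.toFun _ = σ.toFun _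
    simp [spherical, axisCircle]
  rw [e2, h, mul_one, mul_inv_cancel] at hg
  rw [e1, hg, one_zpow]

/-- In group terms, a single meridian normally generates the fundamental group of the complement. -/
theorem eq_one_of_meridian [SimplyConnectedSpace X] (hF : IsTame F) (hcl : IsClosed F) (hconn : IsPreconnected F)
    (W : Holonomy ↥Fᶜ G) (p : Circle) (h : W (σ.meridian p) = 1) : W.TrivialOn Set.univ :=
  hF.trivialOn_univ_of_connected hcl hconn W ((σ.apply_mem_iff (1, 0)).mpr rfl)
    (σ.exists_trivialOn_nhds W p h)

/-- The meridian as a path, and its class in the fundamental group. -/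
def meridianPath (p : Circle) :
    Path (σ.offAxis (1, axisCircle 2 two_pos p)) (σ.offAxis (1, axisCircle 2 two_pos p)) :=
  ⟨σ.meridian p, σ.meridian_zero p, σ.meridian_one p⟩

/-- The class of the meridian in the fundamental group. -/
def meridianClass (p : Circle) : FundamentalGroup ↥Fᶜ (σ.offAxis (1, axisCircle 2 two_pos p)) :=
  FundamentalGroup.fromPath (Path.Homotopic.Quotient.mk (σ.meridianPath p))

theorem toHom_meridianClass (W : Holonomy ↥Fᶜ G) (p : Circle) :
    W.toHom _ (σ.meridianClass p) = W (σ.meridian p) := rfl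

variable [SimplyConnectedSpace X]

/-- The group is commutative, so the powers of the meridian form a normal subgroup. The holonomy
with values in the quotient kills the meridian, hence all loops, and the quotient is trivial. -/
theorem mem_zpowers_meridianClass (hF : IsTame F) (hcl : IsClosed F) (hconn : IsPreconnected F)
    {d : ℕ} {x₀ : ↥Fᶜ} (hd : Nonempty (FundamentalGroup ↥Fᶜ x₀ ≃* Multiplicative (ZMod d)))
    (p : Circle) (β : FundamentalGroup ↥Fᶜ (σ.offAxis (1, axisCircle 2 two_pos p))) :
    β ∈ Subgroup.zpowers (σ.meridianClass p) := by
  have : PathConnectedSpace ↥Fᶜ :=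
    isPathConnected_iff_pathConnectedSpace.mp hF.isPathConnected_compl
  obtain ⟨e⟩ := hF.nonempty_mulEquiv hd (σ.offAxis (1, axisCircle 2 two_pos p))
  have hcomm : ∀ a b : FundamentalGroup ↥Fᶜ (σ.offAxis (1, axisCircle 2 two_pos p)),
      a * b = b * a := fun a b => e.injective (by rw [map_mul, map_mul, mul_comm])
  have : (Subgroup.zpowers (σ.meridianClass p)).Normal :=
    ⟨fun n hn g => by rwa [hcomm g, mul_inv_cancel_right]⟩
  let φ := QuotientGroup.mk' (Subgroup.zpowers (σ.meridianClass p))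
  have hW : Holonomy.ofHom φ (σ.meridian p) = 1 := by
    rw [← σ.toHom_meridianClass, Holonomy.toHom_ofHom]
    exact (QuotientGroup.eq_one_iff _).mpr (Subgroup.mem_zpowers _)
  have htriv := σ.eq_one_of_meridian hF hcl hconn _ p hW
  rw [← QuotientGroup.eq_one_iff]
  change φ β = 1
  rw [← Holonomy.toHom_ofHom φ]
  induction β using Path.Homotopic.Quotient.ind with | mk b => ?_
  exact htriv _ (fun _ => trivial) (b.source.trans b.target.symm)

theorem exists_eq_meridian_zpow (hF : IsTame F) (hcl : IsClosed F) (hconn : IsPreconnected F)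
    {d : ℕ} {x₀ : ↥Fᶜ} (hd : Nonempty (FundamentalGroup ↥Fᶜ x₀ ≃* Multiplicative (ZMod d)))
    (p : Circle) (W : Holonomy ↥Fᶜ G) {γ : C(I, ↥Fᶜ)}
    (h0 : γ 0 = σ.offAxis (1, axisCircle 2 two_pos p))
    (h1 : γ 1 = σ.offAxis (1, axisCircle 2 two_pos p)) : ∃ k : ℤ, W γ = W (σ.meridian p) ^ k := by
  obtain ⟨k, hk⟩ := σ.mem_zpowers_meridianClass hF hcl hconn hd p
    (FundamentalGroup.fromPath (Path.Homotopic.Quotient.mk ⟨γ, h0, h1⟩))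
  refine ⟨k, ?_⟩
  rw [← σ.toHom_meridianClass, ← map_zpow]
  exact (congrArg (W.toHom _) hk).symm

theorem meridian_pow (hF : IsTame F) {d : ℕ} {x₀ : ↥Fᶜ}
    (hd : Nonempty (FundamentalGroup ↥Fᶜ x₀ ≃* Multiplicative (ZMod d)))
    (p : Circle) (W : Holonomy ↥Fᶜ G) : W (σ.meridian p) ^ d = 1 := by
  obtain ⟨e⟩ := hF.nonempty_mulEquiv hd (σ.offAxis (1, axisCircle 2 two_pos p))
  have h : σ.meridianClass p ^ d = 1 := by
    apply e.injective
    rw [map_pow, map_one, ← toAdd_eq_zero, toAdd_pow]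
    simp
  rw [← σ.toHom_meridianClass, ← map_pow, h, map_one]

/-- The group is cyclic, generated by the meridian, whose order is exactly `d`. The case `d = 0` is
included: the cardinality of `ZMod 0` and the order of an element of infinite order are both `0` by
convention. -/
theorem exists_holonomy_meridian_eq (hF : IsTame F) (hcl : IsClosed F) (hconn : IsPreconnected F)
    {d : ℕ} {x₀ : ↥Fᶜ} (hd : Nonempty (FundamentalGroup ↥Fᶜ x₀ ≃* Multiplicative (ZMod d)))
    (p : Circle) {g : G} (hg : g ^ d = 1) : ∃ W : Holonomy ↥Fᶜ G, W (σ.meridian p) = g := by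
  have : PathConnectedSpace ↥Fᶜ :=
    isPathConnected_iff_pathConnectedSpace.mp hF.isPathConnected_compl
  obtain ⟨e⟩ := hF.nonempty_mulEquiv hd (σ.offAxis (1, axisCircle 2 two_pos p))
  have hgen := σ.mem_zpowers_meridianClass hF hcl hconn hd p
  have ho : orderOf (σ.meridianClass p) = d := by
    rw [orderOf_eq_card_of_forall_mem_zpowers hgen, Nat.card_congr e.toEquiv,
      Nat.card_congr Multiplicative.toAdd, Nat.card_zmod]
  refine ⟨Holonomy.ofHom (monoidHomOfForallMemZpowers hgen (g' := g) (by
    rw [ho]; exact orderOf_dvd_of_pow_eq_one hg)), ?_⟩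
  rw [← σ.toHom_meridianClass, Holonomy.toHom_ofHom]
  exact monoidHomOfForallMemZpowers_apply_gen _ _

/-- In a space with commutative fundamental group a null-homologous loop is trivial. All push-offs
are freely homotopic, because the complement of the axis is path connected, so the choice of `v`
does not matter. -/
theorem eq_one_of_nullHomologous_pushOff (hF : IsTame F) {d : ℕ} {x₀ : ↥Fᶜ}
    (hd : Nonempty (FundamentalGroup ↥Fᶜ x₀ ≃* Multiplicative (ZMod d))) {p : Circle}
    (hp : NullHomologous (σ.pushOff p)) (W : Holonomy ↥Fᶜ G) (v : OffAxis) :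
    W (σ.offAxis.comp ((circleLoop 1).prodMk (.const I v))) = 1 := by
  have : PathConnectedSpace ↥Fᶜ :=
    isPathConnected_iff_pathConnectedSpace.mp hF.isPathConnected_compl
  let v₀ : OffAxis := ⟨(0, p), p.coe_ne_zero⟩
  obtain ⟨e⟩ := hF.nonempty_mulEquiv hd (σ.pushOff p 1)
  have h3 : W (σ.offAxis.comp ((circleLoop 1).prodMk (.const I v₀))) = 1 :=
    W.eq_one_of_nullHomologous_of_mulEquiv e hp
  obtain ⟨g, hg⟩ := (W.comap σ.offAxis).exists_conj_circleLoop (1, v) (1, v₀)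
  refine hg.trans ?_
  change g * W (σ.offAxis.comp ((circleLoop 1).prodMk (.const I v₀))) * g⁻¹ = 1
  rw [h3]; group

end CurveTriv
end

noncomputable section
open Topology
local notation "I" => unitInterval

/-! ### Radial retractions -/

/-- Gluing of continuous maps along two closed sets, one of which is parametrized. -/
theorem ContinuousMap.exists_glue_closed {D Z Z' : Type*} [TopologicalSpace D] [TopologicalSpace Z]
    [TopologicalSpace Z'] {e : D → Z} (he : IsClosedEmbedding e) {A : Set Z} (hA : IsClosed A)
    (hcov : ∀ z, z ∈ A ∨ z ∈ Set.range e) (h : C(D, Z')) (k : C(A, Z'))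
    (hk : ∀ d (hd : e d ∈ A), h d = k ⟨e d, hd⟩) :
    ∃ f : C(Z, Z'), (∀ d, f (e d) = h d) ∧ ∀ a : A, f a = k a := by
  classical
  let f : Z → Z' := fun z => if hz : z ∈ A then k ⟨z, hz⟩ else
    h (Classical.choose ((hcov z).resolve_left hz))
  have hfA : ∀ a : A, f a = k a := fun a => dif_pos a.2
  have hfe : ∀ d, f (e d) = h d := by
    intro d
    by_cases hd : e d ∈ A
    · rw [hk d hd]; exact dif_pos hd
    · refine (dif_neg hd).trans (congrArg h (he.injective ?_))
      exact Classical.choose_spec ((hcov (e d)).resolve_left hd)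
  refine ⟨⟨f, continuous_iff_isClosed.mpr fun s hs => ?_⟩, hfe, hfA⟩
  have : f ⁻¹' s = e '' (h ⁻¹' s) ∪ Subtype.val '' (k ⁻¹' s) := by
    ext z
    constructor
    · intro hz
      rcases hcov z with hzA | ⟨d, rfl⟩
      · exact .inr ⟨⟨z, hzA⟩, by rwa [Set.mem_preimage, ← hfA], rfl⟩
      · exact .inl ⟨d, by rwa [Set.mem_preimage, ← hfe], rfl⟩
    · rintro (⟨d, hd, rfl⟩ | ⟨a, ha, rfl⟩)
      · rwa [Set.mem_preimage, hfe]
      · rwa [Set.mem_preimage, hfA]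
  rw [this]
  exact (he.isClosedMap _ (hs.preimage h.continuous)).union
    (hA.isClosedEmbedding_subtypeVal.isClosedMap _ (hs.preimage k.continuous))

/-- The radial projection to the unit sphere. -/
def unitVec (v : ℝ × ℂ) : ℝ × ℂ := (√(eucSq v))⁻¹ • v

theorem eucSq_smul (c : ℝ) (v : ℝ × ℂ) : eucSq (c • v) = c ^ 2 * eucSq v := by
  simp only [eucSq, Prod.smul_fst, Prod.smul_snd, norm_smul, smul_eq_mul, Real.norm_eq_abs, mul_pow,
    sq_abs]
  ring

theorem eucSq_pos_of_ne {v : ℝ × ℂ} (hv : v.2 ≠ 0) : 0 < eucSq v := eucSq_pos ⟨v, hv⟩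

theorem eucSq_unitVec {v : ℝ × ℂ} (hv : 0 < eucSq v) : eucSq (unitVec v) = 1 := by
  rw [unitVec, eucSq_smul, inv_pow, Real.sq_sqrt hv.le, inv_mul_cancel₀ hv.ne']

theorem unitVec_of_eucSq_eq_one {v : ℝ × ℂ} (hv : eucSq v = 1) : unitVec v = v := by
  simp [unitVec, hv]

theorem unitVec_snd_eq_zero_iff {v : ℝ × ℂ} (hv : 0 < eucSq v) : (unitVec v).2 = 0 ↔ v.2 = 0 := by
  have := (Real.sqrt_pos.mpr hv).ne'
  simp [unitVec, this]

theorem continuousOn_unitVec : ContinuousOn unitVec {v | 0 < eucSq v} := by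
  unfold unitVec
  refine ContinuousOn.smul (ContinuousOn.inv₀ continuous_eucSq.sqrt.continuousOn fun v hv => ?_)
    continuousOn_id
  exact (Real.sqrt_pos.mpr hv).ne'

theorem isCompact_eucBall : IsCompact {v : ℝ × ℂ | eucSq v ≤ 1} := by
  refine Metric.isCompact_of_isClosed_isBounded (isClosed_le continuous_eucSq continuous_const) ?_
  refine (Metric.isBounded_closedBall (x := (0 : ℝ × ℂ)) (r := 1)).subset fun v hv => ?_
  have hv : v.1 ^ 2 + ‖v.2‖ ^ 2 ≤ 1 := hv
  rw [mem_closedBall_zero_iff, Prod.norm_def, max_le_iff, Real.norm_eq_abs]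
  constructor
  · rw [← sq_le_one_iff_abs_le_one]; nlinarith [sq_nonneg ‖v.2‖]
  · nlinarith [sq_nonneg v.1, norm_nonneg v.2]

/-- The radial retraction of the complement of a family of axes of balls onto the complement of the
family of balls. -/
theorem exists_radial_retraction {Θ Z : Type*} [TopologicalSpace Θ] [CompactSpace Θ]
    [TopologicalSpace Z] [T2Space Z] {e : Θ × (ℝ × ℂ) → Z} (hc : Continuous e)
    (hinj : Set.InjOn e {q | eucSq q.2 ≤ 1}) {R : Set Z} (hR : e '' {q | eucSq q.2 < 1} = R)
    (hopen : IsOpen R)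
    {S : Set Z} (hS : ∀ q, eucSq q.2 ≤ 1 → (e q ∈ S ↔ q.2.2 = 0)) :
    ∃ r : C({z // z ∉ S}, {z // z ∉ R ∧ z ∉ S}),
      ∀ z : {z // z ∉ R ∧ z ∉ S}, r ⟨z, z.2.2⟩ = z := by
  subst hR
  let B : Set (Θ × (ℝ × ℂ)) := {q | eucSq q.2 ≤ 1}
  have hB : IsCompact B := by
    have : B = Set.univ ×ˢ {v | eucSq v ≤ 1} := by ext; simp [B]
    rw [this]; exact isCompact_univ.prod isCompact_eucBall
  have : CompactSpace B := isCompact_iff_compactSpace.mp hB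
  have he : IsClosedEmbedding (B.domRestrict e) :=
    (hc.comp continuous_subtype_val).isClosedEmbedding hinj.injective
  have heS := he.restrictPreimage Sᶜ
  have hne : ∀ d : (B.domRestrict e ⁻¹' Sᶜ), (d : B).1.2.2 ≠ 0 := fun d h => d.2 ((hS _ d.1.2).mpr h)
  have hpos : ∀ d : (B.domRestrict e ⁻¹' Sᶜ), 0 < eucSq (d : B).1.2 := fun d => eucSq_pos_of_ne (hne d)
  have hout : ∀ (θ : Θ) (v : ℝ × ℂ), eucSq v = 1 → e (θ, v) ∉ e '' {q | eucSq q.2 < 1} := by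
    rintro θ v hv ⟨q, hq, h⟩
    have := hinj (le_of_lt hq : eucSq q.2 ≤ 1) (show eucSq (θ, v).2 ≤ 1 from hv.le) h
    subst this
    exact absurd hv (ne_of_lt hq)
  let A : Set ↥Sᶜ := {z | (z : Z) ∉ e '' {q | eucSq q.2 < 1}}
  have hcov : ∀ z : ↥Sᶜ, z ∈ A ∨ z ∈ Set.range (Sᶜ.restrictPreimage (B.domRestrict e)) := by
    intro z
    by_cases hz : z ∈ A
    · exact .inl hz
    · obtain ⟨q, hq, h⟩ := not_not.mp hz
      exact .inr ⟨⟨⟨q, show eucSq q.2 ≤ 1 from le_of_lt hq⟩, show e q ∈ Sᶜ from h ▸ z.2⟩, Subtype.ext h⟩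
  have hone : ∀ d, Sᶜ.restrictPreimage (B.domRestrict e) d ∈ A →
      unitVec (d : B).1.2 = (d : B).1.2 := by
    intro d hd
    refine unitVec_of_eucSq_eq_one (le_antisymm d.1.2 (not_lt.mp fun h => hd ⟨_, h, rfl⟩))
  -- Radial projection on the closed balls, which is defined because the centres lie on the removed
  -- axes, and the identity outside the open balls; both fix the spheres.
  obtain ⟨r, -, hr⟩ := ContinuousMap.exists_glue_closed
    (Z' := {z // z ∉ e '' {q | eucSq q.2 < 1} ∧ z ∉ S}) heS
    (A := A) (hopen.isClosed_compl.preimage continuous_subtype_val) hcov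
    ⟨fun d => ⟨e ((d : B).1.1, unitVec (d : B).1.2), hout _ _ (eucSq_unitVec (hpos d)), fun h =>
        hne d ((unitVec_snd_eq_zero_iff (hpos d)).mp ((hS _ (eucSq_unitVec (hpos d)).le).mp h))⟩, by
      refine Continuous.subtype_mk (hc.comp (Continuous.prodMk (by fun_prop) ?_)) _
      exact continuousOn_unitVec.comp_continuous (by fun_prop) hpos⟩
    ⟨fun a => ⟨a.1.1, a.2, a.1.2⟩, by fun_prop⟩
    fun d hd => Subtype.ext (by
      change e ((d : B).1.1, unitVec (d : B).1.2) = e _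
      rw [hone d hd])
  exact ⟨r, fun z => hr ⟨⟨z, z.2.2⟩, z.2.1⟩⟩

namespace TubedKnot

variable (N : TubedKnot)

theorem isOpen_removedBall : IsOpen N.removedBall := by
  have hexp : IsOpenMap Circle.exp := Circle.isCoveringMap_exp.isLocalHomeomorph.isOpenMap
  have h1 : IsOpenMap fun v : ℝ × ℂ => (Circle.exp (v.1 / 2), v.2 / 2) :=
    by
    simp only [div_eq_mul_inv]
    exact (hexp.comp (Homeomorph.mulRight₀ (2⁻¹ : ℝ) (by norm_num)).isOpenMap).prodMap
      (Homeomorph.mulRight₀ (2⁻¹ : ℂ) (by norm_num)).isOpenMap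
  exact (N.isOpenEmbedding.isOpenMap.comp h1) _ (isOpen_lt continuous_eucSq continuous_const)

theorem ballChart_mem_knot_iff (v : ℝ × ℂ) : N.ballChart v ∈ N.knot ↔ v.2 = 0 :=
  (N.apply_mem_knot_iff _).trans (by simp)

theorem exists_retraction_arcCompl :
    ∃ r : C(↥(N.knot)ᶜ, N.ArcCompl), ∀ y : N.ArcCompl, r ⟨y, y.2.2⟩ = y := by
  have himg : (fun q : Unit × (ℝ × ℂ) => N.ballChart q.2) '' {q | eucSq q.2 < 1} =
      N.removedBall := by
    ext y
    constructor
    · rintro ⟨q, hq, rfl⟩; exact ⟨q.2, hq, rfl⟩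
    · rintro ⟨v, hv, rfl⟩; exact ⟨((), v), hv, rfl⟩
  exact exists_radial_retraction (Θ := Unit) (e := fun q => N.ballChart q.2)
    (N.continuous_ballChart.comp continuous_snd)
    (fun a ha b hb h => Prod.ext rfl (N.ballChart_injOn ha hb h)) himg
    N.isOpen_removedBall fun q _ => N.ballChart_mem_knot_iff q.2

instance : PathConnectedSpace N.ArcCompl := by
  obtain ⟨r, hr⟩ := N.exists_retraction_arcCompl
  exact Function.Surjective.pathConnectedSpace (f := r) (fun y => ⟨_, hr y⟩) r.continuous

end TubedKnot

namespace CurveTriv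

variable {X : Type*} [TopologicalSpace X] [ChartedSpace (EuclideanSpace ℝ (Fin 4)) X] {F : Set X}
  (σ : CurveTriv F)

/-- The complement of the surface in `X - S¹ × int B³`. -/
abbrev OuterCompl := {x : X // x ∉ σ.toFun '' {q | eucSq q.2 < 1} ∧ x ∉ F}

/-- The family of balls is parametrized by the circle. The retraction serves to pull holonomies of
the surgered complement back to the complement of the surface in `X`, where the group is known. -/
theorem exists_retraction_outerCompl [T2Space X] :
    ∃ r : C(↥Fᶜ, σ.OuterCompl), ∀ x : σ.OuterCompl, r ⟨x, x.2.2⟩ = x :=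
  exists_radial_retraction σ.continuous σ.injective.injOn rfl
    (σ.isOpenEmbedding.isOpenMap _
      (isOpen_lt (continuous_eucSq.comp continuous_snd) continuous_const))
    fun q _ => σ.apply_mem_iff q

end CurveTriv
end

noncomputable section
open Topology
local notation "I" => unitInterval

/-! ### The complement of the surgered surface -/

namespace TubedKnot

variable (N : TubedKnot)

theorem coe_twistBall_zpow (k : ℤ) (y : N.Ball) : ((N.twistBall ^ k) y : S3) = (N.twist ^ k) y := by
  have h1 : ∀ y : N.Ball, ((N.twistBall⁻¹ y : N.Ball) : S3) = N.twist⁻¹ y := fun y => rfl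
  induction k generalizing y with
  | zero => rfl
  | succ n ih =>
    rw [zpow_add_one, zpow_add_one]
    change (((N.twistBall ^ (n : ℤ)) (N.twistBall y) : N.Ball) : S3) = _
    rw [ih]; rfl
  | pred n ih =>
    rw [zpow_sub_one, zpow_sub_one]
    change (((N.twistBall ^ (-(n : ℤ))) (N.twistBall⁻¹ y) : N.Ball) : S3) = _
    rw [ih, h1]; rfl

theorem coe_twistArc_zpow (k : ℤ) (y : N.ArcCompl) :
    ((N.twistArc ^ k) y : S3) = (N.twist ^ k) y := by
  have h1 : ∀ y : N.ArcCompl, ((N.twistArc⁻¹ y : N.ArcCompl) : S3) = N.twist⁻¹ y := fun y => rfl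
  induction k generalizing y with
  | zero => rfl
  | succ n ih =>
    rw [zpow_add_one, zpow_add_one]
    change (((N.twistArc ^ (n : ℤ)) (N.twistArc y) : N.ArcCompl) : S3) = _
    rw [ih]; rfl
  | pred n ih =>
    rw [zpow_sub_one, zpow_sub_one]
    change (((N.twistArc ^ (-(n : ℤ))) (N.twistArc⁻¹ y) : N.ArcCompl) : S3) = _
    rw [ih, h1]; rfl

theorem twist_zpow_of_fixed {y : S3} (h : N.twist y = y) (k : ℤ) : (N.twist ^ k) y = y := by
  have h' : N.twist⁻¹ y = y := N.twist.symm_apply_eq.mpr h.symm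
  induction k with
  | zero => rfl
  | succ n ih => rw [zpow_add_one]; change (N.twist ^ (n : ℤ)) (N.twist y) = _; rw [h, ih]
  | pred n ih => rw [zpow_sub_one]; change (N.twist ^ (-(n : ℤ))) (N.twist⁻¹ y) = _; rw [h', ih]

theorem twist_ballChart {v : ℝ × ℂ} (hv : eucSq v ≤ 1) : N.twist (N.ballChart v) = N.ballChart v :=
  N.twist_of_norm_le ((norm_half_le hv).trans (by norm_num))

theorem twist_zpow_ballChart (k : ℤ) {v : ℝ × ℂ} (hv : eucSq v ≤ 1) :
    (N.twist ^ k) (N.ballChart v) = N.ballChart v :=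
  N.twist_zpow_of_fixed (N.twist_ballChart hv) k

/-- A point of the boundary of the ball, off the arc. -/
def spherePoint (v : ℝ × ℂ) (hv : eucSq v = 1) (h : v.2 ≠ 0) : N.ArcCompl :=
  ⟨N.ballChart v, N.ballChart_notMem hv, fun h' => h ((N.ballChart_mem_knot_iff v).mp h')⟩

end TubedKnot

namespace CurveTriv

variable {X : Type*} [TopologicalSpace X] [ChartedSpace (EuclideanSpace ℝ (Fin 4)) X] {F : Set X}
  (σ : CurveTriv F) (N : TubedKnot) (m : ℤ)

theorem inl_notMem_surface (x : σ.OuterCompl) :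
    Quot.mk (σ.Glue N m) (Sum.inl ⟨x, x.2.1⟩) ∉ σ.surface N m := by
  rw [mk_mem_surface_iff]; exact x.2.2

/-- The inclusion of the outer piece. -/
def inlY : C(σ.OuterCompl, σ.SurfaceCompl N m) where
  toFun x := ⟨Quot.mk _ (Sum.inl ⟨x, x.2.1⟩), σ.inl_notMem_surface N m x⟩
  continuous_toFun := Continuous.subtype_mk
    (continuous_quot_mk.comp (continuous_inl.comp (continuous_subtype_val.subtype_mk _))) _

/-- The inclusion of the product of the knotted piece with the interval. -/
def inrY : C(N.ArcCompl × I, σ.SurfaceCompl N m) where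
  toFun y := ⟨Quot.mk _ (Sum.inr (⟨y.1, y.1.2.1⟩, y.2)), by rw [mk_mem_surface_iff]; exact y.1.2.2⟩
  continuous_toFun := by
    refine Continuous.subtype_mk (continuous_quot_mk.comp (continuous_inr.comp ?_)) _
    exact Continuous.prodMk (Continuous.subtype_mk (by fun_prop) _) continuous_snd

theorem inrY_zero (y : N.ArcCompl) : σ.inrY N m (y, 0) = σ.inrY N m ((N.twistArc ^ m) y, 1) := by
  refine Subtype.ext ((Quot.sound (Glue.wrap ⟨y, y.2.1⟩)).trans ?_)
  change Quot.mk _ (Sum.inr _) = Quot.mk _ (Sum.inr _)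
  congr 3
  exact Subtype.ext ((N.coe_twistBall_zpow m _).trans (N.coe_twistArc_zpow m y).symm)

theorem inlY_eq_inrY (t : I) (v : ℝ × ℂ) (hv : eucSq v = 1) (h : v.2 ≠ 0)
    (hx : σ.toFun (Circle.exp (2 * Real.pi * t), v) ∉ σ.toFun '' {q | eucSq q.2 < 1} ∧
      σ.toFun (Circle.exp (2 * Real.pi * t), v) ∉ F) :
    σ.inlY N m ⟨_, hx⟩ = σ.inrY N m (N.spherePoint v hv h, t) :=
  Subtype.ext (Quot.sound (Glue.bdry t v hv))

theorem eq_inlY_or_inrY (y : σ.SurfaceCompl N m) :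
    (∃ x, y = σ.inlY N m x) ∨ ∃ b, y = σ.inrY N m b := by
  obtain ⟨y, hy⟩ := y
  induction y using Quot.ind with | mk a => ?_
  rcases a with x | b
  · exact .inl ⟨⟨x, x.2, fun h => hy ((mk_mem_surface_iff σ N m _).mpr h)⟩, rfl⟩
  · exact .inr ⟨(⟨b.1, b.1.2, fun h => hy ((mk_mem_surface_iff σ N m _).mpr h)⟩, b.2), rfl⟩

variable {σ N m} in
-- The topology is that of a subspace of a quotient. Since the surface and the knot are closed, each
-- piece minus the surface is open in that piece, so openness can still be tested on the two pieces.
theorem isOpen_of_pieces (hcl : IsClosed F) {B : Set (σ.SurfaceCompl N m)}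
    (h1 : IsOpen (σ.inlY N m ⁻¹' B)) (h2 : IsOpen (σ.inrY N m ⁻¹' B)) : IsOpen B := by
  have e1 : IsOpenEmbedding fun x : σ.OuterCompl => (⟨x, x.2.1⟩ : σ.Outer) := by
    refine ⟨.of_comp (by fun_prop) continuous_subtype_val IsEmbedding.subtypeVal, ?_⟩
    have : Set.range (fun x : σ.OuterCompl => (⟨x, x.2.1⟩ : σ.Outer)) = {x : σ.Outer | (x : X) ∉ F} := by
      ext x; exact ⟨by rintro ⟨a, rfl⟩; exact a.2.2, fun h => ⟨⟨x, x.2, h⟩, rfl⟩⟩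
    rw [this]; exact hcl.isOpen_compl.preimage continuous_subtype_val
  have e2 : IsOpenEmbedding fun y : N.ArcCompl => (⟨y, y.2.1⟩ : N.Ball) := by
    refine ⟨.of_comp (by fun_prop) continuous_subtype_val IsEmbedding.subtypeVal, ?_⟩
    have : Set.range (fun y : N.ArcCompl => (⟨y, y.2.1⟩ : N.Ball)) =
          {y : N.Ball | (y : S3) ∉ N.knot} := by
      ext x; exact ⟨by rintro ⟨a, rfl⟩; exact a.2.2, fun h => ⟨⟨x, x.2, h⟩, rfl⟩⟩
    rw [this]; exact N.isClosed_knot.isOpen_compl.preimage continuous_subtype_val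
  have key : IsOpen (Subtype.val '' B : Set (σ.Surgered N m)) := by
    rw [← isQuotientMap_quot_mk.isOpen_preimage, isOpen_sum_iff]
    constructor
    · convert e1.isOpenMap _ h1 using 1
      ext x
      constructor
      · rintro ⟨y, hy, h⟩
        have hx : (x : X) ∉ F := fun hx => y.2 (by
          rw [h]; exact (mk_mem_surface_iff σ N m (.inl x)).mpr hx)
        exact ⟨⟨x, x.2, hx⟩, by
          rw [Set.mem_preimage]; convert hy using 1; exact Subtype.ext h.symm, rfl⟩
      · rintro ⟨a, ha, rfl⟩; exact ⟨_, ha, rfl⟩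
    · convert (e2.prodMap IsOpenEmbedding.id).isOpenMap _ h2 using 1
      ext x
      constructor
      · rintro ⟨y, hy, h⟩
        have hx : (x.1 : S3) ∉ N.knot := fun hx => y.2 (by
          rw [h]; exact (mk_mem_surface_iff σ N m (.inr x)).mpr hx)
        exact ⟨(⟨x.1, x.1.2, hx⟩, x.2), by
          rw [Set.mem_preimage]; convert hy using 1; exact Subtype.ext h.symm, rfl⟩
      · rintro ⟨a, ha, rfl⟩; exact ⟨_, ha, rfl⟩
  convert key.preimage continuous_subtype_val using 1
  exact (Set.preimage_image_eq _ Subtype.val_injective).symm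

variable {σ N m} in
theorem continuousOn_of_pieces (hcl : IsClosed F) {Z : Type*} [TopologicalSpace Z]
    {B : Set (σ.SurfaceCompl N m)} (hB : IsOpen B) {f : σ.SurfaceCompl N m → Z}
    (h1 : ContinuousOn (fun x => f (σ.inlY N m x)) (σ.inlY N m ⁻¹' B))
    (h2 : ContinuousOn (fun x => f (σ.inrY N m x)) (σ.inrY N m ⁻¹' B)) : ContinuousOn f B := by
  rw [continuousOn_open_iff hB]
  intro t ht
  refine isOpen_of_pieces hcl ?_ ?_
  · exact (continuousOn_open_iff (hB.preimage (σ.inlY N m).continuous)).mp h1 t ht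
  · exact (continuousOn_open_iff (hB.preimage (σ.inrY N m).continuous)).mp h2 t ht

/-- Functions on the surgered complement, defined piecewise. -/
def liftY {Z : Type*} (f : σ.Outer → Z) (g : N.Ball × I → Z)
    (h : ∀ x, g (x, 0) = g ((N.twistBall ^ m) x, 1))
    (h' : ∀ (t : I) v hv, f (σ.outerPoint (Circle.exp (2 * Real.pi * t)) v hv) =
      g (⟨N.ballChart v, N.ballChart_notMem hv⟩, t)) (y : σ.SurfaceCompl N m) : Z :=
  Quot.lift (Sum.elim f g) (by
    intro a b hab
    cases hab with
    | wrap x => exact h x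
    | bdry t v hv => exact h' t v hv) (y : σ.Surgered N m)

/-- The coordinates of a point of the tubular neighbourhood. -/
def coord (x : X) : Circle × (ℝ × ℂ) := Function.invFun σ.toFun x

theorem coord_apply (q : Circle × (ℝ × ℂ)) : σ.coord (σ.toFun q) = q :=
  Function.leftInverse_invFun σ.injective q

theorem continuousOn_coord : ContinuousOn σ.coord (Set.range σ.toFun) := by
  rintro _ ⟨q, rfl⟩
  refine ContinuousAt.continuousWithinAt (σ.isOpenEmbedding.continuousAt_iff.mp ?_)
  rw [show σ.coord ∘ σ.toFun = id from funext σ.coord_apply]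
  exact continuousAt_id

theorem notMem_ball_iff (q : Circle × (ℝ × ℂ)) :
    σ.toFun q ∉ σ.toFun '' {q | eucSq q.2 < 1} ↔ 1 ≤ eucSq q.2 := by
  exact (not_congr (σ.injective.mem_set_image (s := {q | eucSq q.2 < 1}))).trans
    (show ¬eucSq q.2 < 1 ↔ _ from not_lt)

theorem notMem_closedBall_iff (q : Circle × (ℝ × ℂ)) :
    σ.toFun q ∉ σ.toFun '' {q | eucSq q.2 ≤ 1} ↔ 1 < eucSq q.2 := by
  exact (not_congr (σ.injective.mem_set_image (s := {q | eucSq q.2 ≤ 1}))).trans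
    (show ¬eucSq q.2 ≤ 1 ↔ _ from not_le)

/-- The points of `ℝ × ℂ` off the axis and outside the ball. -/
abbrev Far := {v : ℝ × ℂ // 1 ≤ eucSq v ∧ v.2 ≠ 0}

/-- The collar of the outer piece. -/
def collar : C(Circle × Far, σ.SurfaceCompl N m) :=
  (σ.inlY N m).comp ⟨fun q => ⟨σ.toFun (q.1, q.2), (σ.notMem_ball_iff _).mpr q.2.2.1,
    fun h => q.2.2.2 ((σ.apply_mem_iff _).mp h)⟩, (σ.continuous.comp (by fun_prop)).subtype_mk _⟩

/-- The neighbourhood of the mapping torus. -/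
def nearSet : Set (σ.SurfaceCompl N m) :=
  {y | σ.liftY N m (fun x => (x : X) ∈ Set.range σ.toFun) (fun _ => True) (fun _ => rfl)
    (fun _ _ _ => eq_true ⟨_, rfl⟩) y}

/-- The interior of the outer piece. -/
def outerSet : Set (σ.SurfaceCompl N m) :=
  {y | σ.liftY N m (fun x => (x : X) ∉ σ.toFun '' {q | eucSq q.2 ≤ 1}) (fun _ => False)
    (fun _ => rfl) (fun _ _ hv => eq_false (not_not.mpr ⟨_, le_of_eq hv, rfl⟩)) y}

theorem inrY_mem_nearSet (b : N.ArcCompl × I) : σ.inrY N m b ∈ σ.nearSet N m := trivial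

theorem collar_mem_nearSet (q : Circle × Far) : σ.collar N m q ∈ σ.nearSet N m := ⟨_, rfl⟩

theorem inrY_notMem_outerSet (b : N.ArcCompl × I) : σ.inrY N m b ∉ σ.outerSet N m := fun h => h

theorem collar_mem_outerSet_iff (q : Circle × Far) :
    σ.collar N m q ∈ σ.outerSet N m ↔ 1 < eucSq (q.2 : ℝ × ℂ) :=
  σ.notMem_closedBall_iff (q.1, q.2)

theorem eq_collar_or_inrY {y : σ.SurfaceCompl N m} (hy : y ∈ σ.nearSet N m) :
    (∃ q, y = σ.collar N m q) ∨ ∃ b, y = σ.inrY N m b := by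
  rcases σ.eq_inlY_or_inrY N m y with ⟨x, rfl⟩ | h
  · obtain ⟨x, hx⟩ := x
    obtain ⟨q, rfl⟩ := hy
    exact .inl ⟨(q.1, ⟨q.2, (σ.notMem_ball_iff q).mp hx.1,
      fun h => hx.2 ((σ.apply_mem_iff q).mpr h)⟩), rfl⟩
  · exact .inr h

theorem mem_outerSet_or_nearSet (y : σ.SurfaceCompl N m) :
    y ∈ σ.outerSet N m ∨ y ∈ σ.nearSet N m := by
  rcases σ.eq_inlY_or_inrY N m y with ⟨x, rfl⟩ | ⟨b, rfl⟩
  · by_cases h : (x : X) ∈ Set.range σ.toFun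
    · exact .inr h
    · exact .inl fun ⟨q, _, hq⟩ => h ⟨q, hq⟩
  · exact .inr trivial

variable {σ N m} in
theorem isOpen_nearSet (hcl : IsClosed F) : IsOpen (σ.nearSet N m) := by
  refine isOpen_of_pieces hcl ?_ isOpen_univ
  exact σ.isOpenEmbedding.isOpen_range.preimage continuous_subtype_val

variable {σ N m} in
theorem isOpen_outerSet [T2Space X] (hcl : IsClosed F) : IsOpen (σ.outerSet N m) := by
  refine isOpen_of_pieces hcl ?_ isOpen_empty
  refine IsOpen.preimage continuous_subtype_val
    (IsCompact.image ?_ σ.continuous).isClosed.isOpen_compl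
  have : {q : Circle × (ℝ × ℂ) | eucSq q.2 ≤ 1} = Set.univ ×ˢ {v | eucSq v ≤ 1} := by ext; simp
  rw [this]; exact isCompact_univ.prod isCompact_eucBall

open Classical in
/-- The interior of the outer piece, as a subset of `X`. -/
def toOuter (y : σ.SurfaceCompl N m) : X :=
  -- The point `σ(1, 0)` is a dummy value. Sending the closed balls and the knotted piece to it
  -- makes the function well defined on the quotient; only its values on `outerSet` are used.
  σ.liftY N m (fun x => if (x : X) ∈ σ.toFun '' {q | eucSq q.2 ≤ 1} then σ.toFun (1, 0) else x)
    (fun _ => σ.toFun (1, 0)) (fun _ => rfl) (fun _ _ hv => if_pos ⟨_, le_of_eq hv, rfl⟩) y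

theorem toOuter_inlY {x : σ.OuterCompl} (h : (x : X) ∉ σ.toFun '' {q | eucSq q.2 ≤ 1}) :
    σ.toOuter N m (σ.inlY N m x) = x := if_neg h

theorem exists_eq_inlY {y : σ.SurfaceCompl N m} (hy : y ∈ σ.outerSet N m) :
    ∃ x, y = σ.inlY N m x ∧ σ.toOuter N m y = x := by
  rcases σ.eq_inlY_or_inrY N m y with ⟨x, rfl⟩ | ⟨b, rfl⟩
  · exact ⟨x, rfl, σ.toOuter_inlY N m hy⟩
  · exact absurd hy (σ.inrY_notMem_outerSet N m b)

variable {σ N m} in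
theorem continuousOn_toOuter [T2Space X] (hcl : IsClosed F) :
    ContinuousOn (σ.toOuter N m) (σ.outerSet N m) := by
  refine continuousOn_of_pieces hcl (isOpen_outerSet hcl) ?_ ?_
  · exact continuous_subtype_val.continuousOn.congr fun x hx => σ.toOuter_inlY N m hx
  · exact continuousOn_const

theorem toOuter_notMem {y : σ.SurfaceCompl N m} (hy : y ∈ σ.outerSet N m) :
    σ.toOuter N m y ∉ F := by
  obtain ⟨x, -, h⟩ := σ.exists_eq_inlY N m hy
  rw [h]; exact x.2.2

variable {N m} in
/-- The interior of the outer piece is a part of the complement of the surface in `X`. -/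
def outerMap [T2Space X] (hcl : IsClosed F) : C(σ.outerSet N m, ↥Fᶜ) where
  toFun y := ⟨σ.toOuter N m y, σ.toOuter_notMem N m y.2⟩
  continuous_toFun := ((continuousOn_toOuter hcl).comp_continuous continuous_subtype_val
    fun y => y.2).subtype_mk _

/-- The angle. -/
def ang (y : σ.SurfaceCompl N m) : Circle :=
  σ.liftY N m (fun x => (σ.coord x).1) (fun b => Circle.exp (2 * Real.pi * b.2)) (fun _ => by simp)
    (fun _ _ _ => by rw [outerPoint, coord_apply]) y

theorem ang_collar (q : Circle × Far) : σ.ang N m (σ.collar N m q) = q.1 :=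
  congrArg Prod.fst (σ.coord_apply (q.1, q.2))

theorem ang_inrY (b : N.ArcCompl × I) :
    σ.ang N m (σ.inrY N m b) = Circle.exp (2 * Real.pi * b.2) := rfl

variable {σ N m} in
theorem continuousOn_ang (hcl : IsClosed F) : ContinuousOn (σ.ang N m) (σ.nearSet N m) := by
  refine continuousOn_of_pieces hcl (isOpen_nearSet hcl) ?_ ?_
  · exact (σ.continuousOn_coord.comp continuous_subtype_val.continuousOn fun x hx => hx).fst
  · exact Continuous.continuousOn (f := fun b : N.ArcCompl × I =>
      Circle.exp (2 * Real.pi * b.2)) (by fun_prop)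

end CurveTriv
end

/-! ### Cutting the mapping torus open. -/

noncomputable section
open Topology
local notation "I" => unitInterval

/-- The angle in units of full turns, in `(c - 1, c]`. -/
def turn (c : ℝ) (z : Circle) : ℝ :=
  Complex.arg (z * Circle.exp (Real.pi - 2 * Real.pi * c) : Circle) / (2 * Real.pi) + c - 1 / 2

theorem exp_turn (c : ℝ) (z : Circle) : Circle.exp (2 * Real.pi * turn c z) = z := by
  have : 2 * Real.pi * turn c z =
      Complex.arg (z * Circle.exp (Real.pi - 2 * Real.pi * c) : Circle) -
        (Real.pi - 2 * Real.pi * c) := by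
    unfold turn; field_simp [Real.pi_ne_zero]; ring
  rw [this, Circle.exp_sub, Circle.exp_arg, mul_div_cancel_right]

theorem turn_mem (c : ℝ) (z : Circle) : turn c z ∈ Set.Ioc (c - 1) c := by
  have h1 := Complex.neg_pi_lt_arg (z * Circle.exp (Real.pi - 2 * Real.pi * c) : Circle)
  have h2 := Complex.arg_le_pi (z * Circle.exp (Real.pi - 2 * Real.pi * c) : Circle)
  have h3 : -(1 / 2) < Complex.arg (z * Circle.exp (Real.pi - 2 * Real.pi * c) : Circle) /
      (2 * Real.pi) := by
    rw [lt_div_iff₀ Real.two_pi_pos]; linarith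
  have h4 : Complex.arg (z * Circle.exp (Real.pi - 2 * Real.pi * c) : Circle) /
      (2 * Real.pi) ≤ 1 / 2 := by
    rw [div_le_iff₀ Real.two_pi_pos]; linarith
  unfold turn
  constructor <;> linarith

theorem turn_exp {c t : ℝ} (ht : t ∈ Set.Ioc (c - 1) c) :
    turn c (Circle.exp (2 * Real.pi * t)) = t := by
  have h : Circle.exp (2 * Real.pi * t) * Circle.exp (Real.pi - 2 * Real.pi * c) =
      Circle.exp (2 * Real.pi * (t - c) + Real.pi) := by
    rw [← Circle.exp_add]; congr 1; ring
  have h1 := ht.1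
  have h2 := ht.2
  rw [turn, h, Circle.arg_exp (by nlinarith [Real.pi_pos]) (by nlinarith [Real.pi_pos])]
  field_simp [Real.pi_ne_zero]; ring

theorem turn_of_le {c : ℝ} (hc : c ∈ Set.Ico (0 : ℝ) 1) {t : I} (h : (t : ℝ) ≤ c) :
    turn c (Circle.exp (2 * Real.pi * t)) = t :=
  turn_exp ⟨by linarith [t.2.1, hc.2], h⟩

/-- Parameters beyond the cut drop by one full turn; `fibre` compensates this by `τ^{-m}`. -/
theorem turn_of_lt {c : ℝ} (hc : c ∈ Set.Ico (0 : ℝ) 1) {t : I} (h : c < t) :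
    turn c (Circle.exp (2 * Real.pi * t)) = t - 1 := by
  have : Circle.exp (2 * Real.pi * t) = Circle.exp (2 * Real.pi * (t - 1)) := by
    rw [mul_sub, mul_one, Circle.exp_sub, Circle.exp_two_pi, div_one]
  rw [this]
  exact turn_exp ⟨by linarith, by linarith [t.2.2, hc.1]⟩

theorem continuousOn_turn (c : ℝ) : ContinuousOn (turn c) {Circle.exp (2 * Real.pi * c)}ᶜ := by
  intro z hz
  refine ContinuousAt.continuousWithinAt ?_
  have h : ((z * Circle.exp (Real.pi - 2 * Real.pi * c) : Circle) : ℂ) ∈ Complex.slitPlane := by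
    rw [Complex.mem_slitPlane_iff_arg]
    refine ⟨fun h => hz ?_, Circle.coe_ne_zero _⟩
    have := exp_turn c z
    rw [turn, h] at this
    rw [Set.mem_singleton_iff, ← this]
    congr 1
    field_simp [Real.pi_ne_zero]; ring
  unfold turn
  refine ContinuousAt.sub (ContinuousAt.add (ContinuousAt.div_const ?_ _) continuousAt_const)
    continuousAt_const
  exact ContinuousAt.comp (f := fun z : Circle =>
    ((z * Circle.exp (Real.pi - 2 * Real.pi * c) : Circle) : ℂ)) (Complex.continuousAt_arg h)
    (by fun_prop)

/-- The radial deformation to the unit sphere. -/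
def shrink (s : ℝ) (v : ℝ × ℂ) : ℝ × ℂ := ((1 - s) + s * (√(eucSq v))⁻¹) • v

theorem shrink_zero (v : ℝ × ℂ) : shrink 0 v = v := by simp [shrink]

theorem shrink_one (v : ℝ × ℂ) : shrink 1 v = unitVec v := by simp [shrink, unitVec]

theorem shrink_of_eucSq_eq_one (s : ℝ) {v : ℝ × ℂ} (hv : eucSq v = 1) : shrink s v = v := by
  simp [shrink, hv]

theorem one_le_eucSq_shrink (s : I) {v : ℝ × ℂ} (hv : 1 ≤ eucSq v) : 1 ≤ eucSq (shrink s v) := by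
  have h1 : 1 ≤ √(eucSq v) := Real.one_le_sqrt.mpr hv
  have h0 : 0 < √(eucSq v) := by linarith
  have h2 : eucSq v = √(eucSq v) ^ 2 := (Real.sq_sqrt (by linarith)).symm
  rw [shrink, eucSq_smul, h2, Real.sqrt_sq h0.le, ← mul_pow, add_mul, mul_assoc,
    inv_mul_cancel₀ h0.ne', mul_one]
  have : 1 ≤ (1 - (s : ℝ)) * √(eucSq v) + s := by nlinarith [s.2.1, s.2.2]
  nlinarith

theorem shrink_snd_ne_zero (s : I) {v : ℝ × ℂ} (hv : v.2 ≠ 0) : (shrink s v).2 ≠ 0 := by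
  have h0 : 0 < √(eucSq v) := Real.sqrt_pos.mpr (eucSq_pos_of_ne hv)
  have : 0 < (1 - (s : ℝ)) + s * (√(eucSq v))⁻¹ := by
    rcases s.2.1.eq_or_lt with h | h
    · rw [← h]; norm_num
    · have := mul_pos h (inv_pos.mpr h0)
      linarith [s.2.2]
  exact smul_ne_zero this.ne' hv

theorem continuousOn_shrink :
    ContinuousOn (fun q : ℝ × (ℝ × ℂ) => shrink q.1 q.2) {q | 0 < eucSq q.2} := by
  unfold shrink
  refine ContinuousOn.smul (ContinuousOn.add (by fun_prop) (ContinuousOn.mul (by fun_prop)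
    (ContinuousOn.inv₀ ?_ fun q hq => (Real.sqrt_pos.mpr hq).ne'))) (by fun_prop)
  exact (continuous_eucSq.comp continuous_snd).sqrt.continuousOn

namespace CurveTriv

variable {X : Type*} [TopologicalSpace X] [ChartedSpace (EuclideanSpace ℝ (Fin 4)) X] {F : Set X}
  (σ : CurveTriv F) (N : TubedKnot) (m : ℤ)

open Classical in
/-- The coordinate in the fibre of the mapping torus, cut open at the angle `c`. -/
def fibre {c : ℝ} (hc : c ∈ Set.Ico (0 : ℝ) 1) (y : σ.SurfaceCompl N m) : S3 :=
  σ.liftY N m (fun x => N.ballChart (unitVec (σ.coord x).2))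
    (fun b => if (b.2 : ℝ) ≤ c then b.1 else (N.twist ^ (-m)) b.1)
    -- The point `(x, 0)` lies before the cut and `(τ^m x, 1)` after it, so both have fibre
    -- coordinate `x`. On `∂B³` the twist is the identity, and the cut is not seen there.
    (fun x => by
      dsimp only
      rw [if_pos (show ((0 : I) : ℝ) ≤ c from hc.1),
        if_neg (show ¬((1 : I) : ℝ) ≤ c from not_le.mpr hc.2), N.coe_twistBall_zpow, ← Homeomorph.mul_apply,
        ← zpow_add, neg_add_cancel]
      rfl)
    (fun t v hv => by
      dsimp only
      rw [N.twist_zpow_ballChart _ hv.le, ite_self, outerPoint, coord_apply,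
        unitVec_of_eucSq_eq_one hv]) y

variable {c : ℝ} (hc : c ∈ Set.Ico (0 : ℝ) 1)

theorem fibre_collar (q : Circle × Far) :
    σ.fibre N m hc (σ.collar N m q) = N.ballChart (unitVec q.2) := by
  change N.ballChart (unitVec (σ.coord (σ.toFun (q.1, q.2))).2) = _
  rw [coord_apply]

theorem fibre_inrY_of_le {b : N.ArcCompl × I} (h : (b.2 : ℝ) ≤ c) :
    σ.fibre N m hc (σ.inrY N m b) = b.1 := if_pos h

theorem fibre_inrY_of_lt {b : N.ArcCompl × I} (h : c < b.2) :
    σ.fibre N m hc (σ.inrY N m b) = (N.twistArc ^ (-m)) b.1 :=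
  (if_neg (not_le.mpr h)).trans (N.coe_twistArc_zpow _ _).symm

theorem fibre_mem {y : σ.SurfaceCompl N m} (hy : y ∈ σ.nearSet N m) :
    σ.fibre N m hc y ∉ N.removedBall ∧ σ.fibre N m hc y ∉ N.knot := by
  rcases σ.eq_collar_or_inrY N m hy with ⟨q, rfl⟩ | ⟨b, rfl⟩
  · rw [fibre_collar]
    have hq := eucSq_pos_of_ne q.2.2.2
    exact (N.spherePoint _ (eucSq_unitVec hq) fun h =>
      q.2.2.2 ((unitVec_snd_eq_zero_iff hq).mp h)).2
  · rcases le_or_gt (b.2 : ℝ) c with h | h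
    · rw [fibre_inrY_of_le _ _ _ _ h]; exact b.1.2
    · rw [fibre_inrY_of_lt _ _ _ _ h]; exact ((N.twistArc ^ (-m)) b.1).2

variable {σ N m} in
theorem isOpen_cut (hcl : IsClosed F) (w : Circle) :
    IsOpen {y : σ.SurfaceCompl N m | y ∈ σ.nearSet N m ∧ σ.ang N m y ≠ w} :=
  (continuousOn_ang hcl).isOpen_inter_preimage (isOpen_nearSet hcl) isOpen_compl_singleton

variable {σ N m} in
theorem continuousOn_fibre (hcl : IsClosed F) : ContinuousOn (σ.fibre N m hc)
    {y | y ∈ σ.nearSet N m ∧ σ.ang N m y ≠ Circle.exp (2 * Real.pi * c)} := by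
  refine continuousOn_of_pieces hcl (isOpen_cut hcl _) ?_ ?_
  · refine N.continuous_ballChart.comp_continuousOn (continuousOn_unitVec.comp
      ((σ.continuousOn_coord.comp continuous_subtype_val.continuousOn fun x hx => hx.1).snd)
      fun x hx => ?_)
    obtain ⟨q, hq⟩ := hx.1
    change 0 < eucSq (σ.coord x).2
    have h := x.2.2
    change σ.toFun q = x at hq
    rw [← hq] at h ⊢
    rw [coord_apply]
    exact eucSq_pos_of_ne fun h' => h ((σ.apply_mem_iff q).mpr h')
  · rintro ⟨y, t⟩ hb
    refine ContinuousAt.continuousWithinAt ?_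
    have ht : (t : ℝ) ≠ c := fun h => hb.2 (by rw [ang_inrY, h])
    have hcont : Continuous fun b : N.ArcCompl × I => (b.2 : ℝ) := by fun_prop
    rcases ht.lt_or_gt with h | h
    · have : Continuous fun b : N.ArcCompl × I => (b.1 : S3) := by fun_prop
      refine this.continuousAt.congr ?_
      filter_upwards [(isOpen_lt hcont continuous_const).mem_nhds h] with b hb
      exact (σ.fibre_inrY_of_le N m hc (le_of_lt hb)).symm
    · have : Continuous fun b : N.ArcCompl × I => (((N.twistArc ^ (-m)) b.1 : N.ArcCompl) : S3) :=
        continuous_subtype_val.comp ((N.twistArc ^ (-m)).continuous.comp continuous_fst)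
      refine this.continuousAt.congr ?_
      filter_upwards [(isOpen_lt continuous_const hcont).mem_nhds h] with b hb
      exact (σ.fibre_inrY_of_lt N m hc hb).symm

/-- The coordinate in the fibre, as a point of the complement of the arc. -/
def fibrePt (y : σ.nearSet N m) : N.ArcCompl := ⟨σ.fibre N m hc y, σ.fibre_mem N m hc y.2⟩

/-- The infinite cyclic cover of the mapping torus, over two fundamental domains. -/
def cylinder : C(N.ArcCompl × ℝ, σ.SurfaceCompl N m) where
  toFun b := if 0 ≤ b.2 then σ.inrY N m (b.1, Set.projIcc 0 1 zero_le_one b.2)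
    else σ.inrY N m ((N.twistArc ^ m) b.1, Set.projIcc 0 1 zero_le_one (b.2 + 1))
  continuous_toFun := by
    have h1 : Continuous fun b : N.ArcCompl × ℝ => (N.twistArc ^ m) b.1 :=
      (N.twistArc ^ m).continuous.comp continuous_fst
    refine Continuous.if_le ?_ ?_ continuous_const continuous_snd ?_
    · exact (σ.inrY N m).continuous.comp (by fun_prop)
    · exact (σ.inrY N m).continuous.comp (h1.prodMk (by fun_prop))
    · rintro ⟨y, r⟩ (rfl : 0 = r)
      have e0 : Set.projIcc (0 : ℝ) 1 zero_le_one 0 = 0 := Set.projIcc_left _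
      have e1 : Set.projIcc (0 : ℝ) 1 zero_le_one (0 + 1) = 1 := by
        rw [zero_add]; exact Set.projIcc_right _
      rw [e0, e1]; exact σ.inrY_zero N m y

theorem cylinder_unit (y : N.ArcCompl) (t : I) : σ.cylinder N m (y, t) = σ.inrY N m (y, t) := by
  refine (if_pos t.2.1).trans ?_
  rw [Set.projIcc_val]

/-- The deck transformation `(y, r) ↦ (τ^m y, r + 1)` of the cyclic cover. -/
theorem cylinder_neg {r : ℝ} (h1 : -1 ≤ r) (h2 : r ≤ 0) (y : N.ArcCompl) :
    σ.cylinder N m (y, r) = σ.cylinder N m ((N.twistArc ^ m) y, r + 1) := by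
  rcases h2.eq_or_lt with rfl | h2
  · have : σ.cylinder N m (y, 0) = _ := σ.cylinder_unit N m y 0
    have h' : σ.cylinder N m (_, 1) = _ := σ.cylinder_unit N m ((N.twistArc ^ m) y) 1
    rw [this, zero_add, h', inrY_zero]
  · exact (if_neg (not_le.mpr h2)).trans (if_pos (by simp; linarith)).symm

theorem zpow_neg_zpow (y : N.ArcCompl) : (N.twistArc ^ m) ((N.twistArc ^ (-m)) y) = y := by
  rw [← Homeomorph.mul_apply, ← zpow_add, add_neg_cancel]; rfl

/-- Since the twist fixes `∂B³`, any real angle `s` of `z` in `[-1, 1]` gives the same point, not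
only one in the fundamental domain. -/
theorem inlY_collar_unit (z : Circle) (w : Far) (s : ℝ) (hs : -1 ≤ s ∧ s ≤ 1)
    (hz : Circle.exp (2 * Real.pi * s) = z) (h1 : eucSq (w : ℝ × ℂ) = 1) :
    σ.cylinder N m (N.spherePoint w h1 w.2.2, s) = σ.collar N m (z, w) := by
  have key : ∀ t : I, Circle.exp (2 * Real.pi * t) = z →
      σ.inrY N m (N.spherePoint w h1 w.2.2, t) = σ.collar N m (z, w) := by
    rintro t rfl
    exact (σ.inlY_eq_inrY N m t w h1 w.2.2 _).symm
  rcases le_or_gt 0 s with h | h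
  · have := σ.cylinder_unit N m (N.spherePoint w h1 w.2.2) ⟨s, h, hs.2⟩
    exact this.trans (key ⟨s, h, hs.2⟩ hz)
  · rw [cylinder_neg σ N m hs.1 h.le]
    have e : (N.twistArc ^ m) (N.spherePoint w h1 w.2.2) = N.spherePoint w h1 w.2.2 :=
      Subtype.ext ((N.coe_twistArc_zpow _ _).trans (N.twist_zpow_ballChart m h1.le))
    rw [e]
    have := σ.cylinder_unit N m (N.spherePoint w h1 w.2.2) ⟨s + 1, by linarith, by linarith⟩
    refine this.trans (key _ ?_)
    rw [← hz]
    change Circle.exp (2 * Real.pi * (s + 1)) = _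
    rw [mul_add, mul_one, Circle.exp_add, Circle.exp_two_pi, mul_one]

/-- The radial deformation of the collar. -/
def shrinkFar (s : I) (v : Far) : Far :=
  ⟨shrink s v, one_le_eucSq_shrink s v.2.1, shrink_snd_ne_zero s v.2.2⟩

theorem shrinkFar_zero (v : Far) : shrinkFar 0 v = v := Subtype.ext (shrink_zero _)

theorem eucSq_shrinkFar_one (v : Far) : eucSq (shrinkFar 1 v : ℝ × ℂ) = 1 := by
  change eucSq (shrink 1 v) = 1
  rw [shrink_one, eucSq_unitVec (eucSq_pos_of_ne v.2.2)]

theorem continuous_shrinkFar : Continuous fun q : I × Far => shrinkFar q.1 q.2 :=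
  (continuousOn_shrink.comp_continuous (f := fun q : I × Far => ((q.1 : ℝ), (q.2 : ℝ × ℂ)))
    (by fun_prop) fun q => eucSq_pos_of_ne q.2.2.2).subtype_mk _

/-- The track of a point of the collar under the radial deformation. -/
def collarTrack (q : Circle × Far) : C(I, σ.SurfaceCompl N m) where
  toFun s := σ.collar N m (q.1, shrinkFar s q.2)
  continuous_toFun := (σ.collar N m).continuous.comp (continuous_const.prodMk
    (continuous_shrinkFar.comp (continuous_id.prodMk continuous_const)))

open Classical in
/-- The track of a point of the outer piece under the radial deformation. -/
def outerTrack (x : σ.Outer) : C(I, σ.Surgered N m) :=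
  if h : (x : X) ∈ Set.range σ.toFun then
    { toFun s := Quot.mk _ (Sum.inl ⟨σ.toFun ((σ.coord x).1, shrink s (σ.coord x).2), by
        have hx := x.2
        obtain ⟨q, hq⟩ := h
        rw [← hq, notMem_ball_iff] at hx
        rw [notMem_ball_iff, ← hq, coord_apply]
        exact one_le_eucSq_shrink s hx⟩)
      continuous_toFun := by
        refine continuous_quot_mk.comp (continuous_inl.comp (Continuous.subtype_mk ?_ _))
        refine σ.continuous.comp (continuous_const.prodMk ?_)
        unfold shrink; fun_prop }
  else .const I (Quot.mk _ (Sum.inl x))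

end CurveTriv
end

/-! ### The radial deformation onto the mapping torus. -/

noncomputable section
open Topology
local notation "I" => unitInterval

namespace CurveTriv

variable {X : Type*} [TopologicalSpace X] [ChartedSpace (EuclideanSpace ℝ (Fin 4)) X] {F : Set X}
  (σ : CurveTriv F) (N : TubedKnot) (m : ℤ)

theorem outerTrack_apply (x : σ.Outer) (q : Circle × (ℝ × ℂ)) (hq : σ.toFun q = x) (s : I)
    (hs : σ.toFun (q.1, shrink s q.2) ∉ σ.toFun '' {q | eucSq q.2 < 1}) :
    σ.outerTrack N m x s = Quot.mk _ (Sum.inl ⟨σ.toFun (q.1, shrink s q.2), hs⟩) := by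
  have h : (x : X) ∈ Set.range σ.toFun := ⟨q, hq⟩
  rw [outerTrack, dif_pos h]
  change Quot.mk _ (Sum.inl _) = _
  congr 3
  rw [← hq, coord_apply]

/-- The tracks of the radial deformation. -/
def surgeredTrack (y : σ.SurfaceCompl N m) : C(I, σ.Surgered N m) :=
  -- The tracks run in the whole glued space because a function on the quotient must also be given
  -- at points of the surface. They are confined to the complement of the surface afterwards, in
  -- `track`.
  σ.liftY N m (σ.outerTrack N m) (fun b => .const I (Quot.mk _ (Sum.inr b)))
    (fun x => congrArg (ContinuousMap.const I) (Quot.sound (Glue.wrap x)))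
    (fun t v hv => by
      ext s
      have e : shrink s v = v := shrink_of_eucSq_eq_one s hv
      have hs : σ.toFun (Circle.exp (2 * Real.pi * t), shrink s v) ∉
          σ.toFun '' {q | eucSq q.2 < 1} := by
        rw [e]; exact (σ.outerPoint (Circle.exp (2 * Real.pi * t)) v hv).2
      rw [σ.outerTrack_apply N m _ (Circle.exp (2 * Real.pi * t), v) rfl s hs]
      refine Eq.trans ?_ (Quot.sound (Glue.bdry t v hv))
      congr 2
      exact Subtype.ext (congrArg (fun w => σ.toFun (Circle.exp (2 * Real.pi * t), w)) e)) y

theorem surgeredTrack_collar (q : Circle × Far) (s : I) :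
    σ.surgeredTrack N m (σ.collar N m q) s = σ.collarTrack N m q s :=
  σ.outerTrack_apply N m _ (q.1, q.2) rfl s _

theorem surgeredTrack_inrY (b : N.ArcCompl × I) (s : I) :
    σ.surgeredTrack N m (σ.inrY N m b) s = σ.inrY N m b := rfl

theorem surgeredTrack_notMem {y : σ.SurfaceCompl N m} (hy : y ∈ σ.nearSet N m) (s : I) :
    σ.surgeredTrack N m y s ∉ σ.surface N m := by
  rcases σ.eq_collar_or_inrY N m hy with ⟨q, rfl⟩ | ⟨b, rfl⟩
  · rw [surgeredTrack_collar]; exact (σ.collarTrack N m q s).2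
  · rw [surgeredTrack_inrY]; exact (σ.inrY N m b).2

variable {σ N m} in
-- The deformation is a map into the path space, which can be checked on the two pieces; this avoids
-- the product of a quotient space with the interval. Joint continuity is recovered in
-- `exists_homotopy_track`.
theorem continuousOn_surgeredTrack (hcl : IsClosed F) :
    ContinuousOn (σ.surgeredTrack N m) (σ.nearSet N m) := by
  refine continuousOn_of_pieces hcl (isOpen_nearSet hcl) ?_ ?_
  · rw [continuousOn_iff_continuous_domRestrict]
    have hq : Continuous fun x : (σ.inlY N m ⁻¹' σ.nearSet N m) => σ.coord (x : σ.OuterCompl) :=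
      σ.continuousOn_coord.comp_continuous (by fun_prop) fun x => x.2
    have hx : ∀ x : (σ.inlY N m ⁻¹' σ.nearSet N m), σ.toFun (σ.coord (x : σ.OuterCompl)) =
        (x : σ.OuterCompl) := by
      intro x
      obtain ⟨q, hq⟩ := (x.2 : ((x : σ.OuterCompl) : X) ∈ Set.range σ.toFun)
      rw [← hq, coord_apply]
    have hfar : ∀ x : (σ.inlY N m ⁻¹' σ.nearSet N m), 1 ≤ eucSq (σ.coord (x : σ.OuterCompl)).2 ∧
        (σ.coord (x : σ.OuterCompl)).2.2 ≠ 0 := by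
      intro x
      have h := (x : σ.OuterCompl).2
      rw [← hx x] at h
      exact ⟨(σ.notMem_ball_iff _).mp h.1, fun h' => h.2 ((σ.apply_mem_iff _).mpr h')⟩
    let f : C((σ.inlY N m ⁻¹' σ.nearSet N m) × I, σ.Surgered N m) :=
      ⟨fun p => σ.collar N m ((σ.coord (p.1 : σ.OuterCompl)).1, shrinkFar p.2 ⟨_, hfar p.1⟩), by
        refine continuous_subtype_val.comp ((σ.collar N m).continuous.comp ?_)
        refine (hq.comp continuous_fst).fst.prodMk ?_
        exact continuous_shrinkFar.comp (continuous_snd.prodMk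
          ((hq.comp continuous_fst).snd.subtype_mk fun p => hfar p.1))⟩
    have : (σ.inlY N m ⁻¹' σ.nearSet N m).domRestrict
        (fun x => σ.surgeredTrack N m (σ.inlY N m x)) = f.curry := by
      ext x s
      exact σ.outerTrack_apply N m _ _ (hx x) s _
    rw [this]
    exact f.curry.continuous
  · refine Continuous.continuousOn ?_
    exact ContinuousMap.const'.continuous.comp
      (continuous_subtype_val.comp (σ.inrY N m).continuous)

/-- The track of a point near the mapping torus under the radial deformation. -/
def track (y : σ.nearSet N m) : C(I, σ.SurfaceCompl N m) where
  toFun s := ⟨σ.surgeredTrack N m y s, σ.surgeredTrack_notMem N m y.2 s⟩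
  continuous_toFun := (σ.surgeredTrack N m y).continuous.subtype_mk _

theorem track_collar (q : Circle × Far) (h : σ.collar N m q ∈ σ.nearSet N m) :
    σ.track N m ⟨_, h⟩ = σ.collarTrack N m q :=
  ContinuousMap.ext fun s => Subtype.ext (σ.surgeredTrack_collar N m q s)

theorem track_inrY (b : N.ArcCompl × I) (h : σ.inrY N m b ∈ σ.nearSet N m) :
    σ.track N m ⟨_, h⟩ = .const I (σ.inrY N m b) := rfl

theorem track_zero (y : σ.nearSet N m) : σ.track N m y 0 = y := by
  obtain ⟨y, hy⟩ := y
  rcases σ.eq_collar_or_inrY N m hy with ⟨q, rfl⟩ | ⟨b, rfl⟩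
  · rw [track_collar]
    change σ.collar N m (q.1, shrinkFar 0 q.2) = _
    rw [shrinkFar_zero]
  · rfl

/-- The deformation ends in the mapping torus, and the end has the same cylinder coordinates as the
starting point, for every position `c` of the cut. -/
theorem track_one {c : ℝ} (hc : c ∈ Set.Ico (0 : ℝ) 1) (y : σ.nearSet N m) :
    σ.track N m y 1 = σ.cylinder N m (σ.fibrePt N m hc y, turn c (σ.ang N m y)) := by
  obtain ⟨y, hy⟩ := y
  rcases σ.eq_collar_or_inrY N m hy with ⟨q, rfl⟩ | ⟨b, rfl⟩
  · rw [track_collar]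
    have ht := turn_mem c q.1
    refine (σ.inlY_collar_unit N m q.1 (shrinkFar 1 q.2) (turn c q.1)
      ⟨by linarith [ht.1, hc.1], by linarith [ht.2, hc.2]⟩ (exp_turn c q.1)
      (eucSq_shrinkFar_one q.2)).symm.trans ?_
    rw [ang_collar]
    congr 2
    refine Subtype.ext ?_
    refine Eq.trans ?_ (σ.fibre_collar N m hc q).symm
    change N.ballChart (shrink 1 q.2) = _
    rw [shrink_one]
  · rw [track_inrY, ang_inrY]
    rcases le_or_gt (b.2 : ℝ) c with h | h
    · rw [turn_of_le hc h, cylinder_unit]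
      change σ.inrY N m b = _
      congr 1
      exact Prod.ext (Subtype.ext (σ.fibre_inrY_of_le N m hc h).symm) rfl
    · rw [turn_of_lt hc h, cylinder_neg σ N m (by linarith [b.2.2.1]) (by linarith [b.2.2.2]),
        sub_add_cancel, cylinder_unit]
      change σ.inrY N m b = _
      congr 1
      refine Prod.ext ?_ rfl
      have : σ.fibrePt N m hc ⟨_, hy⟩ = (N.twistArc ^ (-m)) b.1 :=
        Subtype.ext (σ.fibre_inrY_of_lt N m hc h)
      dsimp only
      rw [this, zpow_neg_zpow]

variable {σ N m} in
theorem exists_homotopy_track (hcl : IsClosed F) (γ : C(I, σ.nearSet N m)) :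
    ∃ H : C(I × I, σ.SurfaceCompl N m), ∀ t s, H (t, s) = σ.track N m (γ t) s := by
  have h1 : Continuous fun t => σ.surgeredTrack N m (γ t) :=
    (continuousOn_surgeredTrack hcl).comp_continuous (by fun_prop) fun t => (γ t).2
  have h2 : Continuous fun p : I × I => σ.surgeredTrack N m (γ p.1) p.2 :=
    ContinuousEval.continuous_eval.comp ((h1.comp continuous_fst).prodMk continuous_snd)
  exact ⟨⟨fun p => σ.track N m (γ p.1) p.2, h2.subtype_mk _⟩, fun t s => rfl⟩

/-- The coordinate in the fibre as a continuous map. -/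
def fibreMap {c : ℝ} (hc : c ∈ Set.Ico (0 : ℝ) 1) (hcl : IsClosed F) :
    C({y : σ.nearSet N m | σ.ang N m y ≠ Circle.exp (2 * Real.pi * c)}, N.ArcCompl) where
  toFun y := σ.fibrePt N m hc y
  continuous_toFun := ((continuousOn_fibre hc hcl).comp_continuous (by fun_prop)
    fun y => ⟨y.1.2, y.2⟩).subtype_mk _

variable {σ N m} in
theorem continuous_ang (hcl : IsClosed F) : Continuous fun y : σ.nearSet N m => σ.ang N m y :=
  (continuousOn_ang hcl).comp_continuous continuous_subtype_val fun y => y.2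

theorem fibrePt_eq_of_im_neg (h0 : (0 : ℝ) ∈ Set.Ico (0 : ℝ) 1) (h1 : (1 / 2 : ℝ) ∈ Set.Ico (0 : ℝ) 1)
    {y : σ.nearSet N m} (hy : (σ.ang N m y : ℂ).im < 0) :
    σ.fibrePt N m h1 y = σ.fibrePt N m h0 y := by
  obtain ⟨y, hy'⟩ := y
  rcases σ.eq_collar_or_inrY N m hy' with ⟨q, rfl⟩ | ⟨b, rfl⟩
  · exact Subtype.ext ((σ.fibre_collar N m h1 q).trans (σ.fibre_collar N m h0 q).symm)
  · have h : (1 / 2 : ℝ) < b.2 := by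
      by_contra hle
      refine absurd hy (not_lt.mpr ?_)
      rw [ang_inrY, Circle.coe_exp, Complex.exp_ofReal_mul_I_im]
      have := b.2.2.1
      exact Real.sin_nonneg_of_nonneg_of_le_pi (by positivity) (by nlinarith [Real.pi_pos])
    exact Subtype.ext ((σ.fibre_inrY_of_lt N m h1 h).trans
      (σ.fibre_inrY_of_lt N m h0 (by linarith)).symm)

/-- Only parameters in `(0, 1/2]` lie after the cut at `0` and before the cut at `1/2`. So the two
fibre coordinates differ by the monodromy on the upper half circle and agree on the lower one. -/
theorem fibrePt_eq_of_im_pos (h0 : (0 : ℝ) ∈ Set.Ico (0 : ℝ) 1) (h1 : (1 / 2 : ℝ) ∈ Set.Ico (0 : ℝ) 1)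
    {y : σ.nearSet N m} (hy : 0 < (σ.ang N m y : ℂ).im) :
    σ.fibrePt N m h1 y = (N.twistArc ^ m) (σ.fibrePt N m h0 y) := by
  obtain ⟨y, hy'⟩ := y
  rcases σ.eq_collar_or_inrY N m hy' with ⟨q, rfl⟩ | ⟨b, rfl⟩
  · refine Subtype.ext ((σ.fibre_collar N m h1 q).trans ?_)
    rw [N.coe_twistArc_zpow]
    change _ = (N.twist ^ m) (σ.fibre N m h0 (σ.collar N m q))
    rw [fibre_collar, N.twist_zpow_ballChart]
    rw [eucSq_unitVec (eucSq_pos_of_ne q.2.2.2)]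
  · rw [ang_inrY, Circle.coe_exp, Complex.exp_ofReal_mul_I_im] at hy
    have h : (b.2 : ℝ) ≤ 1 / 2 := by
      by_contra hle
      refine absurd hy (not_lt.mpr ?_)
      have : Real.sin (2 * Real.pi * b.2) = Real.sin (2 * Real.pi * b.2 - 2 * Real.pi) :=
        (Real.sin_sub_two_pi _).symm
      rw [this]
      exact Real.sin_nonpos_of_nonpos_of_neg_pi_le (by nlinarith [Real.pi_pos, b.2.2.2])
        (by nlinarith [Real.pi_pos])
    have h' : (0 : ℝ) < b.2 := by
      refine b.2.2.1.lt_of_ne fun h => ?_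
      rw [← h] at hy
      simp at hy
    have e0 : σ.fibrePt N m h0 ⟨_, hy'⟩ = (N.twistArc ^ (-m)) b.1 :=
      Subtype.ext (σ.fibre_inrY_of_lt N m h0 h')
    rw [e0, zpow_neg_zpow]
    exact Subtype.ext (σ.fibre_inrY_of_le N m h1 h)

end CurveTriv
end

/-! ### Extension of an invariant holonomy over the mapping torus. -/

noncomputable section
open Topology
local notation "I" => unitInterval

theorem zero_mem_Ico : (0 : ℝ) ∈ Set.Ico (0 : ℝ) 1 := ⟨le_rfl, one_pos⟩

theorem half_mem_Ico : (1 / 2 : ℝ) ∈ Set.Ico (0 : ℝ) 1 := by constructor <;> norm_num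

theorem exp_two_pi_mul_zero : Circle.exp (2 * Real.pi * 0) = 1 := by simp

theorem exp_two_pi_mul_half : Circle.exp (2 * Real.pi * (1 / 2)) = -1 := by
  ext
  rw [show 2 * Real.pi * (1 / 2) = Real.pi by ring, Circle.coe_exp, Complex.exp_pi_mul_I]
  simp

theorem Circle.one_ne_neg_one : (1 : Circle) ≠ -1 := by
  intro h
  have := congrArg (fun z : Circle => (z : ℂ).re) h
  norm_num at this

theorem Circle.im_ne_zero {z : Circle} (h1 : z ≠ 1) (h2 : z ≠ -1) : (z : ℂ).im ≠ 0 := by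
  intro h
  have h3 : (z : ℂ).re ^ 2 = 1 := by
    have := Circle.normSq_coe z
    rw [Complex.normSq_apply, h] at this
    nlinarith
  rcases sq_eq_sq_iff_eq_or_eq_neg.mp (h3.trans (one_pow 2).symm) with h4 | h4
  · exact h1 (Circle.ext (Complex.ext h4 h))
  · exact h2 (Circle.ext (Complex.ext (by simpa using h4) (by simpa using h)))

namespace CurveTriv

variable {X : Type*} [TopologicalSpace X] [ChartedSpace (EuclideanSpace ℝ (Fin 4)) X] {F : Set X}
  (σ : CurveTriv F) (N : TubedKnot) (m : ℤ)

/-- The inclusion of the fibre in the neighbourhood of the mapping torus. -/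
def fibreNear : C(N.ArcCompl, σ.nearSet N m) where
  toFun y := ⟨σ.inrY N m (y, 0), σ.inrY_mem_nearSet N m _⟩
  continuous_toFun := ((σ.inrY N m).continuous.comp (by fun_prop)).subtype_mk _

/-- The collar in the neighbourhood of the mapping torus. -/
def collarNear : C(Circle × Far, σ.nearSet N m) where
  toFun q := ⟨σ.collar N m q, σ.collar_mem_nearSet N m q⟩
  continuous_toFun := (σ.collar N m).continuous.subtype_mk _

/-- The self-homeomorphism `τ^m` as a continuous map. -/
def _root_.TubedKnot.twistMap (N : TubedKnot) (m : ℤ) : C(N.ArcCompl, N.ArcCompl) :=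
  ⟨(N.twistArc ^ m : N.ArcCompl ≃ₜ N.ArcCompl), (N.twistArc ^ m).continuous⟩

variable {σ N m}

/-- A holonomy of the fibre that is invariant under the monodromy extends over the mapping
torus. -/
theorem exists_nearHolonomy (hcl : IsClosed F) {G : Type*} [Group G] (θ : Holonomy N.ArcCompl G)
    (y₀ : N.ArcCompl) (hθ : ∀ γ : C(I, N.ArcCompl), γ 0 = y₀ → γ 1 = y₀ →
      θ γ = θ ((N.twistMap m).comp γ)) :
    ∃ W : Holonomy (σ.nearSet N m) G,
      (∀ γ, W ((σ.fibreNear N m).comp γ) = θ γ) ∧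
      ∀ (v : Far) (δ : C(I, N.ArcCompl)), δ 0 = y₀ → (δ 1 : S3) = N.ballChart (unitVec v) →
        (∀ s, N.twistMap m (δ s) = δ s) → ∀ γ : C(I, Circle),
        W ((σ.collarNear N m).comp (γ.prodMk (.const I v))) = 1 := by
  classical
  -- Invariance on loops means that `θ` and its pull-back along `τ^m` differ by a gauge `k`,
  -- normalized to `1` at the base point.
  obtain ⟨k, hk, hk₀⟩ := Holonomy.exists_gauge θ (θ.comap (N.twistMap m)) y₀
    fun γ => hθ γ γ.source γ.target
  have hA : ∀ c : ℝ, IsOpen {y : σ.nearSet N m | σ.ang N m y ≠ Circle.exp (2 * Real.pi * c)} :=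
    fun c => isOpen_compl_singleton.preimage (continuous_ang hcl)
  -- The transition function between the pull-backs of `θ` along the two fibre coordinates. The
  -- overlap of the two cut-open pieces lies over two open half circles; the transition is `k` over
  -- the upper one and trivial over the lower one.
  let g : σ.nearSet N m → G := fun y =>
    if 0 < (σ.ang N m y : ℂ).im then k (σ.fibrePt N m zero_mem_Ico y) else 1
  have hcov : ∀ y : σ.nearSet N m,
      y ∈ {y : σ.nearSet N m | σ.ang N m y ≠ Circle.exp (2 * Real.pi * 0)} ∨
      y ∈ {y : σ.nearSet N m | σ.ang N m y ≠ Circle.exp (2 * Real.pi * (1 / 2))} := by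
    intro y
    by_cases h : σ.ang N m y = 1
    · right
      change σ.ang N m y ≠ _
      rw [h, exp_two_pi_mul_half]
      exact Circle.one_ne_neg_one
    · left
      change σ.ang N m y ≠ _
      rwa [exp_two_pi_mul_zero]
  have hglue : ∀ (γ : C(I, σ.nearSet N m))
      (hγ1 : ∀ t, γ t ∈ {y : σ.nearSet N m | σ.ang N m y ≠ Circle.exp (2 * Real.pi * 0)})
      (hγ2 : ∀ t, γ t ∈ {y : σ.nearSet N m | σ.ang N m y ≠ Circle.exp (2 * Real.pi * (1 / 2))}),
      θ.comap (σ.fibreMap N m half_mem_Ico hcl) (γ.intoSet _ hγ2) = g (γ 1) *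
        θ.comap (σ.fibreMap N m zero_mem_Ico hcl) (γ.intoSet _ hγ1) * (g (γ 0))⁻¹ := by
    intro γ hγ1 hγ2
    have hne : ∀ t, (σ.ang N m (γ t) : ℂ).im ≠ 0 := fun t =>
      Circle.im_ne_zero (fun h => hγ1 t (h.trans exp_two_pi_mul_zero.symm))
        fun h => hγ2 t (h.trans exp_two_pi_mul_half.symm)
    have hc : Continuous fun t => (σ.ang N m (γ t) : ℂ).im :=
      Complex.continuous_im.comp (continuous_subtype_val.comp
        ((continuous_ang hcl).comp γ.continuous))
    have hsign : (∀ t, 0 < (σ.ang N m (γ t) : ℂ).im) ∨ ∀ t, (σ.ang N m (γ t) : ℂ).im < 0 := by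
      by_contra! hcon
      obtain ⟨⟨a, ha⟩, b, hb⟩ := hcon
      obtain ⟨t, ht⟩ := mem_range_of_exists_le_of_exists_ge hc ⟨a, ha⟩ ⟨b, hb⟩
      exact hne t ht
    simp only [Holonomy.comap_apply]
    rcases hsign with h | h
    · have e : (σ.fibreMap N m half_mem_Ico hcl).comp (γ.intoSet _ hγ2) =
          (N.twistMap m).comp ((σ.fibreMap N m zero_mem_Ico hcl).comp (γ.intoSet _ hγ1)) := by
        ext1 t
        exact σ.fibrePt_eq_of_im_pos N m zero_mem_Ico half_mem_Ico (h t)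
      rw [e]
      have := hk ((σ.fibreMap N m zero_mem_Ico hcl).comp (γ.intoSet _ hγ1))
      rw [Holonomy.comap_apply] at this
      rw [this]
      simp only [g, if_pos (h _)]
      rfl
    · have e : (σ.fibreMap N m half_mem_Ico hcl).comp (γ.intoSet _ hγ2) =
          (σ.fibreMap N m zero_mem_Ico hcl).comp (γ.intoSet _ hγ1) := by
        ext1 t
        exact σ.fibrePt_eq_of_im_neg N m zero_mem_Ico half_mem_Ico (h t)
      rw [e]
      simp only [g, if_neg (h _).not_gt, one_mul, inv_one, mul_one]
  obtain ⟨W, hW2, hW1⟩ := Holonomy.exists_glue_two (hA 0) (hA (1 / 2)) hcov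
    (θ.comap (σ.fibreMap N m zero_mem_Ico hcl)) (θ.comap (σ.fibreMap N m half_mem_Ico hcl)) g hglue
  · refine ⟨W, fun γ => ?_, fun v δ h0 h1 hδ γ => ?_⟩
    · have h : ∀ t, (σ.fibreNear N m).comp γ t ∈
          {y : σ.nearSet N m | σ.ang N m y ≠ Circle.exp (2 * Real.pi * (1 / 2))} := by
        intro t
        change σ.ang N m (σ.inrY N m (γ t, 0)) ≠ _
        rw [ang_inrY, exp_two_pi_mul_half]
        simp only [Set.Icc.coe_zero, mul_zero, Circle.exp_zero]
        exact Circle.one_ne_neg_one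
      refine (hW2 (((σ.fibreNear N m).comp γ).intoSet _ h)).trans (congrArg θ ?_)
      ext1 t
      exact Subtype.ext (σ.fibre_inrY_of_le N m half_mem_Ico half_mem_Ico.1)
    · have hpt : ∀ (c : ℝ) (hc : c ∈ Set.Ico (0 : ℝ) 1) (z : Circle),
          σ.fibrePt N m hc (σ.collarNear N m (z, v)) = δ 1 := fun c hc z =>
        Subtype.ext ((σ.fibre_collar N m hc (z, v)).trans h1.symm)
      -- Along `δ` the monodromy is the identity, so `θ` and its pull-back have the same transport
      -- there. The normalization at `y₀` is thus carried to the end of `δ`.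
      have hka : k (δ 1) = 1 := by
        have := hk δ
        rw [h0, hk₀, inv_one, mul_one, Holonomy.comap_apply,
          show (N.twistMap m).comp δ = δ from ContinuousMap.ext hδ] at this
        exact (mul_eq_right.mp this.symm)
      have hg : ∀ z, g (σ.collarNear N m (z, v)) = 1 := by
        intro z
        simp only [g]
        rw [hpt, hka, ite_self]
      let f : C(Circle, σ.nearSet N m) :=
        (σ.collarNear N m).comp ((ContinuousMap.id _).prodMk (.const _ v))
      have hcovf : ∀ z, ∃ b : Bool, z ∈ f ⁻¹' {y | σ.ang N m y ≠
          Circle.exp (2 * Real.pi * if b then 0 else 1 / 2)} := by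
        intro z
        have hz : σ.ang N m (f z) = z := σ.ang_collar N m (z, v)
        by_cases h : z = 1
        · refine ⟨false, ?_⟩
          change σ.ang N m (f z) ≠ Circle.exp (2 * Real.pi * (1 / 2))
          rw [hz, h, exp_two_pi_mul_half]
          exact Circle.one_ne_neg_one
        · refine ⟨true, ?_⟩
          change σ.ang N m (f z) ≠ Circle.exp (2 * Real.pi * 0)
          rwa [hz, exp_two_pi_mul_zero]
      have hloc : ∀ (b : Bool) (γ : C(I, Circle)), (∀ t, γ t ∈ f ⁻¹' {y | σ.ang N m y ≠
          Circle.exp (2 * Real.pi * if b then 0 else 1 / 2)}) → (1 : G) = W.comap f γ • 1 := by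
        intro b γ hγ
        suffices h : W (f.comp γ) = 1 by simp [h]
        cases b
        · refine (hW2 ((f.comp γ).intoSet _ hγ)).trans ?_
          refine (congrArg θ (?_ : _ = ContinuousMap.const I (δ 1))).trans (θ.const _)
          ext1 t
          exact hpt _ half_mem_Ico (γ t)
        · refine (hW1 ((f.comp γ).intoSet _ hγ)).trans ?_
          have : θ.comap (σ.fibreMap N m zero_mem_Ico hcl) ((f.comp γ).intoSet _ hγ) = 1 := by
            refine (congrArg θ (?_ : _ = ContinuousMap.const I (δ 1))).trans (θ.const _)
            ext1 t
            exact hpt _ zero_mem_Ico (γ t)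
          rw [this]
          change g (σ.collarNear N m (γ 1, v)) * 1 * (g (σ.collarNear N m (γ 0, v)))⁻¹ = 1
          rw [hg, hg]; simp
      -- Triviality of transport along the circle says that the constant section `1` is parallel for
      -- left multiplication, which is a local condition.
      have key := Holonomy.smul_eq_of_cover (W.comap f) (S := G) (ι := Bool)
        (U := fun b => f ⁻¹' {y | σ.ang N m y ≠ Circle.exp (2 * Real.pi * if b then 0 else 1 / 2)})
        (fun b => (hA _).preimage f.continuous) hcovf (fun _ => 1) hloc γ
      have h2 : W (f.comp γ) = 1 := by simpa using key.symm
      exact h2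

end CurveTriv
end

/-! ### The annulus fixed by the twist, and the meridians. -/

noncomputable section
open Topology
local notation "I" => unitInterval

namespace TubedKnot

variable (N : TubedKnot) (m : ℤ)

instance : PathConnectedSpace (Set.Icc (1 / 2 : ℝ) 1) :=
  isPathConnected_iff_pathConnectedSpace.mp
    ((convex_Icc _ _).isPathConnected ⟨1, by constructor <;> norm_num⟩)

/-- The part `1/2 ≤ |u| ≤ 1` of the tubular neighbourhood, as a part of the complement of the
arc. -/
def annulus : C(Circle × (Circle × Set.Icc (1 / 2 : ℝ) 1), N.ArcCompl) where
  toFun q := ⟨N.toFun (q.2.1, (q.2.2 : ℝ) * q.1), by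
    rintro ⟨w, hw, h⟩
    have h1 : w.2 / 2 = (q.2.2 : ℝ) * q.1 := congrArg Prod.snd (N.injective h)
    have h2 := congrArg norm h1
    rw [norm_div, norm_mul, Circle.norm_coe, Complex.norm_real, Real.norm_eq_abs,
      abs_of_nonneg (by linarith [q.2.2.2.1]), Complex.norm_ofNat] at h2
    have hw : w.1 ^ 2 + ‖w.2‖ ^ 2 < 1 := hw
    nlinarith [q.2.2.2.1, sq_nonneg w.1], N.notMem_knot (mul_ne_zero
      (Complex.ofReal_ne_zero.mpr (by linarith [q.2.2.2.1])) q.1.coe_ne_zero)⟩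
  continuous_toFun := (N.continuous.comp (by fun_prop)).subtype_mk _

/-- The twist moves only points with `|u| > 1`. The annulus thus joins the torus of base points to
the sphere `∂B³` inside the fixed set. -/
theorem twistMap_annulus (q : Circle × (Circle × Set.Icc (1 / 2 : ℝ) 1)) :
    N.twistMap m (N.annulus q) = N.annulus q := by
  refine Subtype.ext ((N.coe_twistArc_zpow m _).trans (N.twist_zpow_of_fixed ?_ m))
  refine N.twist_of_norm_le ?_
  rw [norm_mul, Circle.norm_coe, Complex.norm_real, Real.norm_eq_abs,
      abs_of_nonneg (by linarith [q.2.2.2.1])]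
  linarith [q.2.2.2.2]

/-- The radius of the torus through the base point. -/
def radiusOne : Set.Icc (1 / 2 : ℝ) 1 := ⟨1, by constructor <;> norm_num⟩

/-- The radius at which the torus touches the sphere. -/
def radiusHalf : Set.Icc (1 / 2 : ℝ) 1 := ⟨1 / 2, by constructor <;> norm_num⟩

theorem annulus_radiusOne (z u : Circle) : N.annulus (u, (z, radiusOne)) = N.torusPoint z u :=
  Subtype.ext (by simp [annulus, torusPoint, radiusOne])

theorem coe_annulus_radiusHalf (p : Circle) :
    (N.annulus (p, (1, radiusHalf)) : S3) = N.ballChart (0, p) := by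
  simp [annulus, radiusHalf, ballChart]
  ring_nf

/-- The meridian as a path. -/
def meridianLoop (z u : Circle) : C(I, N.ArcCompl) :=
  N.annulus.comp ((circleLoop u).prodMk (.const I (z, radiusOne)))

theorem toHom_meridian {G : Type*} [Group G] (θ : Holonomy N.ArcCompl G) (z u : Circle) :
    θ.toHom _ (N.meridian z u) = θ (N.meridianLoop z u) := by
  refine congrArg θ (ContinuousMap.ext fun t => ?_)
  exact (N.annulus_radiusOne z (circleLoop u t)).symm

theorem mk_twistStar {d : ℕ} (z u : Circle)
    (β : FundamentalGroup N.ArcCompl (N.torusPoint z u)) :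
    (QuotientGroup.mk (N.twistStar m z u β) : _ ⧸ Subgroup.normalClosure (N.relators m d z u)) =
      QuotientGroup.mk β := by
  refine (QuotientGroup.eq.mpr (Subgroup.subset_normalClosure ?_)).symm
  exact .inr ⟨β, rfl⟩

theorem toHom_twistStar {G : Type*} [Group G] (θ : Holonomy N.ArcCompl G) (z u : Circle)
    (b : Path (N.torusPoint z u) (N.torusPoint z u)) :
    θ.toHom _ (N.twistStar m z u (FundamentalGroup.fromPath (Path.Homotopic.Quotient.mk b))) =
      θ ((N.twistMap m).comp b) := by
  rw [twistStar, FundamentalGroup.mapOfEq_apply]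
  rfl

end TubedKnot

namespace CurveTriv

variable {X : Type*} [TopologicalSpace X] [ChartedSpace (EuclideanSpace ℝ (Fin 4)) X] {F : Set X}
  (σ : CurveTriv F) (N : TubedKnot) (m : ℤ)

instance : PathConnectedSpace (Set.Ici (1 : ℝ)) :=
  isPathConnected_iff_pathConnectedSpace.mp
    ((convex_Ici _).isPathConnected ⟨1, Set.mem_Ici.mpr le_rfl⟩)

/-- The points outside the ball in the plane perpendicular to the axis. -/
def farPlane : C(Circle × Set.Ici (1 : ℝ), Far) where
  toFun q := ⟨(0, (q.2 : ℝ) * q.1), by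
    have h : (1 : ℝ) ≤ q.2 := q.2.2
    constructor
    · simp only [eucSq, norm_mul, Circle.norm_coe, Complex.norm_real, Real.norm_eq_abs, mul_one,
        sq_abs]
      nlinarith
    · exact mul_ne_zero (Complex.ofReal_ne_zero.mpr (by linarith)) q.1.coe_ne_zero⟩
  continuous_toFun := by fun_prop

theorem coe_farPlane (q : Circle × Set.Ici (1 : ℝ)) :
    (farPlane q : ℝ × ℂ) = (0, (q.2 : ℝ) * (q.1 : ℂ)) := rfl

theorem eucSq_farPlane (q : Circle × Set.Ici (1 : ℝ)) :
    eucSq (farPlane q : ℝ × ℂ) = (q.2 : ℝ) ^ 2 := by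
  have h : ‖(q.1 : ℂ)‖ = 1 := Circle.norm_coe q.1
  rw [coe_farPlane, eucSq, norm_mul, h, Complex.norm_real, Real.norm_eq_abs, mul_one, sq_abs]
  ring

/-- A radius outside the ball. -/
def radiusTwo : Set.Ici (1 : ℝ) := ⟨2, Set.mem_Ici.mpr one_le_two⟩

/-- The base point of the collar. -/
def farPoint (p : Circle) : Far := farPlane (p, radiusTwo)

/-- The meridian of the surface in the collar. -/
def nearMeridian (p : Circle) : C(I, σ.nearSet N m) :=
  (σ.collarNear N m).comp ((ContinuousMap.const I 1).prodMk
    (farPlane.comp ((circleLoop p).prodMk (.const I radiusTwo))))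

/-- The meridian of the surface slides radially to the unit sphere. There it is the circle of radius
`1/2` about the knot, in the fibre over `0`, and it slides on through the annulus to the meridian
through `z × u`. -/
theorem exists_conj_nearMeridian {G : Type*} [Group G] (W : Holonomy (σ.nearSet N m) G)
    (p z u : Circle) : ∃ h, W (σ.nearMeridian N m p) =
      h * W ((σ.fibreNear N m).comp (N.meridianLoop z u)) * h⁻¹ := by
  let f : C(Circle × Set.Ici (1 : ℝ), σ.nearSet N m) :=
    (σ.collarNear N m).comp ((ContinuousMap.const _ 1).prodMk farPlane)
  obtain ⟨h₁, e₁⟩ := (W.comap f).exists_conj_circleLoop (p, radiusTwo)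
    (p, ⟨1, Set.mem_Ici.mpr le_rfl⟩)
  obtain ⟨h₂, e₂⟩ := (W.comap ((σ.fibreNear N m).comp N.annulus)).exists_conj_circleLoop
    (p, (1, TubedKnot.radiusHalf)) (u, (z, TubedKnot.radiusOne))
  refine ⟨h₁ * h₂, ?_⟩
  have e : f.comp ((circleLoop p).prodMk (.const I ⟨1, Set.mem_Ici.mpr le_rfl⟩)) =
      ((σ.fibreNear N m).comp N.annulus).comp
        ((circleLoop p).prodMk (.const I (1, TubedKnot.radiusHalf))) := by
    ext1 t
    refine Subtype.ext ?_
    have h1 : eucSq (farPlane (circleLoop p t, ⟨1, Set.mem_Ici.mpr le_rfl⟩) : ℝ × ℂ) = 1 := by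
      rw [eucSq_farPlane, one_pow]
    have := σ.inlY_collar_unit N m 1 (farPlane (circleLoop p t, ⟨1, Set.mem_Ici.mpr le_rfl⟩)) 0
      (by norm_num) (by simp) h1
    refine this.symm.trans ((σ.cylinder_unit N m _ 0).trans ?_)
    change σ.inrY N m (_, 0) = σ.inrY N m (_, 0)
    congr 2
    refine Subtype.ext (Eq.trans ?_ (N.coe_annulus_radiusHalf _).symm)
    change N.ballChart (farPlane (circleLoop p t, ⟨1, Set.mem_Ici.mpr le_rfl⟩)) = _
    simp [coe_farPlane]
  have e₁' : W (σ.nearMeridian N m p) = _ := e₁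
  have e₂' : W (((σ.fibreNear N m).comp N.annulus).comp
        ((circleLoop p).prodMk (.const I (1, TubedKnot.radiusHalf)))) =
      h₂ * W ((σ.fibreNear N m).comp (N.meridianLoop z u)) * h₂⁻¹ := e₂
  rw [e₁', Holonomy.comap_apply, e, e₂']
  group

/-! ### The overlap -/

/-- Radii and latitudes outside the ball. -/
abbrev ShellBox := ↥(Set.Ioi (1 : ℝ) ×ˢ Set.Ioo (-1 : ℝ) 1)

instance : ContractibleSpace ShellBox :=
  ((convex_Ioi (1 : ℝ)).prod (convex_Ioo (-1 : ℝ) 1)).contractibleSpace ⟨(2, 0), by simp⟩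

theorem far_spherical (q : Circle × ShellBox) :
    1 ≤ eucSq (spherical (q.1, q.2)) ∧ (spherical (q.1, q.2)).2 ≠ 0 := by
  have h1 : (1 : ℝ) < (q.2 : ℝ × ℝ).1 := q.2.2.1
  constructor
  · rw [eucSq_spherical q.2.2.2]; dsimp only; nlinarith
  · exact spherical_snd_ne_zero (zero_lt_one.trans h1) q.2.2.2

/-- Spherical coordinates outside the ball. -/
def shellFar : C(Circle × ShellBox, Far) where
  toFun q := ⟨spherical (q.1, q.2), far_spherical q⟩
  continuous_toFun := Continuous.subtype_mk (f := fun q : Circle × ShellBox =>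
    spherical (q.1, q.2)) (continuous_spherical.comp (by fun_prop)) far_spherical

theorem one_lt_eucSq_shellFar (q : Circle × ShellBox) : 1 < eucSq (shellFar q : ℝ × ℂ) := by
  have h1 : (1 : ℝ) < (q.2 : ℝ × ℝ).1 := q.2.2.1
  change 1 < eucSq (spherical (q.1, q.2))
  rw [eucSq_spherical q.2.2.2]; dsimp only; nlinarith

/-- The parametrization of the overlap of the two open sets. -/
def shell : C(Circle × (Circle × ShellBox), ↥(σ.outerSet N m ∩ σ.nearSet N m)) where
  toFun q := ⟨σ.collar N m (q.1, shellFar q.2), (σ.collar_mem_outerSet_iff N m _).mpr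
    (one_lt_eucSq_shellFar q.2), σ.collar_mem_nearSet N m _⟩
  continuous_toFun := ((σ.collar N m).continuous.comp (by fun_prop)).subtype_mk _

theorem exists_eq_collar (y : ↥(σ.outerSet N m ∩ σ.nearSet N m)) :
    ∃ q : Circle × Far, (y : σ.SurfaceCompl N m) = σ.collar N m q ∧
      σ.toOuter N m y = σ.toFun (q.1, q.2) := by
  obtain ⟨y, h1, h2⟩ := y
  rcases σ.eq_collar_or_inrY N m h2 with ⟨q, rfl⟩ | ⟨b, rfl⟩
  · exact ⟨q, rfl, σ.toOuter_inlY N m h1⟩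
  · exact absurd h1 (σ.inrY_notMem_outerSet N m b)

variable {σ N m} in
/-- The overlap is parametrized by spherical coordinates. -/
theorem exists_shellInv [T2Space X] (hcl : IsClosed F) :
    ∃ f : C(↥(σ.outerSet N m ∩ σ.nearSet N m), Circle × (Circle × ShellBox)),
      ∀ y, σ.shell N m (f y) = y := by
  have hc : Continuous fun y : ↥(σ.outerSet N m ∩ σ.nearSet N m) =>
      σ.coord (σ.toOuter N m y) := by
    refine σ.continuousOn_coord.comp_continuous ((continuousOn_toOuter hcl).comp_continuous
      continuous_subtype_val fun y => y.2.1) fun y => ?_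
    obtain ⟨q, -, h⟩ := σ.exists_eq_collar N m y
    exact ⟨_, h.symm⟩
  have hq : ∀ y : ↥(σ.outerSet N m ∩ σ.nearSet N m), ∃ q : Circle × Far,
      σ.coord (σ.toOuter N m y) = (q.1, (q.2 : ℝ × ℂ)) ∧
      (y : σ.SurfaceCompl N m) = σ.collar N m q ∧ 1 < eucSq (q.2 : ℝ × ℂ) := by
    intro y
    obtain ⟨q, h, h'⟩ := σ.exists_eq_collar N m y
    refine ⟨q, by rw [h', coord_apply], h, (σ.collar_mem_outerSet_iff N m q).mp (h ▸ y.2.1)⟩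
  have hne : ∀ y : ↥(σ.outerSet N m ∩ σ.nearSet N m), (σ.coord (σ.toOuter N m y)).2.2 ≠ 0 := by
    intro y
    obtain ⟨q, h, -⟩ := hq y
    rw [h]; exact q.2.2.2
  have hbox : ∀ y : ↥(σ.outerSet N m ∩ σ.nearSet N m),
      (sphericalInv ⟨_, hne y⟩).2 ∈ Set.Ioi (1 : ℝ) ×ˢ Set.Ioo (-1 : ℝ) 1 := by
    intro y
    refine ⟨?_, sphericalInv_mem _⟩
    obtain ⟨q, h, -, h'⟩ := hq y
    change 1 < √(eucSq (σ.coord (σ.toOuter N m y)).2)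
    rw [h]
    exact Real.lt_sqrt_of_sq_lt (by simpa using h')
  have hs : Continuous fun y : ↥(σ.outerSet N m ∩ σ.nearSet N m) =>
      sphericalInv ⟨_, hne y⟩ := sphericalInv.continuous.comp (hc.snd.subtype_mk _)
  refine ⟨⟨fun y => ((σ.coord (σ.toOuter N m y)).1, (sphericalInv ⟨_, hne y⟩).1,
    ⟨(sphericalInv ⟨_, hne y⟩).2, hbox y⟩),
    hc.fst.prodMk (hs.fst.prodMk (hs.snd.subtype_mk _))⟩, fun y => ?_⟩
  obtain ⟨q, h, h', -⟩ := hq y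
  refine Subtype.ext (Eq.trans ?_ h'.symm)
  change σ.collar N m _ = _
  congr 1
  have h1 := congrArg Prod.fst h
  refine Prod.ext h1 (Subtype.ext ?_)
  exact (spherical_sphericalInv ⟨_, hne y⟩).trans (congrArg Prod.snd h)

variable {σ N m} in
theorem pathConnectedSpace_overlap [T2Space X] (hcl : IsClosed F) :
    PathConnectedSpace ↥(σ.outerSet N m ∩ σ.nearSet N m) := by
  obtain ⟨f, hf⟩ := exists_shellInv (σ := σ) (N := N) (m := m) hcl
  exact Function.Surjective.pathConnectedSpace (f := σ.shell N m) (fun y => ⟨_, hf y⟩)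
    (σ.shell N m).continuous

/-- The base point of the overlap. -/
def overlapPoint (p : Circle) : ↥(σ.outerSet N m ∩ σ.nearSet N m) :=
  ⟨σ.collar N m (1, farPoint p), (σ.collar_mem_outerSet_iff N m _).mpr (by
    rw [farPoint, eucSq_farPlane]
    norm_num [radiusTwo]), σ.collar_mem_nearSet N m _⟩

theorem overlap_ext {q : Circle × Far} {y : ↥(σ.outerSet N m ∩ σ.nearSet N m)}
    (h : σ.collar N m q = y) : (σ.toOuter N m y) = σ.toFun (q.1, q.2) := by
  obtain ⟨y, hy⟩ := y
  subst h
  exact σ.toOuter_inlY N m hy.1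

variable {σ N m} in
/-- Holonomies on the overlap are determined by two loops. -/
theorem eq_of_overlap [T2Space X] (hcl : IsClosed F) {G : Type*} [Group G]
    (W W' : Holonomy ↥(σ.outerSet N m ∩ σ.nearSet N m) G) (p : Circle)
    {γ : C(I, ↥(σ.outerSet N m ∩ σ.nearSet N m))}
    (h0 : γ 0 = σ.overlapPoint N m p) (h1 : γ 1 = σ.overlapPoint N m p)
    (hmer : ∀ δ : C(I, ↥(σ.outerSet N m ∩ σ.nearSet N m)),
      (∀ t, (δ t : σ.SurfaceCompl N m) = σ.nearMeridian N m p t) → W δ = W' δ)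
    (hlong : ∀ δ : C(I, ↥(σ.outerSet N m ∩ σ.nearSet N m)),
      (∀ t, (δ t : σ.SurfaceCompl N m) = σ.collar N m (circleLoop 1 t, farPoint p)) →
      W δ = W' δ) :
    W γ = W' γ := by
  obtain ⟨f, hf⟩ := exists_shellInv (σ := σ) (N := N) (m := m) hcl
  have hγ : (σ.shell N m).comp (f.comp γ) = γ := ContinuousMap.ext fun t => hf (γ t)
  obtain ⟨n, k, hnk⟩ := Holonomy.circle_circle_prod_eq (G := G) (γ := f.comp γ)
    (congrArg f (h0.trans h1.symm))
  have hb : σ.shell N m (f.comp γ 0) = σ.overlapPoint N m p := (hf _).trans h0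
  generalize f.comp γ 0 = q at hnk hb
  obtain ⟨z, w, b⟩ := q
  -- The shell coordinates of the base point are known only through the point they represent, which
  -- determines them as far as needed because `σ` is injective.
  have hb' : ((z, (shellFar (w, b) : ℝ × ℂ)) : Circle × (ℝ × ℂ)) = (1, (farPoint p : ℝ × ℂ)) := by
    apply σ.injective
    have hc : σ.collar N m (z, shellFar (w, b)) = (σ.overlapPoint N m p : σ.SurfaceCompl N m) :=
      congrArg Subtype.val hb
    rw [← σ.overlap_ext N m hc]
    exact σ.overlap_ext N m (q := (1, farPoint p)) rfl
  have hz : z = 1 := congrArg Prod.fst hb'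
  have hv : (shellFar (w, b) : ℝ × ℂ) = farPoint p := congrArg Prod.snd hb'
  have e := hnk (W.comap (σ.shell N m))
  have e' := hnk (W'.comap (σ.shell N m))
  simp only [Holonomy.comap_apply, hγ] at e e'
  rw [e, e', hmer, hlong]
  · intro t
    change σ.collar N m (circleLoop z t, shellFar (w, b)) = _
    rw [hz, Subtype.ext hv]
  · intro t
    change σ.collar N m (z, shellFar (circleLoop w t, b)) =
      σ.collar N m (1, farPlane (circleLoop p t, radiusTwo))
    congr 1
    have h1 : (b : ℝ × ℝ).1 * (b : ℝ × ℝ).2 = 0 := congrArg Prod.fst hv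
    refine Prod.ext hz (Subtype.ext (Prod.ext h1 ?_))
    have h2 : ((b : ℝ × ℝ).1 * √(1 - (b : ℝ × ℝ).2 ^ 2) : ℝ) * (w : ℂ) = (2 : ℝ) * (p : ℂ) :=
      congrArg Prod.snd hv
    change ((b : ℝ × ℝ).1 * √(1 - (b : ℝ × ℝ).2 ^ 2) : ℝ) * ((circleLoop w t : Circle) : ℂ) =
      (2 : ℝ) * ((circleLoop p t : Circle) : ℂ)
    simp only [circleLoop, ContinuousMap.coe_mk, Circle.coe_mul]
    linear_combination (Circle.exp (2 * Real.pi * t) : ℂ) * h2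

end CurveTriv
end

/-! ### The homomorphism back to the quotient, and the collapse. -/

noncomputable section
open Topology
local notation "I" => unitInterval

namespace CurveTriv

variable {X : Type*} [TopologicalSpace X] [ChartedSpace (EuclideanSpace ℝ (Fin 4)) X] {F : Set X}
  (σ : CurveTriv F) (N : TubedKnot) (m : ℤ)

theorem unitVec_farPoint (p : Circle) : unitVec (farPoint p) = (0, (p : ℂ)) := by
  have h : eucSq (farPoint p : ℝ × ℂ) = 2 ^ 2 := eucSq_farPlane _
  rw [unitVec, h, Real.sqrt_sq zero_le_two, farPoint, coe_farPlane]
  simp [radiusTwo]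

section

variable [T2Space X]

/-- The collapse of the complement of the surface onto the outer piece. -/
def collapse : C(↥Fᶜ, σ.SurfaceCompl N m) :=
  (σ.inlY N m).comp σ.exists_retraction_outerCompl.choose

theorem collapse_apply (x : σ.OuterCompl) : σ.collapse N m ⟨x, x.2.2⟩ = σ.inlY N m x :=
  congrArg (σ.inlY N m) (σ.exists_retraction_outerCompl.choose_spec x)

theorem collapse_offAxis (z : Circle) (v : OffAxis) (w : Far) (h : (v : ℝ × ℂ) = w) :
    σ.collapse N m (σ.offAxis (z, v)) = σ.collar N m (z, w) := by
  have e : v = ⟨w, w.2.2⟩ := Subtype.ext h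
  subst e
  exact σ.collapse_apply N m ⟨_, (σ.notMem_ball_iff (z, w)).mpr w.2.1,
    fun h => w.2.2 ((σ.apply_mem_iff _).mp h)⟩

theorem collapse_meridian (p : Circle) (t : I) :
    σ.collapse N m (σ.meridian p t) = σ.nearMeridian N m p t :=
  σ.collapse_offAxis N m 1 _ (farPlane (circleLoop p t, radiusTwo)) rfl

/-- Pulling a holonomy back along the collapse loses nothing over the interior of the outer piece.
-/
theorem collapse_outerMap (hcl : IsClosed F) (y : σ.outerSet N m) :
    σ.collapse N m (σ.outerMap hcl y) = y := by
  obtain ⟨x, h, h'⟩ := σ.exists_eq_inlY N m y.2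
  rw [h, ← collapse_apply]
  exact congrArg _ (Subtype.ext h')

variable [SimplyConnectedSpace X]

variable {σ N m}

/-- The mapping of the fundamental group of the surgered complement to the quotient. -/
theorem exists_hom (hF : IsTame F) (hcl : IsClosed F) (hconn : IsPreconnected F) {d : ℕ}
    {x₀ : ↥Fᶜ} (hd : Nonempty (FundamentalGroup ↥Fᶜ x₀ ≃* Multiplicative (ZMod d))) {p : Circle}
    (hp : NullHomologous (σ.pushOff p)) (z u : Circle) :
    ∃ Ψ : FundamentalGroup (σ.SurfaceCompl N m) (σ.fibreIncl N m (N.torusPoint z u)) →*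
        FundamentalGroup N.ArcCompl (N.torusPoint z u) ⧸
          Subgroup.normalClosure (N.relators m d z u),
      ∀ β, Ψ (FundamentalGroup.map (σ.fibreIncl N m) (N.torusPoint z u) β) =
        QuotientGroup.mk β := by
  let π := QuotientGroup.mk' (Subgroup.normalClosure (N.relators m d z u))
  let θ := Holonomy.ofHom π
  have hθ : ∀ β, θ.toHom (N.torusPoint z u) β = π β :=
    fun β => DFunLike.congr_fun (Holonomy.toHom_ofHom π) β
  -- The relators `β⁻¹ τ_*^m(β)` are exactly what makes the holonomy of the fibre invariant under
  -- the monodromy.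
  obtain ⟨W₁, hfib, hlong⟩ := exists_nearHolonomy (σ := σ) (N := N) (m := m) hcl θ
    (N.torusPoint z u) (fun γ h0 h1 => by
      let b : Path (N.torusPoint z u) (N.torusPoint z u) := ⟨γ, h0, h1⟩
      have e1 := hθ (FundamentalGroup.fromPath (Path.Homotopic.Quotient.mk b))
      have e2 := hθ (N.twistStar m z u (FundamentalGroup.fromPath (Path.Homotopic.Quotient.mk b)))
      rw [TubedKnot.toHom_twistStar] at e2
      exact e1.trans ((N.mk_twistStar m z u _).symm.trans e2.symm))
  obtain ⟨h, hh⟩ := σ.exists_conj_nearMeridian N m W₁ p z u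
  -- By the relator `μ^d`, up to conjugation. It allows a holonomy `W₂` on the complement of the
  -- surface in `X` with the same value on the meridian.
  have hpow : W₁ (σ.nearMeridian N m p) ^ d = 1 := by
    have hμ : π (N.meridian z u) ^ d = 1 := by
      rw [← map_pow]
      exact (QuotientGroup.eq_one_iff _).mpr (Subgroup.subset_normalClosure (.inl rfl))
    rw [hh, hfib, ← TubedKnot.toHom_meridian, hθ, conj_pow, hμ]
    group
  obtain ⟨W₂, hW₂⟩ := σ.exists_holonomy_meridian_eq hF hcl hconn hd p hpow
  have := pathConnectedSpace_overlap (σ := σ) (N := N) (m := m) hcl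
  obtain ⟨W, hW⟩ := Holonomy.exists_extension (isOpen_outerSet hcl) (isOpen_nearSet hcl)
    (σ.mem_outerSet_or_nearSet N m) (W₂.comap (σ.outerMap hcl)) W₁ (σ.overlapPoint N m p)
    (fun γ h0 h1 => by
      have hmap : ∀ (δ : C(I, ↥(σ.outerSet N m ∩ σ.nearSet N m))) (t : I) (q : Circle × Far),
          (δ t : σ.SurfaceCompl N m) = σ.collar N m q →
          σ.toOuter N m (δ t) = σ.toFun (q.1, q.2) :=
        fun δ t q h => σ.overlap_ext N m h.symm
      let iU : C(↥(σ.outerSet N m ∩ σ.nearSet N m), σ.outerSet N m) :=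
        (inclSet _).intoSet _ fun y => y.2.1
      let iV : C(↥(σ.outerSet N m ∩ σ.nearSet N m), σ.nearSet N m) :=
        (inclSet _).intoSet _ fun y => y.2.2
      refine eq_of_overlap hcl ((W₂.comap (σ.outerMap hcl)).comap iU) (W₁.comap iV) p h0 h1 ?_ ?_
      · intro δ hδ
        have e1 : (σ.outerMap hcl).comp (iU.comp δ) = σ.meridian p := by
          ext t
          exact hmap δ t (1, farPlane (circleLoop p t, radiusTwo)) (hδ t)
        have e2 : iV.comp δ = σ.nearMeridian N m p := by
          ext1 t
          exact Subtype.ext (hδ t)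
        simp only [Holonomy.comap_apply, e1, e2, hW₂]
      · intro δ hδ
        have e1 : (σ.outerMap hcl).comp (iU.comp δ) = σ.offAxis.comp
            ((circleLoop 1).prodMk (.const I ⟨farPoint p, (farPoint p).2.2⟩)) := by
          ext t
          exact hmap δ t (circleLoop 1 t, farPoint p) (hδ t)
        have e2 : iV.comp δ = (σ.collarNear N m).comp
            ((circleLoop 1).prodMk (.const I (farPoint p))) := by
          ext1 t
          exact Subtype.ext (hδ t)
        simp only [Holonomy.comap_apply, e1, e2]
        -- On the longitude both holonomies are trivial: `W₂` because the push-off is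
        -- null-homologous, `W₁` because the annulus leads from the base point to the sphere through
        -- fixed points of the twist.
        rw [σ.eq_one_of_nullHomologous_pushOff hF hd hp W₂]
        let ε : Path ((u, (z, TubedKnot.radiusOne)) : Circle × (Circle × Set.Icc (1 / 2 : ℝ) 1))
          (p, (1, TubedKnot.radiusHalf)) := PathConnectedSpace.somePath _ _
        refine (hlong (farPoint p) (N.annulus.comp ε) ?_ ?_
          (fun s => N.twistMap_annulus m _) (circleLoop 1)).symm
        · change N.annulus (ε 0) = _
          rw [ε.source, N.annulus_radiusOne]
        · change (N.annulus (ε 1) : S3) = _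
          rw [ε.target, N.coe_annulus_radiusHalf, unitVec_farPoint])
  refine ⟨W.toHom _, fun β => ?_⟩
  rw [Holonomy.toHom_map]
  induction β using Path.Homotopic.Quotient.ind with | mk b => ?_
  refine Eq.trans ?_ (hθ _)
  exact (hW ((σ.fibreNear N m).comp b)).trans (hfib b)

/-! ### The relations -/

/-- This is `t = 1`: the loop traced by the base point around the mapping torus slides through the
annulus, fixed by the twist, to `∂B³`, where it is the push-off of `α` in the direction `p`. -/
theorem eq_one_inrY (hF : IsTame F) {d : ℕ}
    {x₀ : ↥Fᶜ} (hd : Nonempty (FundamentalGroup ↥Fᶜ x₀ ≃* Multiplicative (ZMod d))) {p : Circle}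
    (hp : NullHomologous (σ.pushOff p)) (z u : Circle) {G : Type*} [Group G]
    (W : Holonomy (σ.SurfaceCompl N m) G) :
    W ((σ.inrY N m).comp ((ContinuousMap.const I (N.torusPoint z u)).prodMk (.id I))) = 1 := by
  let ε : Path ((u, (z, TubedKnot.radiusOne)) : Circle × (Circle × Set.Icc (1 / 2 : ℝ) 1))
          (p, (1, TubedKnot.radiusHalf)) := PathConnectedSpace.somePath _ _
  have hε0 : N.annulus (ε 0) = N.torusPoint z u := by rw [ε.source, N.annulus_radiusOne]
  have hε1 : N.annulus (ε 1) = N.annulus (p, (1, TubedKnot.radiusHalf)) := by rw [ε.target]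
  have hfix : ∀ s, σ.inrY N m (N.annulus (ε s), 1) = σ.inrY N m (N.annulus (ε s), 0) := by
    intro s
    rw [inrY_zero]
    congr 2
    exact (N.twistMap_annulus m _).symm
  let v₀ : OffAxis := ⟨(0, p), p.coe_ne_zero⟩
  have hsq := W.square
    (b := (σ.inrY N m).comp ((ContinuousMap.const I (N.torusPoint z u)).prodMk (.id I)))
    (t := (σ.collapse N m).comp (σ.offAxis.comp ((circleLoop 1).prodMk (.const I v₀))))
    (l := (σ.inrY N m).comp ((N.annulus.comp ε).prodMk (.const I 0)))
    (r := (σ.inrY N m).comp ((N.annulus.comp ε).prodMk (.const I 0)))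
    ((σ.inrY N m).comp ⟨fun q => (N.annulus (ε q.2), q.1), by fun_prop⟩)
    (fun s => by
      change σ.inrY N m (N.annulus (ε 0), s) = _
      rw [hε0]; rfl)
    hfix
    (fun s => by
      change σ.inrY N m (N.annulus (ε 1), s) = σ.collapse N m (σ.offAxis (circleLoop 1 s, v₀))
      have hn : ‖(p : ℂ)‖ = 1 := p.norm_coe
      have hv : eucSq (0, (p : ℂ)) = 1 := by simp [eucSq, hn]
      rw [σ.collapse_offAxis N m _ v₀ ⟨(0, p), hv.ge, p.coe_ne_zero⟩ rfl, hε1]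
      have e := σ.inlY_collar_unit N m (circleLoop 1 s) ⟨(0, p), hv.ge, p.coe_ne_zero⟩ s
        ⟨by linarith [s.2.1], s.2.2⟩ (by simp [circleLoop]) hv
      rw [← e, cylinder_unit]
      congr 2
      exact Subtype.ext (N.coe_annulus_radiusHalf p))
    (fun s => rfl)
  rw [← Holonomy.comap_apply W (σ.collapse N m),
    σ.eq_one_of_nullHomologous_pushOff hF hd hp, one_mul] at hsq
  exact mul_eq_left.mp hsq

/-- Sweeping a loop once around the mapping torus conjugates `τ^m ∘ b` into `b` by the trace of the
base point, which is trivial. -/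
theorem eq_fibreIncl_twist (hF : IsTame F) {d : ℕ}
    {x₀ : ↥Fᶜ} (hd : Nonempty (FundamentalGroup ↥Fᶜ x₀ ≃* Multiplicative (ZMod d))) {p : Circle}
    (hp : NullHomologous (σ.pushOff p)) (z u : Circle) {G : Type*} [Group G]
    (W : Holonomy (σ.SurfaceCompl N m) G) (b : Path (N.torusPoint z u) (N.torusPoint z u)) :
    W ((σ.fibreIncl N m).comp ((N.twistMap m).comp b)) = W ((σ.fibreIncl N m).comp b) := by
  have h1 := eq_one_inrY hF hd hp z u W
  have hfix : N.twistMap m (N.torusPoint z u) = N.torusPoint z u :=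
    N.twistArc_zpow_torusPoint m z u
  have hsq := W.square
    (b := (σ.fibreIncl N m).comp ((N.twistMap m).comp b))
    (t := (σ.fibreIncl N m).comp b)
    (l := (σ.inrY N m).comp ((ContinuousMap.const I (N.torusPoint z u)).prodMk (.id I)))
    (r := (σ.inrY N m).comp ((ContinuousMap.const I (N.torusPoint z u)).prodMk (.id I)))
    ((σ.inrY N m).comp ⟨fun q => (N.twistMap m (b q.1), q.2), by fun_prop⟩)
    (fun s => rfl)
    (fun s => by
      change σ.inrY N m (N.twistMap m (b 1), s) = _
      rw [b.target, hfix]; rfl)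
    (fun s => (σ.inrY_zero N m (b s)).symm)
    (fun s => by
      change σ.inrY N m (N.twistMap m (b 0), s) = _
      rw [b.source, hfix]; rfl)
  rwa [h1, one_mul, mul_one] at hsq

/-- Up to conjugation this is the meridian of the surface, whose `d`-th power already vanishes in
`X` before the surgery; the collapse carries the relation over. -/
theorem meridianLoop_pow (hF : IsTame F) {d : ℕ}
    {x₀ : ↥Fᶜ} (hd : Nonempty (FundamentalGroup ↥Fᶜ x₀ ≃* Multiplicative (ZMod d)))
    (z u : Circle) {G : Type*} [Group G] (W : Holonomy (σ.SurfaceCompl N m) G) :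
    W ((σ.fibreIncl N m).comp (N.meridianLoop z u)) ^ d = 1 := by
  obtain ⟨h, hh⟩ := σ.exists_conj_nearMeridian N m (W.comap (inclSet _)) 1 z u
  have h1 := σ.meridian_pow hF hd 1 (W.comap (σ.collapse N m))
  have e : W.comap (σ.collapse N m) (σ.meridian 1) =
      W.comap (inclSet _) (σ.nearMeridian N m 1) :=
    congrArg W (ContinuousMap.ext fun t => σ.collapse_meridian N m 1 t)
  rw [e, hh, conj_pow] at h1
  change h * W ((σ.fibreIncl N m).comp (N.meridianLoop z u)) ^ d * h⁻¹ = 1 at h1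
  exact conj_eq_one_iff.mp h1

theorem pathConnectedSpace_surfaceCompl (hF : IsTame F) :
    PathConnectedSpace (σ.SurfaceCompl N m) := by
  have : PathConnectedSpace ↥Fᶜ :=
    isPathConnected_iff_pathConnectedSpace.mp hF.isPathConnected_compl
  have h1 := isPathConnected_range (σ.collapse N m).continuous
  have h2 := isPathConnected_range (σ.inrY N m).continuous
  have hv : eucSq (0, ((1 : Circle) : ℂ)) = 1 := by simp [eucSq]
  have h3 := h1.union h2 ⟨σ.collapse N m (σ.offAxis (1, ⟨(0, (1 : Circle)), Circle.coe_ne_zero _⟩)),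
    ⟨_, rfl⟩, by
      rw [σ.collapse_offAxis N m _ _ ⟨(0, (1 : Circle)), hv.ge, Circle.coe_ne_zero _⟩ rfl]
      have e := σ.inlY_collar_unit N m 1 ⟨(0, (1 : Circle)), hv.ge, Circle.coe_ne_zero _⟩ 0
        (by norm_num) (by simp) hv
      rw [← e]
      exact ⟨_, (σ.cylinder_unit N m _ 0).symm⟩⟩
  rw [pathConnectedSpace_iff_univ]
  convert h3
  refine (Set.eq_univ_of_forall fun y => ?_).symm
  rcases σ.eq_inlY_or_inrY N m y with ⟨x, rfl⟩ | ⟨b, rfl⟩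
  · exact .inl ⟨_, σ.collapse_apply N m x⟩
  · exact .inr ⟨b, rfl⟩

theorem normalClosure_relators_le_ker (hF : IsTame F) {d : ℕ}
    {x₀ : ↥Fᶜ} (hd : Nonempty (FundamentalGroup ↥Fᶜ x₀ ≃* Multiplicative (ZMod d))) {p : Circle}
    (hp : NullHomologous (σ.pushOff p)) (z u : Circle) :
    Subgroup.normalClosure (N.relators m d z u) ≤
      (FundamentalGroup.map (σ.fibreIncl N m) (N.torusPoint z u)).ker := by
  have := pathConnectedSpace_surfaceCompl (σ := σ) (N := N) (m := m) hF
  let W : Holonomy (σ.SurfaceCompl N m) _ :=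
    Holonomy.taut (σ.fibreIncl N m (N.torusPoint z u))
  have hW : ∀ β, (W.comap (σ.fibreIncl N m)).toHom (N.torusPoint z u) β =
      FundamentalGroup.map (σ.fibreIncl N m) (N.torusPoint z u) β := by
    intro β
    rw [← Holonomy.toHom_map]
    exact DFunLike.congr_fun (Holonomy.toHom_ofHom (MonoidHom.id _)) _
  refine Subgroup.normalClosure_le_normal ?_
  rintro β (rfl | ⟨β, rfl⟩)
  · rw [SetLike.mem_coe, MonoidHom.mem_ker, map_pow, ← hW, TubedKnot.toHom_meridian]
    exact meridianLoop_pow hF hd z u W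
  · rw [SetLike.mem_coe, MonoidHom.mem_ker, map_mul, map_inv, inv_mul_eq_one, ← hW, ← hW]
    induction β using Path.Homotopic.Quotient.ind with | mk b => ?_
    refine Eq.trans ?_ (N.toHom_twistStar m (W.comap (σ.fibreIncl N m)) z u b).symm
    exact (eq_fibreIncl_twist hF hd hp z u W b).symm

end

end CurveTriv
end

/-! ### Surjectivity by parallel sections. -/

noncomputable section
open Topology
local notation "I" => unitInterval

/-- Parallel sections. -/
theorem Holonomy.exists_parallel {Z G S : Type*} [TopologicalSpace Z] [Group G] [MulAction G S]
    [PathConnectedSpace Z] (W : Holonomy Z G) (z₀ : Z) (s₀ : S)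
    (h : ∀ γ : C(I, Z), γ 0 = z₀ → γ 1 = z₀ → W γ • s₀ = s₀) :
    ∃ κ : Z → S, κ z₀ = s₀ ∧ ∀ γ, κ (γ 1) = W γ • κ (γ 0) := by
  refine ⟨fun z => W (spoke z₀ z : C(I, Z)) • s₀, ?_, fun γ => ?_⟩
  · change W (spoke z₀ z₀ : C(I, Z)) • s₀ = s₀
    exact h _ (Path.source _) (Path.target _)
  · have h1 := h (((spoke z₀ (γ 0)).trans γ.asPath).trans (spoke z₀ (γ 1)).symm : C(I, Z))
      (Path.source _) (Path.target _)
    rw [W.trans, W.trans, W.symm, mul_smul, mul_smul] at h1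
    have e : W (γ.asPath : C(I, Z)) = W γ := rfl
    rw [e] at h1
    exact (eq_inv_smul_iff.mp h1.symm)

namespace CurveTriv

variable {X : Type*} [TopologicalSpace X] [ChartedSpace (EuclideanSpace ℝ (Fin 4)) X] {F : Set X}
  (σ : CurveTriv F) (N : TubedKnot) (m : ℤ)

/-- The fibre coordinates for the two cuts differ by a deck transformation. -/
theorem fibrePt_turn_eq (y : σ.nearSet N m) :
    (σ.fibrePt N m half_mem_Ico y = σ.fibrePt N m zero_mem_Ico y ∧
      turn (1 / 2) (σ.ang N m y) = turn 0 (σ.ang N m y)) ∨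
    (σ.fibrePt N m half_mem_Ico y = N.twistMap m (σ.fibrePt N m zero_mem_Ico y) ∧
      turn (1 / 2) (σ.ang N m y) = turn 0 (σ.ang N m y) + 1) := by
  obtain ⟨y, hy'⟩ := y
  rcases σ.eq_collar_or_inrY N m hy' with ⟨q, rfl⟩ | ⟨b, rfl⟩
  · have h1 : σ.fibrePt N m half_mem_Ico ⟨_, hy'⟩ = σ.fibrePt N m zero_mem_Ico ⟨_, hy'⟩ :=
      Subtype.ext ((σ.fibre_collar N m half_mem_Ico q).trans
        (σ.fibre_collar N m zero_mem_Ico q).symm)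
    have h2 : N.twistMap m (σ.fibrePt N m zero_mem_Ico ⟨_, hy'⟩) =
        σ.fibrePt N m zero_mem_Ico ⟨_, hy'⟩ := by
      refine Subtype.ext ((N.coe_twistArc_zpow m _).trans ?_)
      change (N.twist ^ m) (σ.fibre N m zero_mem_Ico (σ.collar N m q)) =
        σ.fibre N m zero_mem_Ico (σ.collar N m q)
      rw [fibre_collar, N.twist_zpow_ballChart]
      rw [eucSq_unitVec (eucSq_pos_of_ne q.2.2.2)]
    rw [h2, h1]
    have ht := turn_mem (1 / 2) (σ.ang N m (σ.collar N m q))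
    have he := exp_turn (1 / 2) (σ.ang N m (σ.collar N m q))
    rcases le_or_gt (turn (1 / 2) (σ.ang N m (σ.collar N m q))) 0 with h | h
    · left
      refine ⟨rfl, ?_⟩
      have := turn_exp (c := 0) (t := turn (1 / 2) (σ.ang N m (σ.collar N m q)))
        ⟨by linarith [ht.1], h⟩
      rw [he] at this
      exact this.symm
    · right
      refine ⟨rfl, ?_⟩
      have := turn_exp (c := 0) (t := turn (1 / 2) (σ.ang N m (σ.collar N m q)) - 1)
        ⟨by linarith, by linarith [ht.2]⟩
      rw [mul_sub, mul_one, Circle.exp_sub, Circle.exp_two_pi, div_one, he] at this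
      linarith
  · dsimp only
    rw [ang_inrY]
    rcases le_or_gt (b.2 : ℝ) 0 with h | h
    · left
      have h' : (b.2 : ℝ) ≤ 1 / 2 := by linarith
      rw [turn_of_le half_mem_Ico h', turn_of_le zero_mem_Ico h]
      exact ⟨Subtype.ext ((σ.fibre_inrY_of_le N m half_mem_Ico h').trans
        (σ.fibre_inrY_of_le N m zero_mem_Ico h).symm),
        rfl⟩
    rcases le_or_gt (b.2 : ℝ) (1 / 2) with h' | h'
    · right
      rw [turn_of_le half_mem_Ico h', turn_of_lt zero_mem_Ico h]
      have e0 : σ.fibrePt N m zero_mem_Ico ⟨_, hy'⟩ = (N.twistArc ^ (-m)) b.1 :=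
        Subtype.ext (σ.fibre_inrY_of_lt N m zero_mem_Ico h)
      rw [e0]
      exact ⟨(Subtype.ext (σ.fibre_inrY_of_le N m half_mem_Ico h')).trans (zpow_neg_zpow N m b.1).symm,
        by ring⟩
    · left
      rw [turn_of_lt half_mem_Ico h', turn_of_lt zero_mem_Ico h]
      exact ⟨Subtype.ext ((σ.fibre_inrY_of_lt N m half_mem_Ico h').trans
        (σ.fibre_inrY_of_lt N m zero_mem_Ico h).symm),
        rfl⟩

variable {σ N m}

/-- Parallel sections over the fibre extend over the mapping torus. -/
theorem exists_parallel_near (hcl : IsClosed F) {G S : Type*} [Group G] [MulAction G S]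
    (W : Holonomy (σ.SurfaceCompl N m) G) (y₀ : N.ArcCompl) (hy₀ : N.twistMap m y₀ = y₀)
    (hW : W ((σ.inrY N m).comp ((ContinuousMap.const I y₀).prodMk (.id I))) = 1) (s₀ : S)
    (hs : ∀ γ : C(I, N.ArcCompl), γ 0 = y₀ → γ 1 = y₀ →
      W ((σ.fibreIncl N m).comp γ) • s₀ = s₀) :
    ∃ κ : σ.nearSet N m → S, κ (σ.fibreNear N m y₀) = s₀ ∧
      ∀ γ, κ (γ 1) = W ((inclSet _).comp γ) • κ (γ 0) := by
  -- The section is first built on the product of the fibre with `ℝ`, where a loop has the transport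
  -- of its projection to the fibre.
  obtain ⟨κ, hκ₀, hκ⟩ := (W.comap (σ.cylinder N m)).exists_parallel (y₀, 0) s₀ (by
    intro γ h0 h1
    let a : C(I, N.ArcCompl) := ⟨fun t => (γ t).1, by fun_prop⟩
    let b : C(I, ℝ) := ⟨fun t => (γ t).2, by fun_prop⟩
    have e := (W.comap (σ.cylinder N m)).prod_eq a b
    have e1 : W.comap (σ.cylinder N m) ((ContinuousMap.const I (a 1)).prodMk b) = 1 :=
      ((W.comap (σ.cylinder N m)).comap
        ((ContinuousMap.const ℝ (a 1)).prodMk (.id ℝ))).eq_one_of_simplyConnected (γ := b)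
        ((congrArg Prod.snd h0).trans (congrArg Prod.snd h1).symm)
    have hb : b 0 = 0 := congrArg Prod.snd h0
    rw [e1, one_mul, hb] at e
    have e2 : (σ.cylinder N m).comp (a.prodMk (.const I 0)) = (σ.fibreIncl N m).comp a :=
      ContinuousMap.ext fun t => σ.cylinder_unit N m (a t) 0
    have e3 : W.comap (σ.cylinder N m) γ = W ((σ.fibreIncl N m).comp a) :=
      e.trans (congrArg W e2)
    rw [e3]
    exact hs a (congrArg Prod.fst h0) (congrArg Prod.fst h1))
  have hκ₁ : κ (y₀, 1) = s₀ := by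
    have := hκ ((ContinuousMap.const I y₀).prodMk ⟨fun t : I => (t : ℝ), by fun_prop⟩)
    have e : (σ.cylinder N m).comp
        ((ContinuousMap.const I y₀).prodMk ⟨fun t : I => (t : ℝ), by fun_prop⟩) =
        (σ.inrY N m).comp ((ContinuousMap.const I y₀).prodMk (.id I)) :=
      ContinuousMap.ext fun t => σ.cylinder_unit N m y₀ t
    rw [Holonomy.comap_apply, e, hW, one_smul] at this
    exact this.trans hκ₀
  -- Invariance under the deck transformation. A path from `(y₀, 0)` to `(a, r)` and its translate
  -- from `(y₀, 1)` have the same image, and the section has the same value at their starting points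
  -- by `hW`.
  have hdeck : ∀ (a : N.ArcCompl) (r : ℝ), -1 ≤ r → r ≤ 0 →
      κ (N.twistMap m a, r + 1) = κ (a, r) := by
    intro a r hr1 hr0
    let q : Path y₀ a := PathConnectedSpace.somePath _ _
    have e1 := hκ ((q : C(I, N.ArcCompl)).prodMk ⟨fun t : I => (t : ℝ) * r, by fun_prop⟩)
    have e2 := hκ (((N.twistMap m).comp q).prodMk ⟨fun t : I => (t : ℝ) * r + 1, by fun_prop⟩)
    have e3 : (σ.cylinder N m).comp
        ((q : C(I, N.ArcCompl)).prodMk ⟨fun t : I => (t : ℝ) * r, by fun_prop⟩) =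
        (σ.cylinder N m).comp
          (((N.twistMap m).comp q).prodMk ⟨fun t : I => (t : ℝ) * r + 1, by fun_prop⟩) :=
      ContinuousMap.ext fun t => σ.cylinder_neg N m (r := t * r)
        (by nlinarith [t.2.1, t.2.2]) (by nlinarith [t.2.1, t.2.2]) (q t)
    rw [Holonomy.comap_apply] at e1 e2
    rw [e3] at e1
    simp [hy₀, hκ₀, hκ₁] at e1 e2
    rw [e1, e2]
  -- The value at `y` is the value on the cylinder at the end of the radial track, carried back
  -- along the track. By `hdeck` both cuts give the same result, so near any point a cut can be
  -- chosen that avoids it.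
  let κ₁ : σ.nearSet N m → S := fun y => (W (σ.track N m y))⁻¹ •
    κ (σ.fibrePt N m zero_mem_Ico y, turn 0 (σ.ang N m y))
  have hκ₁' : ∀ y, κ₁ y = (W (σ.track N m y))⁻¹ •
      κ (σ.fibrePt N m half_mem_Ico y, turn (1 / 2) (σ.ang N m y)) := by
    intro y
    have ht := turn_mem 0 (σ.ang N m y)
    rcases σ.fibrePt_turn_eq N m y with ⟨h1, h2⟩ | ⟨h1, h2⟩
    · rw [h1, h2]
    · rw [h1, h2, hdeck _ _ (by linarith [ht.1]) ht.2]
  have hloc : ∀ (c : ℝ) (hc : c ∈ Set.Ico (0 : ℝ) 1)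
      (_ : ∀ y, κ₁ y = (W (σ.track N m y))⁻¹ • κ (σ.fibrePt N m hc y, turn c (σ.ang N m y)))
      (γ : C(I, σ.nearSet N m)), (∀ t, γ t ∈ {y : σ.nearSet N m |
        σ.ang N m y ≠ Circle.exp (2 * Real.pi * c)}) →
      κ₁ (γ 1) = W ((inclSet _).comp γ) • κ₁ (γ 0) := by
    intro c hc hκc γ hγ
    obtain ⟨H, hH⟩ := exists_homotopy_track hcl γ
    let η : C(I, N.ArcCompl × ℝ) := ((σ.fibreMap N m hc hcl).comp (γ.intoSet _ hγ)).prodMk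
      ⟨fun t => turn c (σ.ang N m (γ t)), (continuousOn_turn c).comp_continuous
        ((continuous_ang hcl).comp γ.continuous) hγ⟩
    have hsq := W.square (b := (inclSet _).comp γ) (r := σ.track N m (γ 1))
      (t := (σ.cylinder N m).comp η) (l := σ.track N m (γ 0)) H
      (fun s => (hH s 0).trans (σ.track_zero N m (γ s))) (hH 1)
      (fun s => (hH s 1).trans (σ.track_one N m hc (γ s))) (hH 0)
    have hη : κ (η 1) = _ := hκ η
    rw [hκc, hκc, inv_smul_eq_iff, smul_smul, smul_smul, hsq, mul_inv_cancel_right]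
    exact hη
  refine ⟨κ₁, ?_, fun γ => ?_⟩
  · have h1 : W (σ.track N m (σ.fibreNear N m y₀)) = 1 := W.const (σ.inrY N m (y₀, 0))
    have h2 : σ.fibrePt N m zero_mem_Ico (σ.fibreNear N m y₀) = y₀ :=
      Subtype.ext (σ.fibre_inrY_of_le N m zero_mem_Ico le_rfl)
    have h3 : turn 0 (σ.ang N m (σ.fibreNear N m y₀)) = 0 :=
      turn_of_le zero_mem_Ico (t := 0) le_rfl
    simp only [κ₁]
    rw [h1, h2, h3, hκ₀, inv_one, one_smul]
  · refine Holonomy.smul_eq_of_cover (W.comap (inclSet _)) (ι := Bool) (U := fun b =>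
      {y : σ.nearSet N m | σ.ang N m y ≠ Circle.exp (2 * Real.pi * if b then 0 else 1 / 2)})
      (fun b => isOpen_compl_singleton.preimage (continuous_ang hcl)) (fun y => ?_) κ₁
      (fun b γ hγ => ?_) γ
    · by_cases h : σ.ang N m y = 1
      · refine ⟨false, ?_⟩
        change σ.ang N m y ≠ Circle.exp (2 * Real.pi * (1 / 2))
        rw [h, exp_two_pi_mul_half]
        exact Circle.one_ne_neg_one
      · refine ⟨true, ?_⟩
        change σ.ang N m y ≠ Circle.exp (2 * Real.pi * 0)
        rwa [exp_two_pi_mul_zero]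
    · cases b
      · exact hloc _ half_mem_Ico hκ₁' γ hγ
      · exact hloc _ zero_mem_Ico (fun y => rfl) γ hγ

/-- Let `H` be the image of the fibre group in `E`. A parallel section of the cosets `E ⧸ H`, equal
to the trivial coset at the base point, exists over the mapping torus because fibre loops fix that
coset and `t = 1`. It extends over the outer piece because loops there act as powers of the
meridian, which is also a loop near the mapping torus. Any loop then carries the trivial coset to
itself, so its class lies in `H`. -/
theorem surjective_map_fibreIncl [T2Space X] [SimplyConnectedSpace X] (hF : IsTame F)
    (hcl : IsClosed F) (hconn : IsPreconnected F) {d : ℕ}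
    {x₀ : ↥Fᶜ} (hd : Nonempty (FundamentalGroup ↥Fᶜ x₀ ≃* Multiplicative (ZMod d))) {p : Circle}
    (hp : NullHomologous (σ.pushOff p)) (z u : Circle) :
    Function.Surjective (FundamentalGroup.map (σ.fibreIncl N m) (N.torusPoint z u)) := by
  classical
  have := pathConnectedSpace_surfaceCompl (σ := σ) (N := N) (m := m) hF
  have : PathConnectedSpace ↥Fᶜ :=
    isPathConnected_iff_pathConnectedSpace.mp hF.isPathConnected_compl
  let E := FundamentalGroup (σ.SurfaceCompl N m) (σ.fibreIncl N m (N.torusPoint z u))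
  let H : Subgroup E := (FundamentalGroup.map (σ.fibreIncl N m) (N.torusPoint z u)).range
  let W : Holonomy (σ.SurfaceCompl N m) E :=
    Holonomy.taut (σ.fibreIncl N m (N.torusPoint z u))
  have hW : ∀ β : E, W.toHom _ β = β :=
    fun β => DFunLike.congr_fun (Holonomy.toHom_ofHom (MonoidHom.id _)) β
  obtain ⟨κ₁, hκ₀, hκ₁⟩ := exists_parallel_near hcl W (N.torusPoint z u)
    (N.twistArc_zpow_torusPoint m z u) (eq_one_inrY hF hd hp z u W) ((1 : E) : E ⧸ H) (by
      intro γ h0 h1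
      let b : Path (N.torusPoint z u) (N.torusPoint z u) := ⟨γ, h0, h1⟩
      have e : W ((σ.fibreIncl N m).comp γ) = FundamentalGroup.map (σ.fibreIncl N m)
          (N.torusPoint z u) (FundamentalGroup.fromPath (Path.Homotopic.Quotient.mk b)) := by
        rw [← hW (FundamentalGroup.map _ _ _)]; rfl
      change (((_ * 1 : E)) : E ⧸ H) = _
      rw [mul_one, e]
      refine QuotientGroup.eq.mpr ?_
      rw [mul_one]
      exact H.inv_mem ⟨_, rfl⟩)
  have hmer : W (σ.collapse N m |>.comp (σ.meridian p)) •
      κ₁ ⟨_, (σ.overlapPoint N m p).2.2⟩ = κ₁ ⟨_, (σ.overlapPoint N m p).2.2⟩ := by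
    have e := hκ₁ (σ.nearMeridian N m p)
    have e0 : σ.nearMeridian N m p 0 = ⟨_, (σ.overlapPoint N m p).2.2⟩ := by
      refine Subtype.ext ?_
      change σ.collar N m (1, farPlane (circleLoop p 0, radiusTwo)) = _
      rw [circleLoop_zero]; rfl
    have e1 : σ.nearMeridian N m p 1 = ⟨_, (σ.overlapPoint N m p).2.2⟩ := by
      refine Subtype.ext ?_
      change σ.collar N m (1, farPlane (circleLoop p 1, radiusTwo)) = _
      rw [circleLoop_one]; rfl
    rw [e0, e1] at e
    have e2 : (σ.collapse N m).comp (σ.meridian p) = (inclSet _).comp (σ.nearMeridian N m p) :=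
      ContinuousMap.ext fun t => σ.collapse_meridian N m p t
    rw [e2]
    exact e.symm
  obtain ⟨κ₂, hκ₂₀, hκ₂⟩ := (W.comap (σ.collapse N m)).exists_parallel
    (σ.offAxis (1, axisCircle 2 two_pos p)) (κ₁ ⟨_, (σ.overlapPoint N m p).2.2⟩) (by
      intro γ h0 h1
      obtain ⟨k, hk⟩ := σ.exists_eq_meridian_zpow hF hcl hconn hd p (W.comap (σ.collapse N m))
        h0 h1
      rw [hk]
      exact (MulAction.stabilizer E _).zpow_mem (MulAction.mem_stabilizer_iff.mpr hmer) k)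
  -- The last alternative never occurs, since the two open sets cover.
  let κ : σ.SurfaceCompl N m → E ⧸ H := fun y =>
    if h : y ∈ σ.nearSet N m then κ₁ ⟨y, h⟩ else
      if h : y ∈ σ.outerSet N m then κ₂ (σ.outerMap hcl ⟨y, h⟩) else ((1 : E) : E ⧸ H)
  have hnear : ∀ y : σ.nearSet N m, κ y = κ₁ y := fun y => dif_pos y.2
  -- The two sections agree at the base point of the overlap and are parallel for the same holonomy,
  -- so they agree throughout the path-connected overlap.
  have hovl : ∀ y : ↥(σ.outerSet N m ∩ σ.nearSet N m),
      κ₁ ⟨(y : σ.SurfaceCompl N m), y.2.2⟩ =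
        κ₂ (σ.outerMap (N := N) (m := m) hcl ⟨(y : σ.SurfaceCompl N m), y.2.1⟩) := by
    intro y
    have := pathConnectedSpace_overlap (σ := σ) (N := N) (m := m) hcl
    let γ : Path (σ.overlapPoint N m p) y := PathConnectedSpace.somePath _ _
    let iU : C(↥(σ.outerSet N m ∩ σ.nearSet N m), σ.outerSet N m) :=
      (inclSet _).intoSet _ fun y => y.2.1
    let iV : C(↥(σ.outerSet N m ∩ σ.nearSet N m), σ.nearSet N m) :=
      (inclSet _).intoSet _ fun y => y.2.2
    let δ : C(I, ↥(σ.outerSet N m ∩ σ.nearSet N m)) := γ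
    have e1 : κ₁ (iV (γ 1)) = _ := hκ₁ (iV.comp δ)
    have e2 : κ₂ (σ.outerMap hcl (iU (γ 1))) = _ := hκ₂ ((σ.outerMap hcl).comp (iU.comp δ))
    have e3 : (σ.collapse N m).comp ((σ.outerMap hcl).comp (iU.comp δ)) =
        (inclSet _).comp (iV.comp δ) :=
      ContinuousMap.ext fun t => σ.collapse_outerMap N m hcl (iU (δ t))
    have e4 : σ.outerMap hcl (iU (σ.overlapPoint N m p)) =
        σ.offAxis (1, axisCircle 2 two_pos p) :=
      Subtype.ext (σ.overlap_ext N m (q := (1, farPoint p)) (y := σ.overlapPoint N m p) rfl)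
    rw [Holonomy.comap_apply, e3] at e2
    have e5 : ((σ.outerMap hcl).comp (iU.comp δ)) 0 = σ.offAxis (1, axisCircle 2 two_pos p) := by
      rw [← e4]; exact congrArg (fun y => σ.outerMap hcl (iU y)) γ.source
    have e6 : (iV.comp δ) 0 = ⟨_, (σ.overlapPoint N m p).2.2⟩ := congrArg iV γ.source
    rw [e5, hκ₂₀] at e2
    rw [e6] at e1
    have e7 := e1.trans e2.symm
    rw [γ.target] at e7
    exact e7
  have hout : ∀ y : σ.outerSet N m, κ y = κ₂ (σ.outerMap hcl y) := by
    intro y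
    by_cases h : (y : σ.SurfaceCompl N m) ∈ σ.nearSet N m
    · exact (hnear ⟨y, h⟩).trans (hovl ⟨y, y.2, h⟩)
    · exact (dif_neg h).trans (dif_pos y.2)
  have hκ := Holonomy.smul_eq_of_cover W (ι := Bool)
    (U := fun b => if b then σ.outerSet N m else σ.nearSet N m) (fun b => by
      cases b
      · exact isOpen_nearSet hcl
      · exact isOpen_outerSet hcl) (fun y => (σ.mem_outerSet_or_nearSet N m y).elim
        (fun h => ⟨true, h⟩) fun h => ⟨false, h⟩) κ (fun b γ hγ => by
      cases b
      · have := hκ₁ (γ.intoSet _ hγ)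
        rw [← hnear, ← hnear] at this
        exact this
      · have := hκ₂ ((σ.outerMap hcl).comp (γ.intoSet (σ.outerSet N m) hγ))
        have e : (σ.collapse N m).comp ((σ.outerMap hcl).comp
            (γ.intoSet (σ.outerSet N m) hγ)) = γ :=
          ContinuousMap.ext fun t => σ.collapse_outerMap N m hcl _
        rw [Holonomy.comap_apply, e] at this
        have h1 := hout ⟨γ 1, hγ 1⟩
        have h0 := hout ⟨γ 0, hγ 0⟩
        exact h1.trans (this.trans (congrArg _ h0.symm)))
  intro β
  have hκ₀' : κ (σ.fibreIncl N m (N.torusPoint z u)) = ((1 : E) : E ⧸ H) :=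
    (hnear (σ.fibreNear N m (N.torusPoint z u))).trans hκ₀
  suffices h : (β : E) ∈ H from h
  induction β using Path.Homotopic.Quotient.ind with | mk b => ?_
  have h1 := hκ b
  have h2 : W (b : C(I, σ.SurfaceCompl N m)) =
      FundamentalGroup.fromPath (Path.Homotopic.Quotient.mk b) :=
    hW (FundamentalGroup.fromPath (Path.Homotopic.Quotient.mk b))
  have h3 : κ ((b : C(I, σ.SurfaceCompl N m)) 0) = ((1 : E) : E ⧸ H) :=
    (congrArg κ b.source).trans hκ₀'
  have h4 : κ ((b : C(I, σ.SurfaceCompl N m)) 1) = ((1 : E) : E ⧸ H) :=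
    (congrArg κ b.target).trans hκ₀'
  rw [h2, h3, h4] at h1
  have h5 : ((1 : E) : E ⧸ H) =
      ((FundamentalGroup.fromPath (Path.Homotopic.Quotient.mk b) * 1 : E) : E ⧸ H) := h1
  have h6 := QuotientGroup.eq.mp h5
  rwa [inv_one, one_mul, mul_one] at h6

end CurveTriv
end

/-! ### The isomorphism. -/

theorem lemma3
    {X : Type*} [TopologicalSpace X] [T2Space X] [SecondCountableTopology X]
    [ChartedSpace (EuclideanSpace ℝ (Fin 4)) X] [IsManifold (𝓡 4) ∞ X] [SimplyConnectedSpace X]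
    {S : Type*} [TopologicalSpace S] [CompactSpace S] [ConnectedSpace S]
    [ChartedSpace (EuclideanSpace ℝ (Fin 2)) S] [IsManifold (𝓡 2) ∞ S]
    (ι : S → X) (hι : Manifold.IsSmoothEmbedding (𝓡 2) (𝓡 4) ∞ ι)
    (d : ℕ) (x₀ : {x : X // x ∉ Set.range ι})
    (hd : Nonempty
      (FundamentalGroup {x : X // x ∉ Set.range ι} x₀ ≃* Multiplicative (ZMod d)))
    (σ : CurveTriv (Set.range ι)) (p : Circle) (hσ : NullHomologous (σ.pushOff p))
    (N : TubedKnot) (m : ℤ) (z u : Circle) :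
    ∃ Φ : FundamentalGroup N.ArcCompl (N.torusPoint z u) ⧸
          Subgroup.normalClosure (N.relators m d z u) ≃*
        FundamentalGroup (σ.SurfaceCompl N m) (σ.fibreIncl N m (N.torusPoint z u)),
      ∀ β : FundamentalGroup N.ArcCompl (N.torusPoint z u),
        Φ (QuotientGroup.mk β) =
          FundamentalGroup.map (σ.fibreIncl N m) (N.torusPoint z u) β := by
  have hF : IsTame (Set.range ι) := IsTame.of_isSmoothEmbedding hι
  have hcont : Continuous ι := hι.isEmbedding.continuous
  have hcl : IsClosed (Set.range ι) := (isCompact_range hcont).isClosed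
  have hconn : IsPreconnected (Set.range ι) := isPreconnected_range hcont
  obtain ⟨Ψ, hΨ⟩ := CurveTriv.exists_hom (N := N) (m := m) hF hcl hconn hd hσ z u
  let f := QuotientGroup.lift (Subgroup.normalClosure (N.relators m d z u))
    (FundamentalGroup.map (σ.fibreIncl N m) (N.torusPoint z u))
    (CurveTriv.normalClosure_relators_le_ker hF hd hσ z u)
  have hf : ∀ β, f (QuotientGroup.mk β) =
      FundamentalGroup.map (σ.fibreIncl N m) (N.torusPoint z u) β := fun β => rfl
  have hinj : Function.Injective f := by
    refine Function.LeftInverse.injective (g := Ψ) fun x => ?_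
    induction x using QuotientGroup.induction_on with | H β => ?_
    rw [hf, hΨ]
  have hsurj : Function.Surjective f := by
    intro y
    obtain ⟨β, rfl⟩ := CurveTriv.surjective_map_fibreIncl hF hcl hconn hd hσ z u y
    exact ⟨QuotientGroup.mk β, rfl⟩
  exact ⟨MulEquiv.ofBijective f ⟨hinj, hsurj⟩, hf⟩
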